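/- A deterministic Markov decision problem (DMDP) consists of a finite set $S$ of $n\ge 1$ states, a finite set $A$ of $k$ actions, a transition map $S\times A\to S$, $(s,a)\mapsto s\cdot a$, and rewards $R(s,a)\in\mathbb{R}$. For a policy $\pi:S\to A$ and $\gamma\in[0,1)$ let $V^\pi_\gamma(s)=\sum_{t\ge 0}\gamma^tR(s^t,\pi(s^t))$, where $s^0=s$ and $s^{t+1}=s^t\cdot\pi(s^t)$. The policy $\pi$ is Blackwell optimal if there is $\gamma'\in[0,1)$ such that $V^\pi_\gamma(s)\ge V^{\pi'}_\gamma(s)$ for all $s\in S$, all policies $\pi'$ and all $\gamma\in[\gamma',1)$. Let $P^\pi$ be the transition matrix of $\pi$. Cramer's rule for $(I-\gamma P^\pi)V^\pi=(R(s,\pi(s)))_{s}$ expresses $V^\pi(s)$, and hence $Q^\pi(s,a)=R(s,a)+\gamma V^\pi(s\cdot a)$, as a rational function of the indeterminate $\gamma$. Order the real rational functions as follows (the $\mu$-ordering): if $r_1-r_2=\frac{(1-x)^{c_1}\bar\eta(x)}{(1-x)^{c_2}\bar\delta(x)}$ is non-zero, with polynomials $\bar\eta,\bar\delta$ satisfying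 $\bar\eta(1)\ne 0\ne\bar\delta(1)$, then $r_1\succ r_2$ iff $\bar\eta(1)\bar\delta(1)>0$; if $r_1=r_2$ then neither $r_1\succ r_2$ nor $r_2\succ r_1$. The Max-Gain procedure starts from an arbitrary policy. In each iteration it selects a pair $(s,a)$ whose gain $Q^\pi(s,a)-V^\pi(s)$ is maximal in the $\mu$-ordering (ties are broken arbitrarily). If this gain is $\succ 0$, then $\pi(s)$ is replaced by $a$; otherwise (that is, if no gain is $\succ 0$) the procedure stops and returns $\pi$. **Theorem.** For every DMDP, every initial policy and every way of breaking ties, the procedure stops after finitely many iterations, and the returned policy is Blackwell optimal. There is an absolute constant $C$ such that, for $n\ge 2$, it makes at most $C\,n^7k^3\log^2 n$ iterations. Moreover, there is a single program, independent of $n$, $k$ and the DMDP, for a random access machine with exact real arithmetic which, given a DMDP and an initial policy, carries the procedure out for some way of breaking ties, outputs the visited policies, the last of which is Blackwell optimal, and for $n\ge 2$ executes in total at most $C\,n^7k^3\log^2 n$ elementary steps, regardless of the magnitude of the rewards. Here the elementary steps, each of unit cost, are $+,-,\times,/$ on real numbers, addition and truncated subtraction of natural numbers, assignments, reading or writing an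 entry of an array with at most two indices, and comparisons of two real or two natural numbers. -/

import Mathlib

noncomputable section

namespace BlackwellDMDP

/-! ### Deterministic Markov decision problems and Blackwell optimality -/

/-- A deterministic MDP with state set `S` and action set `A`: taking action `a` in state `s` leads
with probability one to `next s a` and yields the (mean) reward `reward s a`. -/
structure DMDP (S A : Type*) where
  next : S → A → S
  reward : S → A → ℝ

namespace DMDP

variable {S A : Type*} (M : DMDP S A)

/-- The state visited at time `t` when the policy `π` is followed from `s`. -/
def stateAt (π : S → A) (s : S) : ℕ → S
  | 0 => s
  | t + 1 => M.next (stateAt π s t) (π (stateAt π s t))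

/-- The discounted value `V_γ^π(s) = ∑_t γ^t R(s^t, π(s^t))`. -/
def value (γ : ℝ) (π : S → A) (s : S) : ℝ :=
  ∑' t : ℕ, γ ^ t * M.reward (M.stateAt π s t) (π (M.stateAt π s t))

/-- `π` is Blackwell optimal: it is discount-optimal for every discount factor in some
interval `[γ', 1)`. -/
def IsBlackwellOptimal (π : S → A) : Prop :=
  ∃ γ' : ℝ, 0 ≤ γ' ∧ γ' < 1 ∧
    ∀ γ : ℝ, γ' ≤ γ → γ < 1 → ∀ (π' : S → A) (s : S), M.value γ π' s ≤ M.value γ π s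

end DMDP

/-! ### The ordering of rational functions to the left of `1` -/

/-- If `p = (1 - X)^c * q` with `c` the multiplicity of the root `1` of `p ≠ 0`, this is `q(1)`;
for `p = 0` it is `0`. -/
def leadAtOne (p : Polynomial ℝ) : ℝ :=
  (-1) ^ p.rootMultiplicity 1 *
    (p /ₘ (Polynomial.X - Polynomial.C 1) ^ p.rootMultiplicity 1).eval 1

/-- The `μ`-ordering `f ≻ g` of rational functions. -/
def MuGT (f g : RatFunc ℝ) : Prop :=
  0 < leadAtOne (f - g).num * leadAtOne (f - g).denom

/-! ### The Max-Gain rule under the `μ`-ordering -/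

namespace DMDP

variable {S A : Type*} [Fintype S] [DecidableEq S] (M : DMDP S A)

/-- The matrix `I - γ P^π`, with the discount factor `γ` as indeterminate. -/
def bellmanMatrix (π : S → A) : Matrix S S (Polynomial ℝ) :=
  1 - (Polynomial.X : Polynomial ℝ) •
    Matrix.of fun s s' => if M.next s (π s) = s' then (1 : Polynomial ℝ) else 0

/-- The value `V^π(s)` as a rational function of the discount factor, by Cramer's rule. -/
def ratValue (π : S → A) (s : S) : RatFunc ℝ :=
  algebraMap (Polynomial ℝ) (RatFunc ℝ)
      ((M.bellmanMatrix π).cramer (fun s' => Polynomial.C (M.reward s' (π s'))) s) /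
    algebraMap (Polynomial ℝ) (RatFunc ℝ) (M.bellmanMatrix π).det

/-- The action value `Q^π(s, a)` as a rational function of the discount factor. -/
def ratQ (π : S → A) (s : S) (a : A) : RatFunc ℝ :=
  RatFunc.C (M.reward s a) + RatFunc.X * M.ratValue π (M.next s a)

/-- The gain `Q^π(s, a) - V^π(s)` as a rational function of the discount factor. -/
def ratGain (π : S → A) (s : S) (a : A) : RatFunc ℝ :=
  M.ratQ π s a - M.ratValue π s

/-- `(s, a)` attains the maximum of the gain in the `μ`-ordering. -/
def IsMaxGain (π : S → A) (s : S) (a : A) : Prop :=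
  ∀ (s' : S) (a' : A), ¬ MuGT (M.ratGain π s' a') (M.ratGain π s a)

/-- No gain is positive in the `μ`-ordering; this is when the procedure terminates. -/
def IsTerminal (π : S → A) : Prop :=
  ∀ (s : S) (a : A), ¬ MuGT (M.ratGain π s a) 0

/-- One iteration: a pair `(s, a)` of maximal gain is selected, this gain is positive, and the
action in `s` is switched to `a`. Ties are broken arbitrarily. -/
def Step (π π' : S → A) : Prop :=
  ∃ (s : S) (a : A), M.IsMaxGain π s a ∧ MuGT (M.ratGain π s a) 0 ∧ π' = Function.update π s a

/-- `p 0, p 1, …, p N` are the policies visited in `N` iterations started from `π₀`. -/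
def IsRun (π₀ : S → A) (p : ℕ → S → A) (N : ℕ) : Prop :=
  p 0 = π₀ ∧ ∀ t < N, M.Step (p t) (p (t + 1))

end DMDP

/-! ### A random access machine over the reals with a step count -/

/-- Memory: variables and (doubly indexed) arrays holding natural numbers, and variables and
(doubly indexed) arrays holding real numbers. A program mentions finitely many of each. -/
structure Mem where
  nvar : ℕ → ℕ
  narr : ℕ → ℕ → ℕ → ℕ
  rvar : ℕ → ℝ
  rarr : ℕ → ℕ → ℕ → ℝ

/-- Elementary instructions. The arguments `x y z i j` name variables, `T` names an array. -/
inductive Instr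
  /-- `x := c` -/
  | nconst (x c : ℕ)
  /-- `x := y + z` -/
  | nadd (x y z : ℕ)
  /-- `x := max (y - z) 0` -/
  | nsub (x y z : ℕ)
  /-- `x := T[i, j]` -/
  | nload (x T i j : ℕ)
  /-- `T[i, j] := x` -/
  | nstore (T i j x : ℕ)
  /-- `x := 0` -/
  | rzero (x : ℕ)
  /-- `x := 1` -/
  | rone (x : ℕ)
  /-- `x := y + z` -/
  | radd (x y z : ℕ)
  /-- `x := y - z` -/
  | rsub (x y z : ℕ)
  /-- `x := y * z` -/
  | rmul (x y z : ℕ)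
  /-- `x := y / z` -/
  | rdiv (x y z : ℕ)
  /-- `x := T[i, j]` -/
  | rload (x T i j : ℕ)
  /-- `T[i, j] := x` -/
  | rstore (T i j x : ℕ)

/-- `f` with the entry at `(T, i, j)` replaced by `v`. -/
def update3 {α : Type*} (f : ℕ → ℕ → ℕ → α) (T i j : ℕ) (v : α) : ℕ → ℕ → ℕ → α :=
  fun T' i' j' => if T' = T ∧ i' = i ∧ j' = j then v else f T' i' j'

/-- The effect of an elementary instruction. -/
def Instr.apply (σ : Mem) : Instr → Mem
  | nconst x c => { σ with nvar := Function.update σ.nvar x c }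
  | nadd x y z => { σ with nvar := Function.update σ.nvar x (σ.nvar y + σ.nvar z) }
  | nsub x y z => { σ with nvar := Function.update σ.nvar x (σ.nvar y - σ.nvar z) }
  | nload x T i j => { σ with nvar := Function.update σ.nvar x (σ.narr T (σ.nvar i) (σ.nvar j)) }
  | nstore T i j x => { σ with narr := update3 σ.narr T (σ.nvar i) (σ.nvar j) (σ.nvar x) }
  | rzero x => { σ with rvar := Function.update σ.rvar x 0 }
  | rone x => { σ with rvar := Function.update σ.rvar x 1 }
  | radd x y z => { σ with rvar := Function.update σ.rvar x (σ.rvar y + σ.rvar z) }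
  | rsub x y z => { σ with rvar := Function.update σ.rvar x (σ.rvar y - σ.rvar z) }
  | rmul x y z => { σ with rvar := Function.update σ.rvar x (σ.rvar y * σ.rvar z) }
  | rdiv x y z => { σ with rvar := Function.update σ.rvar x (σ.rvar y / σ.rvar z) }
  | rload x T i j => { σ with rvar := Function.update σ.rvar x (σ.rarr T (σ.nvar i) (σ.nvar j)) }
  | rstore T i j x => { σ with rarr := update3 σ.rarr T (σ.nvar i) (σ.nvar j) (σ.rvar x) }

/-- Tests: strict comparison of two natural or of two real variables. -/
inductive Test
  | nlt (x y : ℕ)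
  | rlt (x y : ℕ)

/-- The test succeeds in memory state `σ`. -/
def Test.Holds (σ : Mem) : Test → Prop
  | nlt x y => σ.nvar x < σ.nvar y
  | rlt x y => σ.rvar x < σ.rvar y

/-- Programs. -/
inductive Prog
  | skip
  | instr (c : Instr)
  | seq (P Q : Prog)
  | ite (b : Test) (P Q : Prog)
  | while (b : Test) (P : Prog)

/-- `Exec P σ t σ'`: started in `σ`, the program `P` halts in `σ'` after `t` steps, where every
elementary instruction and every evaluation of a test is one step. -/
inductive Exec : Prog → Mem → ℕ → Mem → Prop
  | skip (σ : Mem) : Exec Prog.skip σ 1 σ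
  | instr (c : Instr) (σ : Mem) : Exec (Prog.instr c) σ 1 (c.apply σ)
  | seq {P Q : Prog} {σ σ' σ'' : Mem} {t u : ℕ} :
      Exec P σ t σ' → Exec Q σ' u σ'' → Exec (Prog.seq P Q) σ (t + u) σ''
  | ite_true {b : Test} {P Q : Prog} {σ σ' : Mem} {t : ℕ} :
      b.Holds σ → Exec P σ t σ' → Exec (Prog.ite b P Q) σ (t + 1) σ'
  | ite_false {b : Test} {P Q : Prog} {σ σ' : Mem} {t : ℕ} :
      ¬ b.Holds σ → Exec Q σ t σ' → Exec (Prog.ite b P Q) σ (t + 1) σ'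
  | while_true {b : Test} {P : Prog} {σ σ' σ'' : Mem} {t u : ℕ} :
      b.Holds σ → Exec P σ t σ' → Exec (Prog.while b P) σ' u σ'' →
        Exec (Prog.while b P) σ (t + u + 1) σ''
  | while_false {b : Test} {P : Prog} {σ : Mem} :
      ¬ b.Holds σ → Exec (Prog.while b P) σ 1 σ

/-- The memory `σ` holds the input: `n`, `k`, the transition table, the initial policy and the
reward table. The rest of the memory is arbitrary. -/
def HoldsInput {n k : ℕ} (M : DMDP (Fin n) (Fin k)) (π₀ : Fin n → Fin k) (σ : Mem) : Prop :=
  σ.nvar 0 = n ∧ σ.nvar 1 = k ∧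
    (∀ (s : Fin n) (a : Fin k), σ.narr 0 s a = M.next s a) ∧
    (∀ s : Fin n, σ.narr 1 s 0 = π₀ s) ∧
    ∀ (s : Fin n) (a : Fin k), σ.rarr 0 s a = M.reward s a

/-- The memory `σ` holds the output: the number `N` of iterations and the visited policies
`p 0, …, p N`, the last one being the computed policy. -/
def HoldsOutput {n k : ℕ} (p : ℕ → Fin n → Fin k) (N : ℕ) (σ : Mem) : Prop :=
  σ.nvar 2 = N ∧ ∀ t ≤ N, ∀ s : Fin n, σ.narr 2 t s = p t s

/-- The bound `n^7 k^3 log^2 n`. -/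
def bound (n k : ℕ) : ℝ :=
  (n : ℝ) ^ 7 * (k : ℝ) ^ 3 * Real.log n ^ 2

end BlackwellDMDP

end

/-!
A polynomial has constant sign to the left of `1`, namely that of `leadAtOne`, so the `μ`-ordering
compares rational functions by their values at all discount factors close to `1`
(`Represents.eventually_muGT_iff`). There are finitely many policies and pairs, hence one discount
factor `γ < 1` at which every `μ`-comparison of gains is a comparison of real numbers
(`DMDP.exists_discount`). A run under the `μ`-ordering is thus a run of the Max-Gain rule for this
fixed `γ`, and a terminal policy is optimal for all discount factors close to `1`.

**Iterations.** For fixed `γ` the argument of Post and Ye applies. The sum of the values of two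
policies differs by `∑ s, x s * gain s`, where the flux `x s` is the discounted number of visits to
`s` under the second policy, from all initial states. The flux lies in `[1, n]` off the cycles and
in `[1 / (1 - γ), n / (1 - γ)]` on them. Therefore a step that creates a cycle reduces the gap to the
optimum by a factor `1 - 1/n` (`GainStep.gap_le_of_creates`), and in a phase in which no cycle is
created each step reduces the gap to the last policy of the phase by a factor `1 - 1/n²`
(`GainStep.gap_le_of_agree`). A much smaller gap excludes the action that contributed most to the
old one. In a phase, after `O(n² log n)` steps an action is no longer used or a state has left the
cycles, so phases have length `O(n³ k log n)` (`DMDP.lt_phaseBound`). Globally, after `O(n log n)`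
creations of cycles an action is no longer used, or no longer used on a cycle, which gives
`O(n^5 k^2 log² n)` iterations (`DMDP.lt_runBound`).

**One iteration in `O(n² k)` steps.** With `ε = 1 - γ`, the Bellman equation turns into linear
equations for the coefficients of `ε² V(s)` as a power series in `ε` (`DMDP.IsExpansion`). Times the
determinant of `I - γ P`, a gain is a polynomial of degree at most `n + 1`; so a difference of gains
whose first `n + 3` coefficients vanish is zero, and the `μ`-ordering is the lexicographic ordering
of these coefficients (`DMDP.IsExpansion.muGT_iff`). The program finds the coefficients on a cycle
one after the other: each is determined up to a constant, fixed by the solvability of the equations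
for the next one. Off the cycles a state is treated after its successor. Every state is treated
once, at a cost of `O(n)` steps, and finding the cycles takes `O(n)` steps per state, whence `O(n²)`
for the evaluation (`runs_evalProg`) and `O(n² k)` for the comparison of all gains
(`runs_searchProg`).
-/

namespace BlackwellDMDP

/-! ### Discounted sums along a functional graph -/

section Discounted

open Function Finset

variable {S : Type*}

/-- The discounted sum `∑_t γ^t h(f^t s)` of `h` along the orbit of `s` under `f`. -/
noncomputable def discSum (γ : ℝ) (f : S → S) (h : S → ℝ) (s : S) : ℝ :=
  ∑' t : ℕ, γ ^ t * h (f^[t] s)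

theorem summable_discSum [Finite S] {γ : ℝ} (h0 : 0 ≤ γ) (h1 : γ < 1) (f : S → S) (h : S → ℝ)
    (s : S) : Summable fun t : ℕ => γ ^ t * h (f^[t] s) := by
  obtain ⟨B, hB⟩ := (Set.finite_range fun x => |h x|).bddAbove
  refine Summable.of_norm_bounded (g := fun t => γ ^ t * B)
    ((summable_geometric_of_lt_one h0 h1).mul_right B) fun t => ?_
  rw [norm_mul, Real.norm_eq_abs, Real.norm_eq_abs, abs_of_nonneg (pow_nonneg h0 t)]
  exact mul_le_mul_of_nonneg_left (hB ⟨_, rfl⟩) (pow_nonneg h0 t)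

theorem discSum_eq_add [Finite S] {γ : ℝ} (h0 : 0 ≤ γ) (h1 : γ < 1) (f : S → S) (h : S → ℝ)
    (s : S) : discSum γ f h s = h s + γ * discSum γ f h (f s) := by
  rw [discSum, (summable_discSum h0 h1 f h s).tsum_eq_zero_add]
  simp only [discSum, ← tsum_mul_left, iterate_succ_apply, pow_zero, one_mul, pow_succ', mul_assoc,
    iterate_zero, id_eq]

theorem eq_sum_add_of_bellman {γ : ℝ} {f : S → S} {h u : S → ℝ}
    (hu : ∀ s, u s = h s + γ * u (f s)) (s : S) (T : ℕ) :
    u s = ∑ t ∈ range T, γ ^ t * h (f^[t] s) + γ ^ T * u (f^[T] s) := by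
  induction T with
  | zero => simp
  | succ T ih =>
    rw [ih, sum_range_succ, hu (f^[T] s), iterate_succ_apply']
    ring

/-- The discounted sum is the only solution of the Bellman equation. -/
theorem eq_discSum_of_bellman [Finite S] {γ : ℝ} (h0 : 0 ≤ γ) (h1 : γ < 1) {f : S → S}
    {h u : S → ℝ} (hu : ∀ s, u s = h s + γ * u (f s)) (s : S) : u s = discSum γ f h s := by
  have e1 := (summable_discSum h0 h1 f h s).hasSum.tendsto_sum_nat
  have e2 := (summable_discSum h0 h1 f u s).tendsto_atTop_zero
  have e3 := e1.add e2
  simp only [← eq_sum_add_of_bellman hu s, add_zero] at e3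
  exact tendsto_nhds_unique tendsto_const_nhds e3

theorem discSum_nonneg {γ : ℝ} (h0 : 0 ≤ γ) {f : S → S} {h : S → ℝ} (hh : ∀ s, 0 ≤ h s) (s : S) :
    0 ≤ discSum γ f h s :=
  tsum_nonneg fun t => mul_nonneg (pow_nonneg h0 t) (hh _)

/-- Every orbit of a self-map of a finite type runs into a cycle. -/
theorem exists_iterate_mem_periodicPts [Fintype S] (f : S → S) (s : S) :
    ∃ d < Fintype.card S, f^[d] s ∈ periodicPts f := by
  classical
  obtain ⟨i, hi, j, hj, hne, he⟩ := exists_ne_map_eq_of_card_lt_of_maps_to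
    (s := range (Fintype.card S + 1)) (t := (univ : Finset S)) (f := fun t => f^[t] s)
    (by simp) (fun _ _ => by simp)
  have key : ∀ i j, i < j → j < Fintype.card S + 1 → f^[i] s = f^[j] s →
      ∃ d < Fintype.card S, f^[d] s ∈ periodicPts f := by
    intro i j hij hj he
    refine ⟨i, by omega, j - i, by omega, ?_⟩
    rw [IsPeriodicPt, IsFixedPt, ← iterate_add_apply, Nat.sub_add_cancel hij.le, ← he]
  rw [mem_range] at hi hj
  rcases lt_or_gt_of_ne hne with h | h
  · exact key i j h hj he
  · exact key j i h hi he.symm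

/-- The discounted number of visits to `s`, summed over all initial states. -/
noncomputable def flux [Fintype S] [DecidableEq S] (γ : ℝ) (f : S → S) (s : S) : ℝ :=
  ∑' t : ℕ, γ ^ t * (#{x | f^[t] x = s} : ℝ)

variable [Fintype S] [DecidableEq S]

theorem card_preimage_iterate_le (f : S → S) (t : ℕ) (s : S) :
    (#{x | f^[t] x = s} : ℝ) ≤ Fintype.card S := by
  exact_mod_cast card_le_univ _

theorem summable_flux {γ : ℝ} (h0 : 0 ≤ γ) (h1 : γ < 1) (f : S → S) (s : S) :
    Summable fun t : ℕ => γ ^ t * (#{x | f^[t] x = s} : ℝ) := by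
  refine Summable.of_nonneg_of_le (fun t => by positivity)
    (fun t => mul_le_mul_of_nonneg_left (card_preimage_iterate_le f t s) (pow_nonneg h0 t))
    ((summable_geometric_of_lt_one h0 h1).mul_right _)

theorem sum_discSum {γ : ℝ} (h0 : 0 ≤ γ) (h1 : γ < 1) (f : S → S) (h : S → ℝ) :
    ∑ s, discSum γ f h s = ∑ s, flux γ f s * h s := by
  simp only [discSum, flux, ← tsum_mul_right]
  rw [← Summable.tsum_finsetSum fun s _ => summable_discSum h0 h1 f h s,
    ← Summable.tsum_finsetSum fun s _ => (summable_flux h0 h1 f s).mul_right _]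
  refine tsum_congr fun t => ?_
  simp only [mul_assoc, ← mul_sum]
  congr 1
  rw [← sum_fiberwise univ (fun x => f^[t] x) fun x => h (f^[t] x)]
  refine sum_congr rfl fun s _ => ?_
  rw [sum_congr rfl (g := fun _ => h s) fun x hx => by rw [(mem_filter.1 hx).2]]
  simp

theorem one_le_flux {γ : ℝ} (h0 : 0 ≤ γ) (h1 : γ < 1) (f : S → S) (s : S) : 1 ≤ flux γ f s := by
  refine le_trans ?_ ((summable_flux h0 h1 f s).le_tsum 0 fun t _ => by positivity)
  simp only [pow_zero, one_mul, iterate_zero, id_eq, Nat.one_le_cast]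
  exact card_pos.2 ⟨s, mem_filter.2 ⟨mem_univ _, rfl⟩⟩

theorem flux_le {γ : ℝ} (h0 : 0 ≤ γ) (h1 : γ < 1) (f : S → S) (s : S) :
    flux γ f s ≤ Fintype.card S / (1 - γ) := by
  rw [div_eq_inv_mul, ← tsum_geometric_of_lt_one h0 h1, ← tsum_mul_right]
  exact (summable_flux h0 h1 f s).tsum_le_tsum
    (fun t => mul_le_mul_of_nonneg_left (card_preimage_iterate_le f t s) (pow_nonneg h0 t))
    ((summable_geometric_of_lt_one h0 h1).mul_right _)

theorem sum_flux {γ : ℝ} (h0 : 0 ≤ γ) (h1 : γ < 1) (f : S → S) :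
    ∑ s, flux γ f s = Fintype.card S / (1 - γ) := by
  have := sum_discSum h0 h1 f fun _ => 1
  simp only [mul_one, discSum, tsum_geometric_of_lt_one h0 h1, sum_const, card_univ,
    nsmul_eq_mul] at this
  rw [← this, div_eq_mul_inv]

/-- At every time some initial state is found at the periodic state `s`. -/
theorem le_flux_of_mem_periodicPts {γ : ℝ} (h0 : 0 ≤ γ) (h1 : γ < 1) {f : S → S} {s : S}
    (hs : s ∈ periodicPts f) : 1 / (1 - γ) ≤ flux γ f s := by
  rw [one_div, ← tsum_geometric_of_lt_one h0 h1]
  refine (summable_geometric_of_lt_one h0 h1).tsum_le_tsum (fun t => ?_) (summable_flux h0 h1 f s)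
  refine le_mul_of_one_le_right (pow_nonneg h0 t) ?_
  obtain ⟨m, hm, hp⟩ := hs
  have : f^[t] (f^[m * t - t] s) = s := by
    rw [← iterate_add_apply, Nat.add_sub_cancel' (Nat.le_mul_of_pos_left t hm)]
    exact (hp.mul_const t)
  exact Nat.one_le_cast.2 (card_pos.2 ⟨_, mem_filter.2 ⟨mem_univ _, this⟩⟩)

/-- Every initial state visits a non-periodic state `s` at most once. -/
theorem flux_le_of_notMem_periodicPts {γ : ℝ} (h0 : 0 ≤ γ) (h1 : γ < 1) {f : S → S} {s : S}
    (hs : s ∉ periodicPts f) : flux γ f s ≤ Fintype.card S := by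
  refine Real.tsum_le_of_sum_range_le (fun t => by positivity) fun T => ?_
  have hd : ∀ t ∈ range T, ∀ t' ∈ range T, t ≠ t' →
      Disjoint (univ.filter fun x => f^[t] x = s) (univ.filter fun x => f^[t'] x = s) := by
    have key : ∀ t t' x, t < t' → f^[t] x = s → f^[t'] x = s → False := by
      intro t t' x hlt e1 e2
      refine hs ⟨t' - t, by omega, ?_⟩
      rw [IsPeriodicPt, IsFixedPt]
      conv_lhs => rw [← e1, ← iterate_add_apply, Nat.sub_add_cancel hlt.le]
      exact e2
    intro t _ t' _ hne
    rw [disjoint_left]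
    intro x h2 h3
    rw [mem_filter] at h2 h3
    rcases lt_or_gt_of_ne hne with h | h
    · exact key t t' x h h2.2 h3.2
    · exact key t' t x h h3.2 h2.2
  calc ∑ t ∈ range T, γ ^ t * (#{x | f^[t] x = s} : ℝ)
      ≤ ∑ t ∈ range T, (#{x | f^[t] x = s} : ℝ) :=
        sum_le_sum fun t _ => mul_le_of_le_one_left (by positivity) (pow_le_one₀ h0 h1.le)
    _ = (#((range T).biUnion fun t => univ.filter fun x => f^[t] x = s) : ℝ) := by
        rw [card_biUnion hd]; push_cast; rfl
    _ ≤ _ := by exact_mod_cast card_le_univ _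

end Discounted

end BlackwellDMDP

namespace BlackwellDMDP

/-! ### Values, gains and policy switches at a fixed discount factor -/

namespace DMDP

open Function Finset

variable {S A : Type*} (M : DMDP S A)

/-- The successor map of the policy `π`. -/
def succ (π : S → A) (s : S) : S := M.next s (π s)

/-- The gain `Q_γ^π(s, a) - V_γ^π(s)` at the numerical discount factor `γ`. -/
noncomputable def gain (γ : ℝ) (π : S → A) (s : S) (a : A) : ℝ :=
  M.reward s a + γ * M.value γ π (M.next s a) - M.value γ π s

theorem stateAt_eq_iterate (π : S → A) (s : S) (t : ℕ) : M.stateAt π s t = (M.succ π)^[t] s := by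
  induction t with
  | zero => rfl
  | succ t ih => rw [iterate_succ_apply', ← ih]; rfl

theorem value_eq_discSum (γ : ℝ) (π : S → A) (s : S) :
    M.value γ π s = discSum γ (M.succ π) (fun x => M.reward x (π x)) s := by
  simp only [value, discSum, stateAt_eq_iterate]

theorem value_bellman [Finite S] {γ : ℝ} (h0 : 0 ≤ γ) (h1 : γ < 1) (π : S → A) (s : S) :
    M.value γ π s = M.reward s (π s) + γ * M.value γ π (M.next s (π s)) := by
  rw [value_eq_discSum, discSum_eq_add h0 h1, ← value_eq_discSum]
  rfl

theorem gain_self [Finite S] {γ : ℝ} (h0 : 0 ≤ γ) (h1 : γ < 1) (π : S → A) (s : S) :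
    M.gain γ π s (π s) = 0 := by
  rw [gain, ← M.value_bellman h0 h1, sub_self]

/-- The performance difference formula. -/
theorem value_sub_bellman [Finite S] {γ : ℝ} (h0 : 0 ≤ γ) (h1 : γ < 1) (π π' : S → A) (s : S) :
    M.value γ π' s - M.value γ π s = M.gain γ π s (π' s) +
      γ * (M.value γ π' (M.succ π' s) - M.value γ π (M.succ π' s)) := by
  rw [gain, M.value_bellman h0 h1 π' s, succ]
  ring

theorem value_sub_eq_discSum [Finite S] {γ : ℝ} (h0 : 0 ≤ γ) (h1 : γ < 1) (π π' : S → A) (s : S) :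
    M.value γ π' s - M.value γ π s =
      discSum γ (M.succ π') (fun x => M.gain γ π x (π' x)) s :=
  eq_discSum_of_bellman h0 h1 (u := fun s => M.value γ π' s - M.value γ π s)
    (M.value_sub_bellman h0 h1 π π') s

theorem value_le_value [Finite S] {γ : ℝ} (h0 : 0 ≤ γ) (h1 : γ < 1) {π π' : S → A}
    (h : ∀ s, 0 ≤ M.gain γ π s (π' s)) (s : S) : M.value γ π s ≤ M.value γ π' s := by
  rw [← sub_nonneg, M.value_sub_eq_discSum h0 h1]
  exact discSum_nonneg h0 h s

theorem value_le_of_gain_nonpos [Finite S] {γ : ℝ} (h0 : 0 ≤ γ) (h1 : γ < 1) {π : S → A}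
    (h : ∀ s a, M.gain γ π s a ≤ 0) (π' : S → A) (s : S) : M.value γ π' s ≤ M.value γ π s := by
  have := discSum_nonneg h0 (f := M.succ π') (h := fun x => -M.gain γ π x (π' x))
    (fun x => neg_nonneg.2 (h x _)) s
  have e := M.value_sub_eq_discSum h0 h1 π π' s
  simp only [discSum, mul_neg, tsum_neg] at this e
  linarith

variable {M} in
/-- If the states on the cycles of `π'` have the same actions in `π`, then these cycles are cycles
of `π` as well. -/
theorem iterate_succ_eq_of_agree {π π' : S → A} (h : ∀ s ∈ periodicPts (M.succ π'), π s = π' s)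
    {s : S} (hs : s ∈ periodicPts (M.succ π')) (t : ℕ) :
    (M.succ π)^[t] s = (M.succ π')^[t] s := by
  induction t with
  | zero => rfl
  | succ t ih =>
    rw [iterate_succ_apply', iterate_succ_apply', ih, succ, succ,
      h _ ((bijOn_periodicPts _).mapsTo.iterate t hs)]

variable {M} in
theorem mem_periodicPts_of_agree {π π' : S → A} (h : ∀ s ∈ periodicPts (M.succ π'), π s = π' s)
    {s : S} (hs : s ∈ periodicPts (M.succ π')) : s ∈ periodicPts (M.succ π) := by
  obtain ⟨m, hm, hp⟩ := hs
  refine ⟨m, hm, ?_⟩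
  rw [IsPeriodicPt, IsFixedPt, iterate_succ_eq_of_agree h ⟨m, hm, hp⟩]
  exact hp

variable {M} in
theorem value_eq_of_agree {γ : ℝ} {π π' : S → A} (h : ∀ s ∈ periodicPts (M.succ π'), π s = π' s)
    {s : S} (hs : s ∈ periodicPts (M.succ π')) : M.value γ π s = M.value γ π' s := by
  simp only [value_eq_discSum, discSum, iterate_succ_eq_of_agree h hs]
  refine tsum_congr fun t => ?_
  rw [h _ ((bijOn_periodicPts _).mapsTo.iterate t hs)]

variable {M} in
theorem agree_trans {π π' π'' : S → A} (h : ∀ s ∈ periodicPts (M.succ π'), π s = π' s)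
    (h' : ∀ s ∈ periodicPts (M.succ π''), π' s = π'' s) :
    ∀ s ∈ periodicPts (M.succ π''), π s = π'' s := fun s hs =>
  (h s (mem_periodicPts_of_agree h' hs)).trans (h' s hs)

/-- The step from `π` to `π'` creates a cycle: some state on a cycle of `π'` was switched. -/
def Creates (M : DMDP S A) (π π' : S → A) : Prop :=
  ∃ s ∈ periodicPts (M.succ π'), π s ≠ π' s

variable {M} in
theorem not_creates_iff {π π' : S → A} :
    ¬ M.Creates π π' ↔ ∀ s ∈ periodicPts (M.succ π'), π s = π' s := by
  simp [Creates]

variable {M} in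
theorem agree_of_run {p : ℕ → S → A} {T : ℕ} (hc : ∀ t < T, ¬ M.Creates (p t) (p (t + 1)))
    {i j : ℕ} (hij : i ≤ j) (hj : j ≤ T) : ∀ s ∈ periodicPts (M.succ (p j)), p i s = p j s := by
  induction j, hij using Nat.le_induction with
  | base => exact fun _ _ => rfl
  | succ j _ ih => exact agree_trans (ih (by omega)) (not_creates_iff.1 (hc j (by omega)))

/-- The sum of the values of all states. -/
noncomputable def totalValue [Fintype S] (γ : ℝ) (π : S → A) : ℝ := ∑ s, M.value γ π s

variable [Fintype S] [DecidableEq S]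

theorem totalValue_sub {γ : ℝ} (h0 : 0 ≤ γ) (h1 : γ < 1) (π π' : S → A) :
    M.totalValue γ π' - M.totalValue γ π =
      ∑ s, flux γ (M.succ π') s * M.gain γ π s (π' s) := by
  rw [totalValue, totalValue, ← sum_sub_distrib, ← sum_discSum h0 h1]
  exact sum_congr rfl fun s _ => M.value_sub_eq_discSum h0 h1 π π' s

/-- One iteration of the Max-Gain rule at the numerical discount factor `γ`. -/
def GainStep (γ : ℝ) (π π' : S → A) : Prop :=
  ∃ s a, (∀ s' a', M.gain γ π s' a' ≤ M.gain γ π s a) ∧ 0 < M.gain γ π s a ∧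
    π' = update π s a

theorem totalValue_update_sub {γ : ℝ} (h0 : 0 ≤ γ) (h1 : γ < 1) (π : S → A) (s : S) (a : A) :
    M.totalValue γ (update π s a) - M.totalValue γ π =
      flux γ (M.succ (update π s a)) s * M.gain γ π s a := by
  rw [M.totalValue_sub h0 h1, sum_eq_single s]
  · rw [update_self]
  · intro x _ hx
    rw [update_of_ne hx, M.gain_self h0 h1, mul_zero]
  · simp

/-- A policy of maximal total value has no positive gain. -/
theorem exists_gain_nonpos [Finite A] [Nonempty (S → A)] {γ : ℝ} (h0 : 0 ≤ γ) (h1 : γ < 1) :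
    ∃ π : S → A, ∀ s a, M.gain γ π s a ≤ 0 := by
  obtain ⟨π, hπ⟩ := Finite.exists_max (M.totalValue γ)
  refine ⟨π, fun s a => ?_⟩
  by_contra! hlt
  have e := M.totalValue_update_sub h0 h1 π s a
  have := mul_pos (zero_lt_one.trans_le (one_le_flux h0 h1 (M.succ (update π s a)) s)) hlt
  linarith [hπ (update π s a)]

variable {M}

theorem GainStep.value_le {γ : ℝ} (h0 : 0 ≤ γ) (h1 : γ < 1) {π π' : S → A}
    (h : M.GainStep γ π π') (s : S) : M.value γ π s ≤ M.value γ π' s := by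
  obtain ⟨x, a, -, hp, rfl⟩ := h
  refine M.value_le_value h0 h1 (fun y => ?_) s
  by_cases hy : y = x
  · subst hy; rw [update_self]; exact hp.le
  · rw [update_of_ne hy, M.gain_self h0 h1]

/-- The gap to any policy shrinks by a factor `1 - 1/n` in a step that creates a cycle. -/
theorem GainStep.gap_le_of_creates {γ : ℝ} (h0 : 0 ≤ γ) (h1 : γ < 1) {π π' : S → A}
    (h : M.GainStep γ π π') (hc : M.Creates π π') (πs : S → A) :
    M.totalValue γ πs - M.totalValue γ π' ≤
      (1 - 1 / (Fintype.card S : ℝ)) * (M.totalValue γ πs - M.totalValue γ π) := by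
  obtain ⟨x, a, hmax, hp, rfl⟩ := h
  obtain ⟨s, hs, hne⟩ := hc
  have hsx : s = x := by
    by_contra hsx
    exact hne (update_of_ne hsx _ _).symm
  subst hsx
  have e1 := M.totalValue_update_sub h0 h1 π s a
  have e2 : M.totalValue γ πs - M.totalValue γ π ≤
      Fintype.card S / (1 - γ) * M.gain γ π s a := by
    rw [M.totalValue_sub h0 h1, ← sum_flux h0 h1 (M.succ πs), sum_mul]
    exact sum_le_sum fun y _ => mul_le_mul_of_nonneg_left (hmax y _)
      (zero_le_one.trans (one_le_flux h0 h1 _ y))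
  have e3 := mul_le_mul_of_nonneg_right (le_flux_of_mem_periodicPts h0 h1 hs) hp.le
  have hn : (0 : ℝ) < Fintype.card S := by exact_mod_cast Fintype.card_pos_iff.2 ⟨s⟩
  have e4 : 1 / (Fintype.card S : ℝ) * (M.totalValue γ πs - M.totalValue γ π) ≤
      1 / (1 - γ) * M.gain γ π s a := by
    rw [one_div, inv_mul_le_iff₀ hn]
    refine e2.trans_eq ?_
    ring
  linarith

/-- If every state on a cycle of `πT` has the same action in `π`, then the gap from `π` to `πT`
shrinks by a factor `1 - 1/n²` in a Max-Gain step: the states whose actions differ have flux at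
most `n`. -/
theorem GainStep.gap_le_of_agree {γ : ℝ} (h0 : 0 ≤ γ) (h1 : γ < 1) {π π' πT : S → A}
    (h : M.GainStep γ π π') (hT : ∀ s ∈ periodicPts (M.succ πT), π s = πT s) :
    M.totalValue γ πT - M.totalValue γ π' ≤
      (1 - 1 / (Fintype.card S : ℝ) ^ 2) * (M.totalValue γ πT - M.totalValue γ π) := by
  obtain ⟨x, a, hmax, hp, rfl⟩ := h
  have e1 := M.totalValue_update_sub h0 h1 π x a
  have e2 : M.totalValue γ πT - M.totalValue γ π ≤
      (Fintype.card S : ℝ) ^ 2 * M.gain γ π x a := by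
    rw [M.totalValue_sub h0 h1]
    refine (sum_le_card_nsmul univ _ (Fintype.card S * M.gain γ π x a) fun y _ => ?_).trans_eq ?_
    · by_cases hy : y ∈ periodicPts (M.succ πT)
      · rw [← hT y hy, M.gain_self h0 h1, mul_zero]
        positivity
      · refine (mul_le_mul_of_nonneg_left (hmax y _)
          (zero_le_one.trans (one_le_flux h0 h1 _ y))).trans ?_
        exact mul_le_mul_of_nonneg_right (flux_le_of_notMem_periodicPts h0 h1 hy) hp.le
    · rw [card_univ, nsmul_eq_mul]; ring
  have e3 := mul_le_mul_of_nonneg_right (one_le_flux h0 h1 (M.succ (update π x a)) x) hp.le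
  have hn : (0 : ℝ) < Fintype.card S := by exact_mod_cast Fintype.card_pos_iff.2 ⟨x⟩
  have e4 : 1 / (Fintype.card S : ℝ) ^ 2 * (M.totalValue γ πT - M.totalValue γ π) ≤
      M.gain γ π x a := by
    rw [one_div, inv_mul_le_iff₀ (by positivity)]
    exact e2
  linarith

end DMDP

end BlackwellDMDP

namespace BlackwellDMDP

/-! ### Counting iterations by vanishing tokens -/

open Function Finset

/-- If at every time some token is present that is absent from `K` time units later on, then the
time is bounded by `K` times the number of tokens (plus one). -/
theorem lt_of_tokens_vanish {E : Type*} [Fintype E] {Pres : E → ℕ → Prop} {K T : ℕ}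
    (h : ∀ i, i + K ≤ T → ∃ e, Pres e i ∧ ∀ j, i + K ≤ j → j ≤ T → ¬ Pres e j) :
    T < K * (Fintype.card E + 1) := by
  by_contra! hT
  have hm : ∀ m : Fin (Fintype.card E + 1), (m : ℕ) * K + K ≤ T := fun m => by
    refine le_trans ?_ hT
    have := Nat.mul_le_mul_right K (show (m : ℕ) + 1 ≤ Fintype.card E + 1 from m.2)
    linarith
  choose e he he' using fun m => h _ (hm m)
  have key : ∀ m m' : Fin (Fintype.card E + 1), m < m' → e m ≠ e m' := by
    intro m m' hlt heq
    refine he' m (m' * K) ?_ (by linarith [hm m']) (heq ▸ he m')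
    have := Nat.mul_le_mul_right K (show (m : ℕ) + 1 ≤ m' from hlt)
    linarith
  have hinj : Injective e := by
    intro m m' heq
    by_contra hne
    rcases lt_or_gt_of_ne hne with hlt | hlt
    · exact key _ _ hlt heq
    · exact key _ _ hlt heq.symm
  have := Fintype.card_le_of_injective e hinj
  simp at this

theorem one_sub_inv_pow_le (N l : ℕ) (hN : 0 < N) :
    (1 - 1 / (N : ℝ)) ^ (N * l) ≤ (1 / 2) ^ l := by
  have h1 : (0 : ℝ) ≤ 1 - 1 / (N : ℝ) := by
    rw [sub_nonneg, div_le_one (by exact_mod_cast hN)]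
    exact_mod_cast hN
  rw [pow_mul]
  refine pow_le_pow_left₀ (pow_nonneg h1 _) ?_ l
  refine (Real.one_sub_div_pow_le_exp_neg (n := N) (t := 1) (by exact_mod_cast hN)).trans ?_
  rw [Real.exp_neg, one_div]
  exact inv_anti₀ two_pos (by linarith [Real.add_one_le_exp (1 : ℝ)])

theorem lt_two_pow_log_succ (n : ℕ) : (n : ℝ) < 2 ^ (Nat.log 2 n + 1) := by
  exact_mod_cast Nat.lt_pow_succ_log_self one_lt_two n

theorem half_pow_lt_inv_sq {n : ℕ} (hn : 0 < n) :
    (1 / 2 : ℝ) ^ (2 * (Nat.log 2 n + 1)) < 1 / (n : ℝ) ^ 2 := by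
  have h := lt_two_pow_log_succ n
  have hn' : (0 : ℝ) < n := by exact_mod_cast hn
  rw [one_div, inv_pow, ← one_div, mul_comm, pow_mul]
  exact one_div_lt_one_div_of_lt (by positivity) (pow_lt_pow_left₀ h hn'.le two_ne_zero)

theorem half_pow_lt_inv_two_mul_sq {n : ℕ} (hn : 0 < n) :
    (1 / 2 : ℝ) ^ (3 * (Nat.log 2 n + 1)) < 1 / (2 * (n : ℝ) ^ 2) := by
  have h := half_pow_lt_inv_sq hn
  have hn' : (0 : ℝ) < n := by exact_mod_cast hn
  have e : 3 * (Nat.log 2 n + 1) = 2 * (Nat.log 2 n + 1) + (Nat.log 2 n + 1) := by ring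
  have h2 : (1 / 2 : ℝ) ^ (Nat.log 2 n + 1) ≤ 1 / 2 := by
    rw [pow_succ]
    exact mul_le_of_le_one_left (by norm_num) (pow_le_one₀ (by norm_num) (by norm_num))
  rw [e, pow_add]
  calc _ < 1 / (n : ℝ) ^ 2 * (1 / 2) := mul_lt_mul h h2 (by positivity) (by positivity)
    _ = _ := by rw [div_mul_div_comm]; ring_nf

/-- Geometric decay of a sequence along steps of length `P`. -/
theorem le_pow_mul_of_step {g : ℕ → ℝ} {c : ℝ} {P T : ℕ} (hc : 0 ≤ c)
    (h : ∀ i, i + P ≤ T → g (i + P) ≤ c * g i) (i m : ℕ) (hm : i + m * P ≤ T) :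
    g (i + m * P) ≤ c ^ m * g i := by
  induction m with
  | zero => simp
  | succ m ih =>
    have e : i + (m + 1) * P = i + m * P + P := by ring
    rw [e] at hm ⊢
    calc _ ≤ c * g (i + m * P) := h _ hm
      _ ≤ c * (c ^ m * g i) := mul_le_mul_of_nonneg_left (ih (by omega)) hc
      _ = _ := by ring

namespace DMDP

variable {S A : Type*} [Fintype S] [DecidableEq S] {M : DMDP S A}

theorem value_le_value_of_run {γ : ℝ} (h0 : 0 ≤ γ) (h1 : γ < 1) {p : ℕ → S → A} {T : ℕ}
    (h : ∀ t < T, M.GainStep γ (p t) (p (t + 1))) {i j : ℕ} (hij : i ≤ j) (hj : j ≤ T) (s : S) :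
    M.value γ (p i) s ≤ M.value γ (p j) s := by
  induction j, hij using Nat.le_induction with
  | base => exact le_rfl
  | succ j _ ih => exact (ih (by omega)).trans ((h j (by omega)).value_le h0 h1 s)

theorem totalValue_le_of_run {γ : ℝ} (h0 : 0 ≤ γ) (h1 : γ < 1) {p : ℕ → S → A} {T : ℕ}
    (h : ∀ t < T, M.GainStep γ (p t) (p (t + 1))) {i j : ℕ} (hij : i ≤ j) (hj : j ≤ T) :
    M.totalValue γ (p i) ≤ M.totalValue γ (p j) :=
  sum_le_sum fun s _ => value_le_value_of_run h0 h1 h hij hj s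

theorem GainStep.totalValue_lt {γ : ℝ} (h0 : 0 ≤ γ) (h1 : γ < 1) {π π' : S → A}
    (h : M.GainStep γ π π') : M.totalValue γ π < M.totalValue γ π' := by
  obtain ⟨x, a, -, hp, rfl⟩ := h
  have e := M.totalValue_update_sub h0 h1 π x a
  have := mul_pos (zero_lt_one.trans_le (one_le_flux h0 h1 (M.succ (update π x a)) x)) hp
  linarith

theorem totalValue_lt_of_run {γ : ℝ} (h0 : 0 ≤ γ) (h1 : γ < 1) {p : ℕ → S → A} {T : ℕ}
    (h : ∀ t < T, M.GainStep γ (p t) (p (t + 1))) {i j : ℕ} (hij : i < j) (hj : j ≤ T) :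
    M.totalValue γ (p i) < M.totalValue γ (p j) :=
  ((h i (by omega)).totalValue_lt h0 h1).trans_le (totalValue_le_of_run h0 h1 h hij hj)

variable [Fintype A]

variable (S A) in
/-- A bound on the length of a sequence of Max-Gain steps none of which creates a cycle. -/
def phaseBound : ℕ :=
  3 * (Nat.log 2 (Fintype.card S) + 1) * Fintype.card S ^ 2 *
    (Fintype.card ((S × A) ⊕ S) + 1)

/-- If no cycle is created, then after `O(n² log n)` steps the gap to the last policy is so small
that a state has left the cycles for good, or an action is no longer used. -/
theorem lt_phaseBound [Nonempty S] {γ : ℝ} (h0 : 0 ≤ γ) (h1 : γ < 1) {p : ℕ → S → A} {T : ℕ}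
    (h : ∀ t < T, M.GainStep γ (p t) (p (t + 1)))
    (hc : ∀ t < T, ¬ M.Creates (p t) (p (t + 1))) : T < phaseBound S A := by
  set n := Fintype.card S with hn
  have hn0 : 0 < n := Fintype.card_pos
  have hn1 : (1 : ℝ) ≤ n := by exact_mod_cast hn0
  set l := 3 * (Nat.log 2 n + 1) with hl
  refine lt_of_tokens_vanish (Pres := fun e j => Sum.elim (fun sa : S × A => p j sa.1 = sa.2)
    (fun s => s ∈ periodicPts (M.succ (p j))) e) fun i hi => ?_
  replace hi : i + l * n ^ 2 ≤ T := hi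
  set δ : ℕ → ℝ := fun j => M.totalValue γ (p T) - M.totalValue γ (p j) with hδ
  have hlK : 0 < l * n ^ 2 := by positivity
  have hpos : 0 < δ i := sub_pos.2 (totalValue_lt_of_run h0 h1 h (by omega) le_rfl)
  have hc0 : (0 : ℝ) ≤ 1 - 1 / (n : ℝ) ^ 2 := by
    rw [sub_nonneg, div_le_one (by positivity)]; exact one_le_pow₀ hn1
  have hdecay : δ (i + l * n ^ 2) < δ i / (2 * (n : ℝ) ^ 2) := by
    have e1 := le_pow_mul_of_step (g := δ) (P := 1) (T := T) hc0 (fun j hj =>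
      (h j (by omega)).gap_le_of_agree h0 h1 (agree_of_run hc (by omega) le_rfl)) i (l * n ^ 2)
      (by omega)
    rw [mul_one] at e1
    have e2 := one_sub_inv_pow_le (n ^ 2) l (by positivity)
    rw [Nat.cast_pow, mul_comm] at e2
    calc _ ≤ _ := e1
      _ ≤ (1 / 2) ^ l * δ i := mul_le_mul_of_nonneg_right e2 hpos.le
      _ < 1 / (2 * (n : ℝ) ^ 2) * δ i :=
        mul_lt_mul_of_pos_right (half_pow_lt_inv_two_mul_sq hn0) hpos
      _ = _ := by ring
  -- late in the run, every state is close to its final value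
  have hlate : ∀ j, i + l * n ^ 2 ≤ j → j ≤ T → ∀ s,
      M.value γ (p T) s - M.value γ (p j) s < δ i / (2 * (n : ℝ) ^ 2) := by
    intro j hj hjT s
    have e1 : δ j ≤ δ (i + l * n ^ 2) :=
      sub_le_sub_left (totalValue_le_of_run h0 h1 h hj hjT) _
    refine lt_of_le_of_lt ?_ (e1.trans_lt hdecay)
    simp only [hδ, totalValue, ← sum_sub_distrib]
    exact single_le_sum (f := fun s => M.value γ (p T) s - M.value γ (p j) s)
      (fun x _ => sub_nonneg.2 (value_le_value_of_run h0 h1 h hjT le_rfl x)) (mem_univ s)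
  have hsq : δ i / (2 * (n : ℝ) ^ 2) ≤ δ i / (2 * n) := by
    refine div_le_div_of_nonneg_left hpos.le (by positivity) ?_
    nlinarith
  by_cases hcase : ∃ s ∈ periodicPts (M.succ (p i)),
      δ i / (2 * n) ≤ M.value γ (p T) s - M.value γ (p i) s
  · obtain ⟨s, hs, hbig⟩ := hcase
    refine ⟨Sum.inr s, hs, fun j hj hjT hsj => ?_⟩
    have e := value_eq_of_agree (γ := γ) (agree_of_run hc (show i ≤ j by omega) hjT)
      (show s ∈ periodicPts (M.succ (p j)) from hsj)
    have := hlate j hj hjT s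
    rw [← e] at this
    linarith
  · push Not at hcase
    obtain ⟨s, -, hs⟩ : ∃ s ∈ univ, δ i / n ≤ M.value γ (p T) s - M.value γ (p i) s := by
      refine exists_le_of_sum_le univ_nonempty (le_of_eq ?_)
      rw [sum_const, card_univ, nsmul_eq_mul, ← hn, mul_div_cancel₀ _ (by positivity)]
      simp only [hδ, totalValue, ← sum_sub_distrib]
    obtain ⟨d, hd, hper⟩ := exists_iterate_mem_periodicPts (M.succ (p i)) s
    have hu := eq_sum_add_of_bellman (γ := γ) (f := M.succ (p i))
      (h := fun y => -M.gain γ (p T) y (p i y))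
      (u := fun y => M.value γ (p T) y - M.value γ (p i) y)
      (fun y => by linarith [M.value_sub_bellman h0 h1 (p T) (p i) y]) s d
    have hlast := hcase _ hper
    obtain ⟨t, ht, hloss⟩ : ∃ t ∈ range d, δ i / (2 * (n : ℝ) ^ 2) ≤
        -M.gain γ (p T) ((M.succ (p i))^[t] s) (p i ((M.succ (p i))^[t] s)) := by
      by_contra! hall
      have e1 : ∑ t ∈ range d, γ ^ t *
          -M.gain γ (p T) ((M.succ (p i))^[t] s) (p i ((M.succ (p i))^[t] s)) ≤
          δ i / (2 * n) := by
        have e3 : (d : ℝ) * (δ i / (2 * (n : ℝ) ^ 2)) ≤ δ i / (2 * n) := by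
          have : (d : ℝ) ≤ n := by exact_mod_cast hd.le
          calc _ ≤ n * (δ i / (2 * (n : ℝ) ^ 2)) :=
                mul_le_mul_of_nonneg_right this (by positivity)
            _ = _ := by field_simp
        refine le_trans (sum_le_card_nsmul _ _ (δ i / (2 * (n : ℝ) ^ 2)) fun t ht => ?_)
          (by rw [card_range, nsmul_eq_mul]; exact e3)
        calc _ ≤ γ ^ t * (δ i / (2 * (n : ℝ) ^ 2)) :=
              mul_le_mul_of_nonneg_left (hall t ht).le (pow_nonneg h0 t)
          _ ≤ _ := mul_le_of_le_one_left (by positivity) (pow_le_one₀ h0 h1.le)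
      have e2 : γ ^ d * (M.value γ (p T) ((M.succ (p i))^[d] s) -
          M.value γ (p i) ((M.succ (p i))^[d] s)) < δ i / (2 * n) := by
        refine lt_of_le_of_lt (mul_le_of_le_one_left ?_ (pow_le_one₀ h0 h1.le)) hlast
        exact sub_nonneg.2 (value_le_value_of_run h0 h1 h (by omega) le_rfl _)
      have e3 : δ i / n = δ i / (2 * n) + δ i / (2 * n) := by field_simp; ring
      linarith
    set y := (M.succ (p i))^[t] s
    refine ⟨Sum.inl (y, p i y), rfl, fun j hj hjT hyj => ?_⟩
    have hyj' : p j y = p i y := hyj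
    have e1 := hlate j hj hjT y
    have e2 := M.value_bellman h0 h1 (p j) y
    rw [hyj'] at e2
    have e3 := mul_le_mul_of_nonneg_left
      (value_le_value_of_run h0 h1 h hjT le_rfl (M.next y (p i y))) h0
    rw [gain] at hloss
    linarith

variable (S A) in
/-- A bound on the number of Max-Gain iterations at a fixed discount factor. -/
def runBound : ℕ :=
  2 * (Nat.log 2 (Fintype.card S) + 1) * Fintype.card S * phaseBound S A *
    (Fintype.card ((S × A) × Bool) + 1)

/-- The number of iterations of the Max-Gain rule at a fixed discount factor is
`O(n^5 k^2 log² n)`. After `O(n log n)` creations of cycles the gap to the optimum is so small that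
an action which contributed most to it is no longer used, or is no longer used on a cycle. -/
theorem lt_runBound [Nonempty S] {γ : ℝ} (h0 : 0 ≤ γ) (h1 : γ < 1) {p : ℕ → S → A} {T : ℕ}
    (h : ∀ t < T, M.GainStep γ (p t) (p (t + 1))) : T < runBound S A := by
  have : Nonempty (S → A) := ⟨p 0⟩
  obtain ⟨πs, hopt⟩ := M.exists_gain_nonpos h0 h1
  set n := Fintype.card S with hn
  have hn0 : 0 < n := Fintype.card_pos
  have hn1 : (1 : ℝ) ≤ n := by exact_mod_cast hn0
  set l := 2 * (Nat.log 2 n + 1) with hl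
  set P := phaseBound S A with hP
  have hγ : 0 < 1 - γ := sub_pos.2 h1
  have hvs : ∀ j, M.totalValue γ (p j) ≤ M.totalValue γ πs := fun j =>
    sum_le_sum fun s _ => M.value_le_of_gain_nonpos h0 h1 hopt (p j) s
  refine lt_of_tokens_vanish (Pres := fun (e : (S × A) × Bool) j => p j e.1.1 = e.1.2 ∧
    (e.1.1 ∈ periodicPts (M.succ (p j)) ↔ e.2 = true)) fun i hi => ?_
  replace hi : i + l * n * P ≤ T := hi
  set g : ℕ → ℝ := fun j => M.totalValue γ πs - M.totalValue γ (p j) with hg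
  have hP0 : 0 < P := by rw [hP, phaseBound]; positivity
  have hlK : 0 < l * n * P := by positivity
  have hpos : 0 < g i :=
    sub_pos.2 ((totalValue_lt_of_run h0 h1 h (by omega) le_rfl).trans_le (hvs T))
  have hc0 : (0 : ℝ) ≤ 1 - 1 / (n : ℝ) := by
    rw [sub_nonneg, div_le_one (by positivity)]; exact hn1
  have hphase : ∀ j, j + P ≤ T → g (j + P) ≤ (1 - 1 / (n : ℝ)) * g j := by
    intro j hj
    have hex : ∃ t < P, M.Creates (p (j + t)) (p (j + t + 1)) := by
      by_contra! hno
      exact lt_irrefl P (lt_phaseBound (p := fun t => p (j + t)) (T := P) h0 h1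
        (fun t ht => h _ (by omega)) hno)
    obtain ⟨t, ht, hcr⟩ := hex
    calc g (j + P) ≤ g (j + t + 1) :=
          sub_le_sub_left (totalValue_le_of_run h0 h1 h (by omega) hj) _
      _ ≤ (1 - 1 / (n : ℝ)) * g (j + t) :=
          (h (j + t) (by omega)).gap_le_of_creates h0 h1 hcr πs
      _ ≤ _ := mul_le_mul_of_nonneg_left
          (sub_le_sub_left (totalValue_le_of_run h0 h1 h (by omega) (by omega)) _) hc0
  have hdecay : g (i + l * n * P) < g i / (n : ℝ) ^ 2 := by
    have e1 := le_pow_mul_of_step (g := g) (P := P) (T := T) hc0 hphase i (l * n) hi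
    have e2 := one_sub_inv_pow_le n l hn0
    rw [mul_comm] at e2
    calc _ ≤ _ := e1
      _ ≤ (1 / 2) ^ l * g i := mul_le_mul_of_nonneg_right e2 hpos.le
      _ < 1 / (n : ℝ) ^ 2 * g i := mul_lt_mul_of_pos_right (half_pow_lt_inv_sq hn0) hpos
      _ = _ := by ring
  have hgsum : ∀ j, g j = ∑ s, flux γ (M.succ (p j)) s * -M.gain γ πs s (p j s) := by
    intro j
    simp only [mul_neg, sum_neg_distrib, ← M.totalValue_sub h0 h1 πs (p j), hg]
    ring
  obtain ⟨s, -, hs⟩ : ∃ s ∈ univ, g i / n ≤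
      flux γ (M.succ (p i)) s * -M.gain γ πs s (p i s) := by
    refine exists_le_of_sum_le univ_nonempty (le_of_eq ?_)
    rw [sum_const, card_univ, nsmul_eq_mul, ← hn, mul_div_cancel₀ _ (by positivity), hgsum]
  classical
  refine ⟨((s, p i s), decide (s ∈ periodicPts (M.succ (p i)))), ⟨rfl, by simp⟩, ?_⟩
  rintro j hj hjT ⟨hj1, hj2⟩
  simp only [decide_eq_true_eq] at hj1 hj2
  have hflux : flux γ (M.succ (p i)) s ≤ n * flux γ (M.succ (p j)) s := by
    by_cases hper : s ∈ periodicPts (M.succ (p i))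
    · calc _ ≤ (n : ℝ) / (1 - γ) := flux_le h0 h1 _ s
        _ = n * (1 / (1 - γ)) := by ring
        _ ≤ _ := mul_le_mul_of_nonneg_left
          (le_flux_of_mem_periodicPts h0 h1 (hj2.2 hper)) (by positivity)
    · calc _ ≤ (n : ℝ) := flux_le_of_notMem_periodicPts h0 h1 hper
        _ ≤ _ := le_mul_of_one_le_right (by positivity) (one_le_flux h0 h1 _ s)
  have e1 : flux γ (M.succ (p j)) s * -M.gain γ πs s (p i s) ≤ g j := by
    rw [hgsum j, ← hj1]
    exact single_le_sum (f := fun s => flux γ (M.succ (p j)) s * -M.gain γ πs s (p j s))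
      (fun x _ => mul_nonneg (zero_le_one.trans (one_le_flux h0 h1 _ x))
        (neg_nonneg.2 (hopt _ _))) (mem_univ s)
  have e2 : g j ≤ g (i + l * n * P) := sub_le_sub_left (totalValue_le_of_run h0 h1 h hj hjT) _
  have e3 := mul_le_mul_of_nonneg_right hflux (neg_nonneg.2 (hopt s (p i s)))
  have e4 : g i / n ≤ n * g j := by nlinarith
  have e5 : g i / (n : ℝ) ^ 2 ≤ g j := by
    rw [div_le_iff₀ (by positivity)]
    rw [div_le_iff₀ (by positivity)] at e4
    linarith
  linarith

end DMDP

end BlackwellDMDP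

namespace BlackwellDMDP

/-! ### The `μ`-ordering as the ordering of functions near `1` -/

open Filter Topology Polynomial

theorem eventually_nonneg_lt_one : ∀ᶠ γ in 𝓝[<] (1 : ℝ), 0 ≤ γ ∧ γ < 1 := by
  filter_upwards [self_mem_nhdsWithin,
    mem_nhdsWithin_of_mem_nhds (Ici_mem_nhds (zero_lt_one' ℝ))] with γ h1 h2
  exact ⟨h2, h1⟩

/-- Writing `p = (1 - X)^c * q`, the sign of `p` to the left of `1` is that of `q(1)`. -/
theorem eventually_sign_eval_eq (p : ℝ[X]) :
    ∀ᶠ γ in 𝓝[<] (1 : ℝ), SignType.sign (p.eval γ) = SignType.sign (leadAtOne p) := by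
  by_cases hp : p = 0
  · simp [hp, leadAtOne]
  set c := p.rootMultiplicity 1 with hc
  set q := p /ₘ (X - C 1) ^ c with hq
  have hq1 : q.eval 1 ≠ 0 := eval_divByMonic_pow_rootMultiplicity_ne_zero 1 hp
  have hpq : ∀ γ, p.eval γ = (1 - γ) ^ c * ((-1) ^ c * q.eval γ) := by
    intro γ
    rw [← mul_assoc, ← mul_pow]
    conv_lhs => rw [← pow_mul_divByMonic_rootMultiplicity_eq p 1]
    simp only [eval_mul, eval_pow, eval_sub, eval_X, eval_C]
    ring_nf
    rfl
  have hl : leadAtOne p = (-1) ^ c * q.eval 1 := rfl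
  have hne : leadAtOne p ≠ 0 := by
    rw [hl]; exact mul_ne_zero (pow_ne_zero _ (by norm_num)) hq1
  have ht : Tendsto (fun γ => (-1) ^ c * q.eval γ) (𝓝[<] (1 : ℝ)) (𝓝 (leadAtOne p)) :=
    ((by fun_prop : Continuous fun γ => (-1) ^ c * q.eval γ).tendsto 1).mono_left
      nhdsWithin_le_nhds
  have hs : ∀ᶠ γ in 𝓝[<] (1 : ℝ),
      SignType.sign ((-1) ^ c * q.eval γ) = SignType.sign (leadAtOne p) := by
    rcases hne.lt_or_gt with h | h
    · filter_upwards [ht.eventually_lt_const h] with γ hγ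
      rw [sign_neg hγ, sign_neg h]
    · filter_upwards [ht.eventually_const_lt h] with γ hγ
      rw [sign_pos hγ, sign_pos h]
  filter_upwards [hs, self_mem_nhdsWithin] with γ hγ hlt
  have : 0 < (1 - γ) ^ c := pow_pos (sub_pos.2 hlt) c
  rw [hpq, sign_mul, sign_pos this, one_mul, hγ]

theorem leadAtOne_ne_zero {p : ℝ[X]} (hp : p ≠ 0) : leadAtOne p ≠ 0 :=
  mul_ne_zero (pow_ne_zero _ (by norm_num))
    (eval_divByMonic_pow_rootMultiplicity_ne_zero 1 hp)

theorem eventually_eval_ne_zero {p : ℝ[X]} (hp : p ≠ 0) :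
    ∀ᶠ γ in 𝓝[<] (1 : ℝ), p.eval γ ≠ 0 := by
  filter_upwards [eventually_sign_eval_eq p] with γ hγ h0
  rw [h0, sign_zero, eq_comm, sign_eq_zero_iff] at hγ
  exact leadAtOne_ne_zero hp hγ

/-- The rational function `f` takes the values of `F` to the left of `1`. -/
def Represents (f : RatFunc ℝ) (F : ℝ → ℝ) : Prop :=
  ∀ᶠ γ in 𝓝[<] (1 : ℝ), f.eval (RingHom.id ℝ) γ = F γ

theorem eventually_denom_ne_zero (f : RatFunc ℝ) :
    ∀ᶠ γ in 𝓝[<] (1 : ℝ), f.denom.eval₂ (RingHom.id ℝ) γ ≠ 0 := by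
  simp only [eval₂_id]
  exact eventually_eval_ne_zero f.denom_ne_zero

namespace Represents

variable {f g : RatFunc ℝ} {F G : ℝ → ℝ}

theorem add (hf : Represents f F) (hg : Represents g G) :
    Represents (f + g) fun γ => F γ + G γ := by
  filter_upwards [hf, hg, eventually_denom_ne_zero f, eventually_denom_ne_zero g]
    with γ h1 h2 h3 h4
  rw [RatFunc.eval_add _ _ h3 h4, h1, h2]

theorem mul (hf : Represents f F) (hg : Represents g G) :
    Represents (f * g) fun γ => F γ * G γ := by
  filter_upwards [hf, hg, eventually_denom_ne_zero f, eventually_denom_ne_zero g]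
    with γ h1 h2 h3 h4
  rw [RatFunc.eval_mul _ _ h3 h4, h1, h2]

theorem const (c : ℝ) : Represents (RatFunc.C c) fun _ => c :=
  Eventually.of_forall fun γ => by simp

theorem id : Represents RatFunc.X fun γ => γ := Eventually.of_forall fun γ => by simp

theorem sub (hf : Represents f F) (hg : Represents g G) :
    Represents (f - g) fun γ => F γ - G γ := by
  have h := hf.add ((const (-1)).mul hg)
  have e : f + RatFunc.C (-1) * g = f - g := by
    rw [map_neg, map_one]; ring
  rw [e] at h
  filter_upwards [h] with γ hγ
  rw [hγ]; ring

theorem poly (p : ℝ[X]) : Represents (algebraMap ℝ[X] (RatFunc ℝ) p) fun γ => p.eval γ :=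
  Eventually.of_forall fun γ => by simp

theorem poly_div (p : ℝ[X]) {q : ℝ[X]} (hq : q ≠ 0) :
    Represents (algebraMap ℝ[X] (RatFunc ℝ) p / algebraMap ℝ[X] (RatFunc ℝ) q)
      fun γ => p.eval γ / q.eval γ := by
  set f := algebraMap ℝ[X] (RatFunc ℝ) p / algebraMap ℝ[X] (RatFunc ℝ) q with hf
  have h : Represents f fun γ => f.eval (RingHom.id ℝ) γ := Eventually.of_forall fun _ => rfl
  have h' := h.mul (poly q)
  rw [hf, div_mul_cancel₀ _ (RatFunc.algebraMap_ne_zero hq)] at h'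
  filter_upwards [h', poly p, eventually_eval_ne_zero hq] with γ h1 h2 h3
  rw [eq_div_iff h3, ← h2, h1]

theorem congr (hf : Represents f F) (h : ∀ᶠ γ in 𝓝[<] (1 : ℝ), F γ = G γ) : Represents f G := by
  filter_upwards [hf, h] with γ h1 h2
  rw [h1, h2]

/-- The `μ`-ordering compares rational functions by their values near `1`. -/
theorem eventually_muGT_iff (hf : Represents f F) (hg : Represents g G) :
    ∀ᶠ γ in 𝓝[<] (1 : ℝ), (MuGT f g ↔ G γ < F γ) := by
  filter_upwards [hf.sub hg, eventually_sign_eval_eq (f - g).num,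
    eventually_sign_eval_eq (f - g).denom] with γ h1 h2 h3
  rw [RatFunc.eval, eval₂_id, eval₂_id] at h1
  rw [MuGT, ← sub_pos (b := G γ), ← h1, div_pos_iff, ← mul_pos_iff, ← sign_eq_one_iff,
    ← sign_eq_one_iff, sign_mul, sign_mul, ← h2, ← h3]

end Represents

/-! ### Values and gains as rational functions of the discount factor -/

namespace DMDP

variable {S A : Type*} [Fintype S] [DecidableEq S] (M : DMDP S A)

/-- The numerator in Cramer's rule for the value of the state `s`. -/
noncomputable def valueNum (π : S → A) (s : S) : ℝ[X] :=
  (M.bellmanMatrix π).cramer (fun s' => C (M.reward s' (π s'))) s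

theorem bellmanMatrix_det_ne_zero (π : S → A) : (M.bellmanMatrix π).det ≠ 0 := by
  -- at `γ = 0` the matrix is the identity
  intro h
  have h' := congrArg (evalRingHom 0) h
  rw [RingHom.map_det, map_zero] at h'
  have e : (evalRingHom (0 : ℝ)).mapMatrix (M.bellmanMatrix π) = 1 := by
    ext i j
    rw [RingHom.mapMatrix_apply, Matrix.map_apply, bellmanMatrix]
    by_cases hij : i = j <;> simp [Matrix.one_apply, hij] <;> split_ifs <;> simp
  rw [e, Matrix.det_one] at h'
  exact one_ne_zero h'

/-- Cramer's rule read as the Bellman equation, multiplied by the determinant. -/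
theorem valueNum_bellman (π : S → A) (s : S) :
    M.valueNum π s - X * M.valueNum π (M.next s (π s)) =
      (M.bellmanMatrix π).det * C (M.reward s (π s)) := by
  have h := congrFun (Matrix.mulVec_cramer (M.bellmanMatrix π)
    fun s' => C (M.reward s' (π s'))) s
  rw [Pi.smul_apply, smul_eq_mul] at h
  rw [← h, bellmanMatrix, Matrix.sub_mulVec, Matrix.one_mulVec, Matrix.smul_mulVec]
  simp [Matrix.mulVec, dotProduct, valueNum, bellmanMatrix]

theorem valueNum_eval {γ : ℝ} (h0 : 0 ≤ γ) (h1 : γ < 1) (π : S → A)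
    (hd : (M.bellmanMatrix π).det.eval γ ≠ 0) (s : S) :
    (M.valueNum π s).eval γ / (M.bellmanMatrix π).det.eval γ = M.value γ π s := by
  rw [value_eq_discSum]
  refine eq_discSum_of_bellman h0 h1
    (u := fun s => (M.valueNum π s).eval γ / (M.bellmanMatrix π).det.eval γ) (fun s => ?_) s
  have h := congrArg (eval γ) (M.valueNum_bellman π s)
  simp only [eval_sub, eval_mul, eval_X, eval_C] at h
  rw [succ]
  field_simp
  linarith

theorem ratValue_represents (π : S → A) (s : S) :
    Represents (M.ratValue π s) fun γ => M.value γ π s := by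
  refine (Represents.poly_div _ (M.bellmanMatrix_det_ne_zero π)).congr ?_
  filter_upwards [eventually_eval_ne_zero (M.bellmanMatrix_det_ne_zero π),
    eventually_nonneg_lt_one] with γ h1 h2
  exact M.valueNum_eval h2.1 h2.2 π h1 s

theorem ratGain_represents (π : S → A) (s : S) (a : A) :
    Represents (M.ratGain π s a) fun γ => M.gain γ π s a :=
  ((Represents.const _).add (Represents.id.mul (M.ratValue_represents π _))).sub
    (M.ratValue_represents π s)

theorem eventually_muGT_gain_iff (π : S → A) (s : S) (a : A) (s' : S) (a' : A) :
    ∀ᶠ γ in 𝓝[<] (1 : ℝ), (MuGT (M.ratGain π s a) (M.ratGain π s' a') ↔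
      M.gain γ π s' a' < M.gain γ π s a) :=
  (M.ratGain_represents π s a).eventually_muGT_iff (M.ratGain_represents π s' a')

theorem eventually_muGT_zero_iff (π : S → A) (s : S) (a : A) :
    ∀ᶠ γ in 𝓝[<] (1 : ℝ), (MuGT (M.ratGain π s a) 0 ↔ 0 < M.gain γ π s a) := by
  have h := (M.ratGain_represents π s a).eventually_muGT_iff (Represents.const 0)
  rwa [map_zero] at h

/-- All `μ`-comparisons of gains are comparisons at one and the same discount factor. -/
theorem exists_discount [Finite A] : ∃ γ : ℝ, 0 ≤ γ ∧ γ < 1 ∧ ∀ (π : S → A) (s : S) (a : A),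
    (MuGT (M.ratGain π s a) 0 ↔ 0 < M.gain γ π s a) ∧
    ∀ (s' : S) (a' : A), (MuGT (M.ratGain π s a) (M.ratGain π s' a') ↔
      M.gain γ π s' a' < M.gain γ π s a) := by
  have h : ∀ᶠ γ in 𝓝[<] (1 : ℝ), ∀ (π : S → A) (s : S) (a : A),
      (MuGT (M.ratGain π s a) 0 ↔ 0 < M.gain γ π s a) ∧
      ∀ (s' : S) (a' : A), (MuGT (M.ratGain π s a) (M.ratGain π s' a') ↔
        M.gain γ π s' a' < M.gain γ π s a) := by
    simp only [eventually_all, eventually_and]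
    exact fun π s a => ⟨M.eventually_muGT_zero_iff π s a,
      fun s' a' => M.eventually_muGT_gain_iff π s a s' a'⟩
  obtain ⟨γ, h1, h2⟩ := (eventually_nonneg_lt_one.and h).exists
  exact ⟨γ, h1.1, h1.2, h2⟩

theorem exists_step [Finite A] {π : S → A} (h : ¬ M.IsTerminal π) : ∃ π', M.Step π π' := by
  obtain ⟨γ, -, -, hγ⟩ := M.exists_discount
  simp only [IsTerminal, not_forall, not_not] at h
  obtain ⟨s, a, hsa⟩ := h
  have : Nonempty (S × A) := ⟨(s, a)⟩
  obtain ⟨⟨x, b⟩, hmax⟩ := Finite.exists_max fun sa : S × A => M.gain γ π sa.1 sa.2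
  refine ⟨_, x, b, fun s' a' => ?_, ?_, rfl⟩
  · rw [(hγ π s' a').2, not_lt]
    exact hmax (s', a')
  · rw [(hγ π x b).1]
    exact ((hγ π s a).1.1 hsa).trans_le (hmax (s, a))

theorem run_lt_runBound [Nonempty S] [Fintype A] {π₀ : S → A} {p : ℕ → S → A} {N : ℕ}
    (h : M.IsRun π₀ p N) : N < runBound S A := by
  obtain ⟨γ, h0, h1, hγ⟩ := M.exists_discount
  refine lt_runBound (M := M) (p := p) h0 h1 fun t ht => ?_
  obtain ⟨s, a, hmax, hpos, he⟩ := h.2 t ht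
  refine ⟨s, a, fun s' a' => ?_, (hγ (p t) s a).1.1 hpos, he⟩
  rw [← not_lt, ← (hγ (p t) s' a').2]
  exact hmax s' a'

theorem IsTerminal.isBlackwellOptimal [Finite A] {M : DMDP S A} {π : S → A}
    (h : M.IsTerminal π) : M.IsBlackwellOptimal π := by
  have h' : ∀ᶠ γ in 𝓝[<] (1 : ℝ), ∀ s a, M.gain γ π s a ≤ 0 := by
    simp only [eventually_all]
    intro s a
    filter_upwards [M.eventually_muGT_zero_iff π s a] with γ hγ
    rw [← not_lt, ← hγ]
    exact h s a
  obtain ⟨l, hl, hl'⟩ := mem_nhdsLT_iff_exists_Ico_subset.1 (h'.and eventually_nonneg_lt_one)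
  refine ⟨l, (hl' ⟨le_rfl, hl⟩).2.1, hl, fun γ h1 h2 π' s => ?_⟩
  have := hl' ⟨h1, h2⟩
  exact M.value_le_of_gain_nonpos this.2.1 this.2.2 this.1 π' s

end DMDP

end BlackwellDMDP

namespace BlackwellDMDP

/-! ### Expansion of the gains at `1` -/

open Filter Topology Polynomial Finset Asymptotics

theorem abs_discSum_le {S : Type*} {γ B : ℝ} (h0 : 0 ≤ γ) (h1 : γ < 1) {f : S → S} {h : S → ℝ}
    (hB : ∀ s, |h s| ≤ B) (s : S) : |discSum γ f h s| ≤ B / (1 - γ) := by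
  rw [div_eq_inv_mul]
  rw [← Real.norm_eq_abs]
  refine tsum_of_norm_bounded ((hasSum_geometric_of_lt_one h0 h1).mul_right B) fun t => ?_
  rw [norm_mul, Real.norm_eq_abs, Real.norm_eq_abs, abs_of_nonneg (pow_nonneg h0 t)]
  exact mul_le_mul_of_nonneg_left (hB _) (pow_nonneg h0 t)

theorem natDegree_det_le {ι : Type*} [Fintype ι] [DecidableEq ι] {B : Matrix ι ι ℝ[X]}
    (hB : ∀ i j, (B i j).natDegree ≤ 1) : B.det.natDegree ≤ Fintype.card ι := by
  rw [Matrix.det_apply]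
  refine natDegree_sum_le_of_forall_le _ _ fun σ _ => ?_
  refine (natDegree_smul_le _ _).trans ((natDegree_prod_le _ _).trans ?_)
  exact (sum_le_card_nsmul _ _ 1 fun i _ => hB _ _).trans (by simp)

theorem eventually_of_iff {P : Prop} {Q : ℝ → Prop} (h : ∀ᶠ γ in 𝓝[<] (1 : ℝ), (P ↔ Q γ)) :
    P ↔ ∀ᶠ γ in 𝓝[<] (1 : ℝ), Q γ := by
  refine ⟨fun hP => h.mono fun γ hγ => hγ.1 hP, fun hQ => ?_⟩
  obtain ⟨γ, h1, h2⟩ := (h.and hQ).exists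
  exact h1.2 h2

theorem pow_isBigO_pow {m l : ℕ} (h : l ≤ m) :
    (fun γ : ℝ => (1 - γ) ^ m) =O[𝓝[<] (1 : ℝ)] fun γ => (1 - γ) ^ l := by
  refine IsBigO.of_bound 1 ?_
  filter_upwards [eventually_nonneg_lt_one] with γ hγ
  rw [one_mul, norm_pow, norm_pow]
  refine pow_le_pow_of_le_one (norm_nonneg _) ?_ h
  rw [Real.norm_eq_abs, abs_of_pos (sub_pos.2 hγ.2)]
  linarith [hγ.1]

/-- A polynomial vanishing at `1` to an order beyond its degree is zero. -/
theorem eq_zero_of_isBigO {p : ℝ[X]} {m : ℕ} (hd : p.natDegree < m)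
    (h : (fun γ => p.eval γ) =O[𝓝[<] (1 : ℝ)] fun γ : ℝ => (1 - γ) ^ m) : p = 0 := by
  by_contra hp
  set c := p.rootMultiplicity 1 with hc
  set q := p /ₘ (X - C 1) ^ c with hq
  have hq1 : q.eval 1 ≠ 0 := eval_divByMonic_pow_rootMultiplicity_ne_zero 1 hp
  have hcm : c < m :=
    ((rootMultiplicity_le_rootMultiplicity_of_dvd hp dvd_rfl 1).trans
      ((p.count_roots (a := 1)).symm.le.trans
        ((Multiset.count_le_card _ _).trans p.card_roots'))).trans_lt hd
  have hpq : ∀ γ, p.eval γ = (γ - 1) ^ c * q.eval γ := by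
    intro γ
    conv_lhs => rw [← pow_mul_divByMonic_rootMultiplicity_eq p 1]
    simp only [eval_mul, eval_pow, eval_sub, eval_X, eval_C]
    rfl
  obtain ⟨B, hB⟩ := h.bound
  have hle : ∀ᶠ γ in 𝓝[<] (1 : ℝ), |q.eval γ| ≤ B * (1 - γ) ^ (m - c) := by
    filter_upwards [hB, self_mem_nhdsWithin] with γ hγ hlt
    have hpos : 0 < 1 - γ := sub_pos.2 hlt
    rw [hpq, norm_mul, norm_pow, norm_pow, Real.norm_eq_abs, Real.norm_eq_abs, Real.norm_eq_abs,
      abs_sub_comm, abs_of_pos hpos, ← Nat.sub_add_cancel hcm.le, pow_add] at hγ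
    have hpc : 0 < (1 - γ) ^ c := pow_pos hpos c
    refine le_of_mul_le_mul_left ?_ hpc
    linarith
  have t1 : Tendsto (fun γ => |q.eval γ|) (𝓝[<] (1 : ℝ)) (𝓝 |q.eval 1|) :=
    ((by fun_prop : Continuous fun γ => |q.eval γ|).tendsto 1).mono_left nhdsWithin_le_nhds
  have t2 : Tendsto (fun γ => B * (1 - γ) ^ (m - c)) (𝓝[<] (1 : ℝ)) (𝓝 0) := by
    have := ((by fun_prop : Continuous fun γ : ℝ => B * (1 - γ) ^ (m - c)).tendsto 1).mono_left
      (nhdsWithin_le_nhds (s := Set.Iio 1))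
    rwa [sub_self, zero_pow (by omega), mul_zero] at this
  have := le_of_tendsto_of_tendsto t1 t2 hle
  exact hq1 (abs_nonpos_iff.1 this)

/-- Strict lexicographic comparison of the first `K` terms of two sequences. -/
def LexLT (K : ℕ) (g h : ℕ → ℝ) : Prop := ∃ j < K, (∀ i < j, g i = h i) ∧ g j < h j

theorem lexLT_or_eq_or_lexLT (K : ℕ) (g h : ℕ → ℝ) :
    LexLT K g h ∨ (∀ i < K, g i = h i) ∨ LexLT K h g := by
  classical
  by_cases hall : ∀ i < K, g i = h i
  · exact Or.inr (Or.inl hall)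
  · push Not at hall
    have hK := (Nat.find_spec hall).1
    have hne := (Nat.find_spec hall).2
    have hlt : ∀ i < Nat.find hall, g i = h i := fun i hi => by
      by_contra h'
      exact Nat.find_min hall hi ⟨hi.trans hK, h'⟩
    rcases lt_or_gt_of_ne hne with h' | h'
    · exact Or.inl ⟨_, hK, hlt, h'⟩
    · exact Or.inr (Or.inr ⟨_, hK, fun i hi => (hlt i hi).symm, h'⟩)

theorem LexLT.trans {K : ℕ} {f g h : ℕ → ℝ} (h1 : LexLT K f g) (h2 : LexLT K g h) :
    LexLT K f h := by
  obtain ⟨j, hj, hj1, hj2⟩ := h1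
  obtain ⟨l, hl, hl1, hl2⟩ := h2
  rcases lt_trichotomy j l with hlt | rfl | hlt
  · exact ⟨j, hj, fun i hi => (hj1 i hi).trans (hl1 i (hi.trans hlt)), hj2.trans_eq (hl1 j hlt)⟩
  · exact ⟨j, hj, fun i hi => (hj1 i hi).trans (hl1 i hi), hj2.trans hl2⟩
  · exact ⟨l, hl, fun i hi => (hj1 i (hi.trans hlt)).trans (hl1 i hi), (hj1 l hlt).trans_lt hl2⟩

theorem LexLT.congr {K : ℕ} {g g' h h' : ℕ → ℝ} (hl : LexLT K g h) (hg : ∀ i < K, g i = g' i)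
    (hh : ∀ i < K, h i = h' i) : LexLT K g' h' := by
  obtain ⟨j, hj, hj1, hj2⟩ := hl
  refine ⟨j, hj, fun i hi => ?_, ?_⟩
  · rw [← hg i (hi.trans hj), ← hh i (hi.trans hj), hj1 i hi]
  · rwa [← hg j hj, ← hh j hj]

theorem not_lexLT_self (K : ℕ) (g : ℕ → ℝ) : ¬ LexLT K g g := fun ⟨_, _, _, h⟩ => lt_irrefl _ h

theorem eventually_pos_of_expansion {D : ℝ → ℝ} {d : ℕ → ℝ} {K : ℕ}
    (hD : (fun γ => (1 - γ) ^ 2 * D γ - ∑ i ∈ range K, d i * (1 - γ) ^ (i + 1))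
      =O[𝓝[<] (1 : ℝ)] fun γ : ℝ => (1 - γ) ^ (K + 1)) (hd : LexLT K (fun _ => 0) d) :
    ∀ᶠ γ in 𝓝[<] (1 : ℝ), 0 < D γ := by
  obtain ⟨j, hj, hz, hp⟩ := hd
  have h1 : (fun γ : ℝ => ∑ i ∈ range K, d i * (1 - γ) ^ (i + 1) - d j * (1 - γ) ^ (j + 1))
      =O[𝓝[<] (1 : ℝ)] fun γ : ℝ => (1 - γ) ^ (j + 2) := by
    have e : ∀ γ : ℝ, ∑ i ∈ range K, d i * (1 - γ) ^ (i + 1) - d j * (1 - γ) ^ (j + 1) =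
        ∑ i ∈ (range K).erase j, d i * (1 - γ) ^ (i + 1) := fun γ => by
      rw [← add_sum_erase _ _ (mem_range.2 hj), add_sub_cancel_left]
    simp only [e]
    refine IsBigO.fun_sum fun i hi => ?_
    rcases lt_or_gt_of_ne (mem_erase.1 hi).1 with hlt | hlt
    · rw [← hz i hlt]
      simp only [zero_mul]
      exact isBigO_zero _ _
    · exact (pow_isBigO_pow (show j + 2 ≤ i + 1 by omega)).const_mul_left _
  have h2 := (hD.trans (pow_isBigO_pow (show j + 2 ≤ K + 1 by omega))).add h1
  obtain ⟨B, hB⟩ := h2.bound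
  have t : Tendsto (fun γ => B * (1 - γ)) (𝓝[<] (1 : ℝ)) (𝓝 0) := by
    have := ((by fun_prop : Continuous fun γ : ℝ => B * (1 - γ)).tendsto 1).mono_left
      (nhdsWithin_le_nhds (s := Set.Iio 1))
    rwa [sub_self, mul_zero] at this
  filter_upwards [hB, t.eventually_lt_const hp, self_mem_nhdsWithin] with γ hγ hlt hγ1
  have hpos : 0 < 1 - γ := sub_pos.2 hγ1
  rw [sub_add_sub_cancel, Real.norm_eq_abs, Real.norm_eq_abs, abs_of_pos (pow_pos hpos _)] at hγ
  have h3 := (abs_le.1 hγ).1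
  have h4 : B * (1 - γ) ^ (j + 2) < d j * (1 - γ) ^ (j + 1) := by
    rw [pow_succ' _ (j + 1), ← mul_assoc]
    exact mul_lt_mul_of_pos_right hlt (pow_pos hpos _)
  exact pos_of_mul_pos_right (show 0 < (1 - γ) ^ 2 * D γ by linarith) (by positivity)

/-- If `q * D` is a polynomial of degree less than `K - 1`, then the sign of `D` near `1` is that of
the first non-zero among the first `K` coefficients of its expansion. -/
theorem eventually_pos_iff_of_expansion {D : ℝ → ℝ} {d : ℕ → ℝ} {K : ℕ} {q p : ℝ[X]}
    (hD : (fun γ => (1 - γ) ^ 2 * D γ - ∑ i ∈ range K, d i * (1 - γ) ^ (i + 1))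
      =O[𝓝[<] (1 : ℝ)] fun γ : ℝ => (1 - γ) ^ (K + 1)) (hq : q ≠ 0)
    (hp : ∀ᶠ γ in 𝓝[<] (1 : ℝ), q.eval γ * D γ = p.eval γ) (hK : p.natDegree + 1 < K) :
    (∀ᶠ γ in 𝓝[<] (1 : ℝ), 0 < D γ) ↔ LexLT K (fun _ => 0) d := by
  refine ⟨fun h => ?_, eventually_pos_of_expansion hD⟩
  rcases lexLT_or_eq_or_lexLT K (fun _ => 0) d with h1 | h1 | h1
  · exact h1
  · exfalso
    have e : ∀ γ : ℝ, ∑ i ∈ range K, d i * (1 - γ) ^ (i + 1) = 0 := fun γ =>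
      sum_eq_zero fun i hi => by rw [← h1 i (mem_range.1 hi), zero_mul]
    simp only [e, sub_zero] at hD
    have hqO : (fun γ => q.eval γ) =O[𝓝[<] (1 : ℝ)] fun _ => (1 : ℝ) :=
      ((q.continuous.tendsto 1).mono_left nhdsWithin_le_nhds).isBigO_one ℝ
    have hpO := hqO.mul hD
    simp only [one_mul] at hpO
    have h0 : (X - C 1) ^ 2 * p = 0 := by
      refine eq_zero_of_isBigO (m := K + 1) ?_ (hpO.congr' ?_ EventuallyEq.rfl)
      · refine natDegree_mul_le.trans_lt ?_
        rw [natDegree_pow, natDegree_X_sub_C]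
        omega
      · filter_upwards [hp] with γ hγ
        simp only [eval_mul, eval_pow, eval_sub, eval_X, eval_C, ← hγ]
        ring
    have hp0 : p = 0 := (mul_eq_zero.1 h0).resolve_left (pow_ne_zero _ (X_sub_C_ne_zero 1))
    obtain ⟨γ, g1, g2, g3⟩ := (h.and (hp.and (eventually_eval_ne_zero hq))).exists
    rw [hp0, eval_zero] at g2
    exact (mul_ne_zero g3 g1.ne') g2
  · exfalso
    have h2 := eventually_pos_of_expansion (D := fun γ => -D γ) (d := fun i => -d i) (K := K) (by
      refine hD.neg_left.congr_left fun γ => ?_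
      simp only [neg_mul, sum_neg_distrib]
      ring) (by
      obtain ⟨j, hj, hj1, hj2⟩ := h1
      exact ⟨j, hj, fun i hi => by simp [hj1 i hi], by linarith⟩)
    obtain ⟨γ, g1, g2⟩ := (h.and h2).exists
    linarith

/-- The coefficients of `(1 - x)^2` as a polynomial in `1 - x`. -/
noncomputable def deltaTwo (i : ℕ) : ℝ := if i = 2 then 1 else 0

theorem sum_deltaTwo {L : ℕ} (hL : 2 ≤ L) (ε : ℝ) :
    ∑ i ∈ range L, deltaTwo (i + 1) * ε ^ (i + 1) = ε ^ 2 := by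
  rw [sum_eq_single 1]
  · simp [deltaTwo]
  · intro i _ hi
    simp [deltaTwo, hi]
  · intro h
    exact absurd (mem_range.2 (by omega)) h

/-- Shifting the coefficients of a truncated power series. -/
theorem sum_shift (w : ℕ → ℝ) (hw : w 0 = 0) (ε : ℝ) (L : ℕ) :
    ∑ i ∈ range L, w i * ε ^ (i + 1) =
      ε * ∑ i ∈ range L, w (i + 1) * ε ^ (i + 1) - w L * ε ^ (L + 1) := by
  have h := sum_range_sub (fun i => w i * ε ^ (i + 1)) L
  rw [hw, zero_mul, sub_zero, sum_sub_distrib] at h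
  rw [← h, mul_sum, sub_sub_eq_add_sub, add_comm, eq_sub_iff_add_eq]
  congr 1
  exact sum_congr rfl fun i _ => by ring

namespace DMDP

variable {S A : Type*} (M : DMDP S A)

/-- `W i s`, for `i ≤ L`, solve the equations for the coefficients of `(1 - γ)^i` in
`(1 - γ)^2 V_γ^π(s)` that arise from the Bellman equation with `γ = 1 - (1 - γ)`. -/
structure IsExpansion (π : S → A) (L : ℕ) (W : ℕ → S → ℝ) : Prop where
  zero : ∀ s, W 0 s = 0
  step : ∀ i < L, ∀ s, W (i + 1) s = deltaTwo (i + 1) * M.reward s (π s) +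
    W (i + 1) (M.next s (π s)) - W i (M.next s (π s))

/-- The coefficient of `(1 - γ)^(i + 1)` in `(1 - γ)^2` times the gain of `(s, a)`. -/
noncomputable def gainCoeff (W : ℕ → S → ℝ) (s : S) (a : A) (i : ℕ) : ℝ :=
  deltaTwo (i + 1) * M.reward s a + W (i + 1) (M.next s a) - W i (M.next s a) - W (i + 1) s

variable {M}

/-- The truncated expansion solves the Bellman equation up to an error of order `K + 2` in `1 - γ`,
and the discounted sum of this error loses one order. -/
theorem IsExpansion.value_isBigO [Finite S] {π : S → A} {K : ℕ} {W : ℕ → S → ℝ}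
    (hW : M.IsExpansion π (K + 1) W) (hK : 2 ≤ K) (s : S) :
    (fun γ => (1 - γ) ^ 2 * M.value γ π s - ∑ i ∈ range K, W (i + 1) s * (1 - γ) ^ (i + 1))
      =O[𝓝[<] (1 : ℝ)] fun γ : ℝ => (1 - γ) ^ (K + 1) := by
  obtain ⟨B, hB⟩ := (Set.finite_range fun x => |W (K + 1) x|).bddAbove
  have h1 : (fun γ => (1 - γ) ^ 2 * M.value γ π s -
      ∑ i ∈ range (K + 1), W (i + 1) s * (1 - γ) ^ (i + 1))
      =O[𝓝[<] (1 : ℝ)] fun γ : ℝ => (1 - γ) ^ (K + 1) := by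
    refine IsBigO.of_bound B ?_
    filter_upwards [eventually_nonneg_lt_one] with γ hγ
    obtain ⟨h0, h1⟩ := hγ
    have hpos : 0 < 1 - γ := sub_pos.2 h1
    have hu := eq_discSum_of_bellman h0 h1 (f := M.succ π)
      (h := fun x => -(W (K + 1) (M.succ π x) * (1 - γ) ^ (K + 2)))
      (u := fun x => (1 - γ) ^ 2 * M.value γ π x -
        ∑ i ∈ range (K + 1), W (i + 1) x * (1 - γ) ^ (i + 1)) (fun x => by
          have e1 : ∑ i ∈ range (K + 1), W (i + 1) x * (1 - γ) ^ (i + 1) =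
              (∑ i ∈ range (K + 1), deltaTwo (i + 1) * (1 - γ) ^ (i + 1)) * M.reward x (π x) +
              ∑ i ∈ range (K + 1), W (i + 1) (M.succ π x) * (1 - γ) ^ (i + 1) -
              ∑ i ∈ range (K + 1), W i (M.succ π x) * (1 - γ) ^ (i + 1) := by
            rw [sum_mul, ← sum_add_distrib, ← sum_sub_distrib]
            refine sum_congr rfl fun i hi => ?_
            rw [hW.step i (mem_range.1 hi) x, succ]
            ring
          rw [e1, sum_deltaTwo (by omega), sum_shift (fun i => W i (M.succ π x)) (hW.zero _),
            M.value_bellman h0 h1 π x]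
          simp only [succ]
          ring) s
    rw [hu, norm_pow, Real.norm_eq_abs, Real.norm_eq_abs, abs_of_pos hpos]
    refine (abs_discSum_le h0 h1 (B := B * (1 - γ) ^ (K + 2)) (fun x => ?_) s).trans_eq ?_
    · rw [abs_neg, abs_mul, abs_of_pos (pow_pos hpos _)]
      exact mul_le_mul_of_nonneg_right (hB ⟨_, rfl⟩) (pow_pos hpos _).le
    · rw [pow_succ, ← mul_assoc, mul_div_cancel_right₀ _ hpos.ne']
  have h2 : (fun γ : ℝ => W (K + 1) s * (1 - γ) ^ (K + 1)) =O[𝓝[<] 1]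
      fun γ => (1 - γ) ^ (K + 1) := (isBigO_refl _ _).const_mul_left _
  refine (h1.add h2).congr_left fun γ => ?_
  rw [sum_range_succ]
  ring

theorem IsExpansion.gain_isBigO [Finite S] {π : S → A} {K : ℕ} {W : ℕ → S → ℝ}
    (hW : M.IsExpansion π (K + 1) W) (hK : 2 ≤ K) (s : S) (a : A) :
    (fun γ => (1 - γ) ^ 2 * M.gain γ π s a -
      ∑ i ∈ range K, M.gainCoeff W s a i * (1 - γ) ^ (i + 1))
      =O[𝓝[<] (1 : ℝ)] fun γ : ℝ => (1 - γ) ^ (K + 1) := by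
  have hγ : (fun γ : ℝ => γ) =O[𝓝[<] 1] fun _ => (1 : ℝ) :=
    ((continuous_id.tendsto (1 : ℝ)).mono_left nhdsWithin_le_nhds).isBigO_one ℝ
  have h1 := hγ.mul (hW.value_isBigO hK (M.next s a))
  simp only [one_mul] at h1
  have h2 : (fun γ : ℝ => W K (M.next s a) * (1 - γ) ^ (K + 1)) =O[𝓝[<] 1]
      fun γ => (1 - γ) ^ (K + 1) := (isBigO_refl _ _).const_mul_left _
  refine ((h1.sub (hW.value_isBigO hK s)).sub h2).congr_left fun γ => ?_
  have e1 : ∑ i ∈ range K, M.gainCoeff W s a i * (1 - γ) ^ (i + 1) =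
      (∑ i ∈ range K, deltaTwo (i + 1) * (1 - γ) ^ (i + 1)) * M.reward s a +
      ∑ i ∈ range K, W (i + 1) (M.next s a) * (1 - γ) ^ (i + 1) -
      ∑ i ∈ range K, W i (M.next s a) * (1 - γ) ^ (i + 1) -
      ∑ i ∈ range K, W (i + 1) s * (1 - γ) ^ (i + 1) := by
    rw [sum_mul, ← sum_add_distrib, ← sum_sub_distrib, ← sum_sub_distrib]
    refine sum_congr rfl fun i hi => ?_
    rw [gainCoeff]
    ring
  rw [e1, sum_deltaTwo hK, sum_shift (fun i => W i (M.next s a)) (hW.zero _), gain]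
  ring

variable [DecidableEq S]

variable (M) in
theorem natDegree_bellmanMatrix_le (π : S → A) (s s' : S) :
    (M.bellmanMatrix π s s').natDegree ≤ 1 := by
  rw [bellmanMatrix, Matrix.sub_apply, Matrix.smul_apply, Matrix.of_apply, Matrix.one_apply,
    smul_eq_mul]
  refine (natDegree_sub_le _ _).trans (max_le ?_ ?_)
  · split_ifs <;> simp
  · split_ifs <;> simp

variable [Fintype S]

variable (M) in
theorem natDegree_valueNum_le (π : S → A) (s : S) :
    (M.valueNum π s).natDegree ≤ Fintype.card S := by
  rw [valueNum, Matrix.cramer_apply]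
  refine natDegree_det_le fun i j => ?_
  rw [Matrix.updateCol_apply]
  split_ifs
  · simp
  · exact M.natDegree_bellmanMatrix_le π i j

variable (M) in
/-- The gain times the determinant of `I - γ P^π`, a polynomial in `γ` of degree at most `n + 1`. -/
noncomputable def gainNum (π : S → A) (s : S) (a : A) : ℝ[X] :=
  C (M.reward s a) * (M.bellmanMatrix π).det + X * M.valueNum π (M.next s a) - M.valueNum π s

variable (M) in
theorem natDegree_gainNum_le (π : S → A) (s : S) (a : A) :
    (M.gainNum π s a).natDegree ≤ Fintype.card S + 1 := by
  have h1 : (C (M.reward s a) * (M.bellmanMatrix π).det).natDegree ≤ Fintype.card S + 1 :=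
    (natDegree_C_mul_le _ _).trans
      ((natDegree_det_le (M.natDegree_bellmanMatrix_le π)).trans (Nat.le_succ _))
  have h2 : (X * M.valueNum π (M.next s a)).natDegree ≤ Fintype.card S + 1 := by
    refine natDegree_mul_le.trans ?_
    rw [natDegree_X, add_comm]
    exact Nat.succ_le_succ (M.natDegree_valueNum_le π _)
  exact (natDegree_sub_le _ _).trans (max_le ((natDegree_add_le _ _).trans (max_le h1 h2))
    ((M.natDegree_valueNum_le π s).trans (Nat.le_succ _)))

variable (M) in
theorem eventually_det_mul_gain (π : S → A) (s : S) (a : A) :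
    ∀ᶠ γ in 𝓝[<] (1 : ℝ), (M.bellmanMatrix π).det.eval γ * M.gain γ π s a =
      (M.gainNum π s a).eval γ := by
  filter_upwards [eventually_eval_ne_zero (M.bellmanMatrix_det_ne_zero π),
    eventually_nonneg_lt_one] with γ h1 h2
  rw [gain, ← M.valueNum_eval h2.1 h2.2 π h1 s, ← M.valueNum_eval h2.1 h2.2 π h1 (M.next s a),
    gainNum]
  simp only [eval_sub, eval_add, eval_mul, eval_C, eval_X]
  field_simp

theorem IsExpansion.muGT_zero_iff {π : S → A} {W : ℕ → S → ℝ}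
    (hW : M.IsExpansion π (Fintype.card S + 4) W) (s : S) (a : A) :
    MuGT (M.ratGain π s a) 0 ↔ LexLT (Fintype.card S + 3) (fun _ => 0) (M.gainCoeff W s a) := by
  rw [eventually_of_iff (M.eventually_muGT_zero_iff π s a)]
  exact eventually_pos_iff_of_expansion (hW.gain_isBigO (by omega) s a)
    (M.bellmanMatrix_det_ne_zero π) (M.eventually_det_mul_gain π s a)
    (by have := M.natDegree_gainNum_le π s a; omega)

/-- The `μ`-ordering of the gains is the lexicographic ordering of their first `n + 3`
coefficients. -/
theorem IsExpansion.muGT_iff {π : S → A} {W : ℕ → S → ℝ}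
    (hW : M.IsExpansion π (Fintype.card S + 4) W) (s : S) (a : A) (s' : S) (a' : A) :
    MuGT (M.ratGain π s a) (M.ratGain π s' a') ↔
      LexLT (Fintype.card S + 3) (M.gainCoeff W s' a') (M.gainCoeff W s a) := by
  rw [eventually_of_iff (M.eventually_muGT_gain_iff π s a s' a')]
  simp only [← sub_pos (b := M.gain _ π s' a')]
  rw [eventually_pos_iff_of_expansion (K := Fintype.card S + 3)
    (d := fun i => M.gainCoeff W s a i - M.gainCoeff W s' a' i)
    (p := M.gainNum π s a - M.gainNum π s' a') ?_
    (M.bellmanMatrix_det_ne_zero π) ?_ ?_]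
  · refine exists_congr fun j => and_congr_right fun _ => and_congr ?_ sub_pos
    exact forall₂_congr fun i _ => by rw [eq_comm, sub_eq_zero, eq_comm]
  · refine ((hW.gain_isBigO (by omega) s a).sub
      (hW.gain_isBigO (by omega) s' a')).congr_left fun γ => ?_
    simp only [sub_mul, sum_sub_distrib]
    ring
  · filter_upwards [M.eventually_det_mul_gain π s a, M.eventually_det_mul_gain π s' a']
      with γ h1 h2
    rw [mul_sub, h1, h2, eval_sub]
  · have h1 := M.natDegree_gainNum_le π s a
    have h2 := M.natDegree_gainNum_le π s' a'
    have h3 := natDegree_sub_le (M.gainNum π s a) (M.gainNum π s' a')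
    have h4 := max_le h1 h2
    omega

end DMDP

end BlackwellDMDP

namespace BlackwellDMDP

/-! ### Reasoning about programs and their running time -/

/-- The variable for natural numbers that an instruction may change. -/
def Instr.nvars : Instr → List ℕ
  | nconst x _ | nadd x _ _ | nsub x _ _ | nload x _ _ _ => [x]
  | _ => []

/-- The array of natural numbers that an instruction may change. -/
def Instr.narrs : Instr → List ℕ
  | nstore T _ _ _ => [T]
  | _ => []

/-- The array of real numbers that an instruction may change. -/
def Instr.rarrs : Instr → List ℕ
  | rstore T _ _ _ => [T]
  | _ => []

/-- The real variable that an instruction may change. -/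
def Instr.rvars : Instr → List ℕ
  | rzero x | rone x | radd x _ _ | rsub x _ _ | rmul x _ _ | rdiv x _ _ | rload x _ _ _ => [x]
  | _ => []

namespace Prog

/-- The list of all `F c`, for the instructions `c` of a program. -/
def collect (F : Instr → List ℕ) : Prog → List ℕ
  | skip => []
  | instr c => F c
  | seq P Q => P.collect F ++ Q.collect F
  | ite _ P Q => P.collect F ++ Q.collect F
  | .while _ P => P.collect F

/-- A sequence of instructions. -/
def block : List Instr → Prog
  | [] => skip
  | c :: l => seq (instr c) (block l)

/-- The loop `for v := 0 to b - 1 do P`. The variable `3` is supposed to hold the number one. -/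
def forLoop (v b : ℕ) (P : Prog) : Prog :=
  seq (instr (Instr.nconst v 0)) (Prog.while (Test.nlt v b) (seq P (instr (Instr.nadd v v 3))))

end Prog

/-- The memory states `σ` and `σ'` agree on everything that `P` does not write to. -/
structure Frame (P : Prog) (σ σ' : Mem) : Prop where
  nvar : ∀ x, x ∉ P.collect Instr.nvars → σ'.nvar x = σ.nvar x
  narr : ∀ T, T ∉ P.collect Instr.narrs → σ'.narr T = σ.narr T
  rvar : ∀ x, x ∉ P.collect Instr.rvars → σ'.rvar x = σ.rvar x
  rarr : ∀ T, T ∉ P.collect Instr.rarrs → σ'.rarr T = σ.rarr T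

theorem update3_of_ne {α : Type*} (f : ℕ → ℕ → ℕ → α) {T T' : ℕ} (i j : ℕ) (v : α) (h : T' ≠ T) :
    update3 f T i j v T' = f T' := by
  funext i' j'
  simp [update3, h]

theorem Frame.refl (P : Prog) (σ : Mem) : Frame P σ σ :=
  ⟨fun _ _ => rfl, fun _ _ => rfl, fun _ _ => rfl, fun _ _ => rfl⟩

theorem Frame.trans {P : Prog} {σ σ' σ'' : Mem} (h : Frame P σ σ') (h' : Frame P σ' σ'') :
    Frame P σ σ'' :=
  ⟨fun x hx => (h'.nvar x hx).trans (h.nvar x hx), fun x hx => (h'.narr x hx).trans (h.narr x hx),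
    fun x hx => (h'.rvar x hx).trans (h.rvar x hx), fun x hx => (h'.rarr x hx).trans (h.rarr x hx)⟩

theorem Frame.mono {P Q : Prog} {σ σ' : Mem} (h : Frame P σ σ')
    (hPQ : ∀ F, P.collect F ⊆ Q.collect F) : Frame Q σ σ' :=
  ⟨fun x hx => h.nvar x fun hm => hx (hPQ _ hm), fun x hx => h.narr x fun hm => hx (hPQ _ hm),
    fun x hx => h.rvar x fun hm => hx (hPQ _ hm), fun x hx => h.rarr x fun hm => hx (hPQ _ hm)⟩

theorem Frame.instr (c : Instr) (σ : Mem) : Frame (Prog.instr c) σ (c.apply σ) := by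
  constructor <;> intro x hx <;> cases c <;>
    simp_all [Instr.apply, Prog.collect, Instr.nvars, Instr.narrs, Instr.rvars, Instr.rarrs,
      Function.update_of_ne, update3_of_ne]

theorem Frame.block (l : List Instr) (σ : Mem) :
    Frame (Prog.block l) σ (l.foldl Instr.apply σ) := by
  induction l generalizing σ with
  | nil => exact Frame.refl _ σ
  | cons c l ih =>
    exact ((Frame.instr c σ).mono fun _ => List.subset_append_left _ _).trans
      ((ih _).mono fun _ => List.subset_append_right _ _)

theorem Exec.frame {P : Prog} {σ σ' : Mem} {t : ℕ} (h : Exec P σ t σ') : Frame P σ σ' := by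
  induction h with
  | skip σ => exact Frame.refl _ σ
  | instr c σ => exact Frame.instr c σ
  | seq _ _ h1 h2 =>
    exact (h1.mono fun _ => List.subset_append_left _ _).trans
      (h2.mono fun _ => List.subset_append_right _ _)
  | ite_true _ _ h1 => exact h1.mono fun _ => List.subset_append_left _ _
  | ite_false _ _ h1 => exact h1.mono fun _ => List.subset_append_right _ _
  | while_true _ _ _ h1 h2 => exact Frame.trans (h1.mono fun _ => List.Subset.refl _) h2
  | while_false _ => exact Frame.refl _ _

/-- Started in `σ`, the program `P` halts, and the number of steps and the final memory
satisfy `Q`. -/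
def Runs (P : Prog) (σ : Mem) (Q : ℕ → Mem → Prop) : Prop :=
  ∃ t σ', Exec P σ t σ' ∧ Q t σ'

namespace Runs

variable {P P' : Prog} {σ : Mem} {Q Q' : ℕ → Mem → Prop} {b : Test}

theorem conseq (h : Runs P σ Q) (hQ : ∀ t σ', Frame P σ σ' → Q t σ' → Q' t σ') :
    Runs P σ Q' := by
  obtain ⟨t, σ', h1, h2⟩ := h
  exact ⟨t, σ', h1, hQ t σ' h1.frame h2⟩

theorem seq (h : Runs P σ fun t σ' => Runs P' σ' fun u σ'' => Q (t + u) σ'') :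
    Runs (Prog.seq P P') σ Q := by
  obtain ⟨t, σ', h1, u, σ'', h2, h3⟩ := h
  exact ⟨_, _, Exec.seq h1 h2, h3⟩

theorem skip (h : Q 1 σ) : Runs Prog.skip σ Q := ⟨_, _, Exec.skip σ, h⟩

theorem instr {c : Instr} (h : Q 1 (c.apply σ)) : Runs (Prog.instr c) σ Q :=
  ⟨_, _, Exec.instr c σ, h⟩

theorem block {l : List Instr} (h : Q (l.length + 1) (l.foldl Instr.apply σ)) :
    Runs (Prog.block l) σ Q := by
  induction l generalizing σ Q with
  | nil => exact skip h
  | cons c l ih =>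
    refine seq (instr (ih ?_))
    rw [List.length_cons, add_right_comm] at h
    rw [add_comm 1]
    exact h

theorem ite (h1 : b.Holds σ → Runs P σ fun t σ' => Q (t + 1) σ')
    (h2 : ¬ b.Holds σ → Runs P' σ fun t σ' => Q (t + 1) σ') : Runs (Prog.ite b P P') σ Q := by
  by_cases hb : b.Holds σ
  · obtain ⟨t, σ', h3, h4⟩ := h1 hb
    exact ⟨_, _, Exec.ite_true hb h3, h4⟩
  · obtain ⟨t, σ', h3, h4⟩ := h2 hb
    exact ⟨_, _, Exec.ite_false hb h3, h4⟩

/-- Rule for `for` loops. The invariant `I i T σ` may refer to the number `i` of completed passes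
and to the number `T` of steps that were spent in them. -/
theorem forLoop {v c N : ℕ} (I : ℕ → ℕ → Mem → Prop) (h3 : σ.nvar 3 = 1) (hc : σ.nvar c = N)
    (hfix : v ≠ 3 ∧ v ≠ c ∧ 3 ∉ P.collect Instr.nvars ∧ c ∉ P.collect Instr.nvars ∧
      v ∉ P.collect Instr.nvars)
    (h0 : I 0 0 { σ with nvar := Function.update σ.nvar v 0 })
    (hstep : ∀ i T σ', i < N → Frame (Prog.forLoop v c P) σ σ' → σ'.nvar v = i → I i T σ' →
      Runs P σ' fun t σ'' => I (i + 1) (T + t)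
        { σ'' with nvar := Function.update σ''.nvar v (i + 1) }) :
    Runs (Prog.forLoop v c P) σ fun t σ' => ∃ T, t = T + 2 * N + 2 ∧ I N T σ' := by
  obtain ⟨hv3, hvc, hP3, hPc, hPv⟩ := hfix
  have n3 : ∀ σ', Frame (Prog.forLoop v c P) σ σ' → σ'.nvar 3 = 1 := fun σ' hf => by
    rw [hf.nvar, h3]
    simp [Prog.forLoop, Prog.collect, Instr.nvars, hP3, hv3.symm]
  have nc : ∀ σ', Frame (Prog.forLoop v c P) σ σ' → σ'.nvar c = N := fun σ' hf => by
    rw [hf.nvar, hc]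
    simp [Prog.forLoop, Prog.collect, Instr.nvars, hPc, hvc.symm]
  have hw : ∀ m i T σ', i + m = N → Frame (Prog.forLoop v c P) σ σ' → σ'.nvar v = i →
      I i T σ' → Runs (Prog.while (Test.nlt v c) (Prog.seq P (Prog.instr (Instr.nadd v v 3)))) σ'
        fun t σ'' => ∃ T', T + t = T' + 2 * m + 1 ∧ I N T' σ'' := by
    intro m
    induction m with
    | zero =>
      intro i T σ' hi hf hv hI
      refine ⟨_, _, Exec.while_false ?_, T, by omega, ?_⟩
      · rw [Test.Holds, nc σ' hf, hv]; omega
      · rwa [show N = i by omega]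
    | succ m ih =>
      intro i T σ' hi hf hv hI
      obtain ⟨t, σ'', hE, hI'⟩ := hstep i T σ' (by omega) hf hv hI
      have hE' := Exec.seq hE (Exec.instr (Instr.nadd v v 3) σ'')
      have hf' : Frame (Prog.forLoop v c P) σ ((Instr.nadd v v 3).apply σ'') :=
        hf.trans (hE'.frame.mono fun _ => List.subset_append_right _ _)
      have e : (Instr.nadd v v 3).apply σ'' =
          { σ'' with nvar := Function.update σ''.nvar v (i + 1) } := by
        have g1 : σ''.nvar v = i := by rw [hE.frame.nvar v hPv, hv]
        have g2 : σ''.nvar 3 = 1 := by rw [hE.frame.nvar 3 hP3, n3 σ' hf]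
        rw [Instr.apply, g1, g2]
      rw [e] at hE' hf'
      obtain ⟨u, σ''', hE2, T', hT, hI2⟩ := ih (i + 1) (T + t) _ (by omega) hf'
        (Function.update_self _ _ _) hI'
      refine ⟨_, _, Exec.while_true ?_ hE' hE2, T', by omega, hI2⟩
      rw [Test.Holds, nc σ' hf, hv]; omega
  have hf0 : Frame (Prog.forLoop v c P) σ { σ with nvar := Function.update σ.nvar v 0 } :=
    (Frame.instr (Instr.nconst v 0) σ).mono fun _ => List.subset_append_left _ _
  obtain ⟨t, σ', hE, T, hT, hI⟩ := hw N 0 0 _ (by omega) hf0 (Function.update_self _ _ _) h0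
  exact ⟨_, _, Exec.seq (Exec.instr _ _) hE, T, by omega, hI⟩

/-- Rule for `for` loops with a uniform bound on the running time of a pass. -/
theorem forLoop_le {v c N B : ℕ} (I : ℕ → Mem → Prop) (h3 : σ.nvar 3 = 1) (hc : σ.nvar c = N)
    (hfix : v ≠ 3 ∧ v ≠ c ∧ 3 ∉ P.collect Instr.nvars ∧ c ∉ P.collect Instr.nvars ∧
      v ∉ P.collect Instr.nvars)
    (h0 : I 0 { σ with nvar := Function.update σ.nvar v 0 })
    (hstep : ∀ i σ', i < N → Frame (Prog.forLoop v c P) σ σ' → σ'.nvar v = i → I i σ' →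
      Runs P σ' fun t σ'' => t ≤ B ∧ I (i + 1)
        { σ'' with nvar := Function.update σ''.nvar v (i + 1) }) :
    Runs (Prog.forLoop v c P) σ fun t σ' => t ≤ N * (B + 2) + 2 ∧ I N σ' := by
  refine (forLoop (fun i T σ' => T ≤ i * B ∧ I i σ') h3 hc hfix ⟨by omega, h0⟩
    fun i T σ' hi hf hv hI => (hstep i σ' hi hf hv hI.2).conseq fun t σ'' _ h => ⟨?_, h.2⟩).conseq
    fun t σ' _ h => ?_
  · rw [Nat.add_mul, Nat.one_mul]
    exact Nat.add_le_add hI.1 h.1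
  · obtain ⟨T, hT, hTB, hI⟩ := h
    refine ⟨?_, hI⟩
    rw [Nat.mul_add]
    omega

end Runs

end BlackwellDMDP

namespace BlackwellDMDP

open Function

/-! ### Evaluating a policy: walks and states off the cycles -/

/-- The memory contents on which all parts of the program rely: `n`, `k`, the constants `1`, `0`,
`n + 3`, `n + 4` and the coefficients of `(1 - x)^2`.

The arrays of natural numbers are used as follows: `0` transitions, `1` initial policy, `2` visited
policies, `3` successors under the current policy, `4` marks of the states whose value is expanded,
`5` the current walk, `6` the current cycle. The arrays of real numbers: `0` rewards, `1` rewards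
under the current policy, `2` coefficients of the values (row `i` for the order `i`), `3` the
coefficients of `(1 - x)^2`, `4` the best gain found, `5` the gain of the current pair. -/
structure Ctx (n k : ℕ) (σ : Mem) : Prop where
  hn : σ.nvar 0 = n
  hk : σ.nvar 1 = k
  one : σ.nvar 3 = 1
  zero : σ.nvar 4 = 0
  hK : σ.nvar 5 = n + 3
  hL : σ.nvar 6 = n + 4
  delta : ∀ i ≤ n + 5, σ.rarr 3 0 i = deltaTwo i

/-- The program leaves the memory contents described by `Ctx` unchanged. -/
def Prog.KeepsCtx (P : Prog) : Prop :=
  (∀ x ∈ [0, 1, 3, 4, 5, 6], x ∉ P.collect Instr.nvars) ∧ 3 ∉ P.collect Instr.rarrs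

instance (P : Prog) : Decidable P.KeepsCtx := by unfold Prog.KeepsCtx; infer_instance

theorem Ctx.frame {n k : ℕ} {σ σ' : Mem} {P : Prog} (h : Ctx n k σ) (hf : Frame P σ σ')
    (hP : P.KeepsCtx) : Ctx n k σ' := by
  obtain ⟨h1, h2⟩ := hP
  simp only [List.forall_mem_cons] at h1
  obtain ⟨a, b, c, d, e, f, -⟩ := h1
  refine ⟨?_, ?_, ?_, ?_, ?_, ?_, ?_⟩
  · rw [hf.nvar _ a, h.hn]
  · rw [hf.nvar _ b, h.hk]
  · rw [hf.nvar _ c, h.one]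
  · rw [hf.nvar _ d, h.zero]
  · rw [hf.nvar _ e, h.hK]
  · rw [hf.nvar _ f, h.hL]
  · rw [hf.rarr _ h2]; exact h.delta

/-- In addition to `Ctx`, the memory holds the successor map `f` and the rewards `r` of the current
policy. -/
structure EvalCtx (n k : ℕ) (f : ℕ → ℕ) (r : ℕ → ℝ) (σ : Mem) : Prop extends Ctx n k σ where
  succ : ∀ s < n, σ.narr 3 0 s = f s
  rew : ∀ s < n, σ.rarr 1 0 s = r s

theorem EvalCtx.frame {n k : ℕ} {f : ℕ → ℕ} {r : ℕ → ℝ} {σ σ' : Mem} {P : Prog}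
    (h : EvalCtx n k f r σ) (hf : Frame P σ σ')
    (hP : P.KeepsCtx ∧ 3 ∉ P.collect Instr.narrs ∧ 1 ∉ P.collect Instr.rarrs) :
    EvalCtx n k f r σ' := by
  refine ⟨h.toCtx.frame hf hP.1, ?_, ?_⟩
  · rw [hf.narr _ hP.2.1]; exact h.succ
  · rw [hf.rarr _ hP.2.2]; exact h.rew

theorem iterate_lt {n : ℕ} {f : ℕ → ℕ} (hf : ∀ s < n, f s < n) {x : ℕ} (hx : x < n) (j : ℕ) :
    f^[j] x < n := by
  induction j with
  | zero => exact hx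
  | succ j ih => rw [iterate_succ_apply']; exact hf _ ih

/-- Stores the first `n` iterates of the successor map at variable `11` in the array `T`. -/
def walkProg (T : ℕ) : Prog :=
  .seq (.block [.nadd 18 11 4, .nstore T 4 4 18])
    (.forLoop 17 0 (.block [.nload 18 3 4 18, .nadd 13 17 3, .nstore T 4 13 18]))

theorem runs_walkProg {n k : ℕ} {f : ℕ → ℕ} {r : ℕ → ℝ} {σ : Mem} {T x : ℕ}
    (hσ : EvalCtx n k f r σ) (hf : ∀ s < n, f s < n) (hT : T ≠ 3) (hx : x < n)
    (hx' : σ.nvar 11 = x) :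
    Runs (walkProg T) σ fun t σ' => t ≤ 6 * n + 5 ∧ (∀ j ≤ n, σ'.narr T 0 j = f^[j] x) ∧
      σ'.nvar 18 = f^[n] x := by
  refine Runs.seq (Runs.block ?_)
  have h4 := hσ.zero
  refine (Runs.forLoop_le (N := n) (B := 4)
    (fun i σ' => σ'.nvar 18 = f^[i] x ∧ (∀ s < n, σ'.narr 3 0 s = f s) ∧
      ∀ j ≤ i, σ'.narr T 0 j = f^[j] x) ?_ ?_ ?_ ?_ ?_).conseq ?_
  · simp [Instr.apply, hσ.one]
  · simp [Instr.apply, hσ.hn]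
  · simp [Prog.collect, Prog.block, Instr.nvars]
  · refine ⟨by simp [Instr.apply, h4, hx'], fun s hs => ?_, fun j hj => ?_⟩
    · simp [Instr.apply, update3, hT.symm, hσ.succ s hs]
    · simp [Instr.apply, update3, h4, hx', Nat.le_zero.1 hj]
  · rintro i σ' hi hfr hv ⟨h18, hs, ha⟩
    have h3 : σ'.nvar 3 = 1 := by
      rw [hfr.nvar _ (by simp [Prog.collect, Prog.block, Prog.forLoop, Instr.nvars])]
      simp [Instr.apply, hσ.one]
    have h4 : σ'.nvar 4 = 0 := by
      rw [hfr.nvar _ (by simp [Prog.collect, Prog.block, Prog.forLoop, Instr.nvars])]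
      simp [Instr.apply, hσ.zero]
    have hit := iterate_lt hf hx i
    refine Runs.block ⟨by simp, ?_, fun s hs' => ?_, fun j hj => ?_⟩
    · simp [Instr.apply, h4, h18, hs _ hit, iterate_succ_apply']
    · simp [Instr.apply, update3, hT.symm, hs s hs']
    · rcases Nat.lt_succ_iff_lt_or_eq.1 (Nat.lt_succ_of_le hj) with hlt | rfl
      · have : j ≠ i + 1 := by omega
        simp [Instr.apply, update3, h4, hv, h3, this, ha j (by omega)]
      · simp [Instr.apply, update3, h4, hv, h3, h18, hs _ hit, iterate_succ_apply']
  · rintro t σ' - ⟨ht, h18, -, ha⟩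
    refine ⟨by simp; omega, ha, h18⟩

/-- Computes the expansion of the value at the state in variable `11` from that at its successor,
which is in variable `15`, and marks the state as done. -/
def treeProg : Prog :=
  .seq (.forLoop 16 6 (.block [.nadd 17 16 3, .rload 0 3 4 17, .rload 1 1 4 11, .rmul 0 0 1,
    .rload 1 2 17 15, .radd 0 0 1, .rload 1 2 16 15, .rsub 0 0 1, .rstore 2 17 11 0]))
    (.block [.nstore 4 4 11 3])

theorem runs_treeProg {n k : ℕ} {f : ℕ → ℕ} {r : ℕ → ℝ} {σ : Mem} {x y : ℕ}
    (hσ : EvalCtx n k f r σ) (hx : x < n) (hxy : y ≠ x) (hx' : σ.nvar 11 = x)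
    (hy' : σ.nvar 15 = y) :
    Runs treeProg σ fun t σ' => t ≤ 12 * n + 52 ∧
      (∀ s, σ'.narr 4 0 s = if s = x then 1 else σ.narr 4 0 s) ∧
      (∀ i, ∀ s ≠ x, σ'.rarr 2 i s = σ.rarr 2 i s) ∧ σ'.rarr 2 0 x = σ.rarr 2 0 x ∧
      ∀ i < n + 4, σ'.rarr 2 (i + 1) x =
        deltaTwo (i + 1) * r x + σ.rarr 2 (i + 1) y - σ.rarr 2 i y := by
  refine Runs.seq ((Runs.forLoop_le (N := n + 4) (B := 10)
    (fun i σ' => (∀ i, ∀ s ≠ x, σ'.rarr 2 i s = σ.rarr 2 i s) ∧ σ'.rarr 2 0 x = σ.rarr 2 0 x ∧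
      ∀ j < i, σ'.rarr 2 (j + 1) x =
        deltaTwo (j + 1) * r x + σ.rarr 2 (j + 1) y - σ.rarr 2 j y)
    hσ.one hσ.hL (by decide) ?_ ?_).conseq ?_)
  · exact ⟨fun _ _ _ => rfl, rfl, fun j hj => absurd hj (Nat.not_lt_zero j)⟩
  · rintro i σ' hi hfr hv ⟨h1, h2, h3⟩
    have hc := hσ.frame hfr (by decide)
    have e11 : σ'.nvar 11 = x := (hfr.nvar _ (by decide)).trans hx'
    have e15 : σ'.nvar 15 = y := (hfr.nvar _ (by decide)).trans hy'
    have hd := hc.delta (i + 1) (by omega)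
    refine Runs.block ⟨by simp, fun j s hs => ?_, ?_, fun j hj => ?_⟩
    · simp [Instr.apply, update3, e11, hs, h1 j s hs]
    · simp [Instr.apply, update3, e11, hc.one, h2]
    · rcases Nat.lt_succ_iff_lt_or_eq.1 hj with hlt | rfl
      · have : j ≠ i := by omega
        simp [Instr.apply, update3, hc.one, hv, this, h3 j hlt]
      · simp [Instr.apply, update3, hc.one, hc.zero, hv, e11, e15, hd, hc.rew x hx, h1 _ y hxy]
  · rintro t σ' hfr ⟨ht, h1, h2, h3⟩
    have hc := hσ.frame hfr (by decide)
    have e11 : σ'.nvar 11 = x := (hfr.nvar _ (by decide)).trans hx'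
    refine Runs.block ⟨by simp; omega, fun s => ?_, h1, h2, h3⟩
    have : σ'.narr 4 = σ.narr 4 := hfr.narr _ (by decide)
    simp [Instr.apply, update3, e11, hc.one, hc.zero, this]

end BlackwellDMDP

namespace BlackwellDMDP

open Function Finset

/-! ### Evaluating a policy: cycles -/

/-- Stores in variable `19` the least `c ≥ 1` for which entry `c` of array `6` is the state in
variable `11`. -/
def periodProg : Prog :=
  .seq (.block [.nadd 19 0 4])
    (.forLoop 17 0 (.seq (.block [.nsub 13 0 17, .nload 18 6 4 13])
      (.ite (.nlt 18 11) .skip (.ite (.nlt 11 18) .skip (.block [.nadd 19 13 4])))))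

theorem runs_periodProg {n k : ℕ} {σ : Mem} {x : ℕ} {z : ℕ → ℕ} (hσ : Ctx n k σ)
    (hx' : σ.nvar 11 = x) (hz : ∀ j ≤ n, σ.narr 6 0 j = z j) (hper : ∃ m ≤ n, 0 < m ∧ z m = x) :
    Runs periodProg σ fun t σ' => t ≤ 9 * n + 4 ∧ 0 < σ'.nvar 19 ∧ σ'.nvar 19 ≤ n ∧
      z (σ'.nvar 19) = x ∧ ∀ j < σ'.nvar 19, 0 < j → z j ≠ x := by
  refine Runs.seq (Runs.block ?_)
  refine (Runs.forLoop_le (N := n) (B := 7)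
    (fun i σ' => σ'.nvar 19 ≤ n ∧ n - i ≤ σ'.nvar 19 ∧ (0 < n → 0 < σ'.nvar 19) ∧
      (∀ j < σ'.nvar 19, n - i < j → z j ≠ x) ∧
      (z (σ'.nvar 19) = x ∨ σ'.nvar 19 = n ∧ ∀ j ≤ n, n - i < j → z j ≠ x))
    ?_ ?_ (by decide) ?_ ?_).conseq ?_
  · simp [Instr.apply, hσ.one]
  · simp [Instr.apply, hσ.hn]
  · have : update (update σ.nvar 19 (σ.nvar 0 + σ.nvar 4)) 17 0 19 = n := by
      simp [hσ.hn, hσ.zero]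
    simp only [Instr.apply, List.foldl_cons, List.foldl_nil, this]
    exact ⟨le_rfl, by omega, fun h => h, fun j h1 h2 => by omega, Or.inr ⟨by trivial,
      fun j h1 h2 => by omega⟩⟩
  · rintro i σ' hi hfr hv ⟨h1, h2, h3, h4, h5⟩
    have e11 : σ'.nvar 11 = x := by
      rw [hfr.nvar _ (by decide)]; simp [Instr.apply, hx']
    have e0 : σ'.nvar 0 = n := by
      rw [hfr.nvar _ (by decide)]; simp [Instr.apply, hσ.hn]
    have e4 : σ'.nvar 4 = 0 := by
      rw [hfr.nvar _ (by decide)]; simp [Instr.apply, hσ.zero]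
    have e6 : σ'.narr 6 0 (n - i) = z (n - i) := by
      rw [hfr.narr _ (by decide)]; simp [Instr.apply, hz]
    have hne : z (n - i) ≠ x → (∀ j < σ'.nvar 19, n - (i + 1) < j → z j ≠ x) ∧
        (z (σ'.nvar 19) = x ∨ σ'.nvar 19 = n ∧ ∀ j ≤ n, n - (i + 1) < j → z j ≠ x) := by
      intro hne
      refine ⟨fun j h6 h7 => ?_, h5.imp_right fun h5 => ⟨h5.1, fun j h6 h7 => ?_⟩⟩
      · rcases eq_or_ne j (n - i) with rfl | h8
        · exact hne
        · exact h4 j h6 (by omega)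
      · rcases eq_or_ne j (n - i) with rfl | h8
        · exact hne
        · exact h5.2 j h6 (by omega)
    refine Runs.seq (Runs.block ?_)
    refine Runs.ite (fun hlt => Runs.skip ⟨by simp, ?_⟩) fun hge => Runs.ite
      (fun hlt => Runs.skip ⟨by simp, ?_⟩) fun hge' => Runs.block ⟨by simp, ?_⟩
    · simp [Test.Holds, Instr.apply, e11, e0, hv, e4, e6] at hlt
      simp [Instr.apply]
      exact ⟨h1, by omega, h3, hne hlt.ne⟩
    · simp [Test.Holds, Instr.apply, e11, e0, hv, e4, e6] at hlt
      simp [Instr.apply]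
      exact ⟨h1, by omega, h3, hne hlt.ne'⟩
    · simp [Test.Holds, Instr.apply, e11, e0, hv, e4, e6] at hge hge'
      have hzx : z (n - i) = x := le_antisymm hge' hge
      simp [Instr.apply, e0, hv, e4]
      exact ⟨by omega, by omega, fun j h6 h7 => by omega, Or.inl hzx⟩
  · rintro t σ' - ⟨ht, h1, h2, h3, h4, h5⟩
    obtain ⟨m, hm, hm0, hzm⟩ := hper
    refine ⟨by simp; omega, h3 (by omega), h1, ?_, fun j h6 h7 => h4 j h6 (by omega)⟩
    rcases h5 with h5 | ⟨-, h5⟩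
    · exact h5
    · exact absurd hzm (h5 m hm (by omega))

/-- Stores the sum of the rewards along the cycle in the real variable `2` and its length in the
real variable `3`, and marks its states as done. -/
def cycleSumProg : Prog :=
  .seq (.block [.rzero 2, .rzero 3, .rone 4])
    (.forLoop 17 19 (.block [.nload 18 6 4 17, .rload 0 1 4 18, .radd 2 2 0, .radd 3 3 4,
      .nstore 4 4 18 3]))

theorem runs_cycleSumProg {n k c : ℕ} {f : ℕ → ℕ} {r : ℕ → ℝ} {σ : Mem} {z : ℕ → ℕ}
    (hσ : EvalCtx n k f r σ) (hc : σ.nvar 19 = c) (hz : ∀ j < c, σ.narr 6 0 j = z j)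
    (hzn : ∀ j < c, z j < n) :
    Runs cycleSumProg σ fun t σ' => t ≤ 8 * c + 6 ∧ σ'.rvar 2 = ∑ j ∈ range c, r (z j) ∧
      σ'.rvar 3 = c ∧ ∀ s, σ'.narr 4 0 s = if s ∈ (range c).image z then 1 else σ.narr 4 0 s := by
  refine Runs.seq (Runs.block ?_)
  refine (Runs.forLoop_le (N := c) (B := 6)
    (fun i σ' => σ'.rvar 2 = ∑ j ∈ range i, r (z j) ∧ σ'.rvar 3 = i ∧ σ'.rvar 4 = 1 ∧
      ∀ s, σ'.narr 4 0 s = if s ∈ (range i).image z then 1 else σ.narr 4 0 s)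
    ?_ ?_ (by decide) ?_ ?_).conseq ?_
  · simp [Instr.apply, hσ.one]
  · simp [Instr.apply, hc]
  · simp [Instr.apply]
  · rintro i σ' hi hfr hv ⟨h1, h2, h3, h4⟩
    have e3 : σ'.nvar 3 = 1 := by
      rw [hfr.nvar _ (by decide)]; simp [Instr.apply, hσ.one]
    have e4 : σ'.nvar 4 = 0 := by
      rw [hfr.nvar _ (by decide)]; simp [Instr.apply, hσ.zero]
    have e6 : σ'.narr 6 0 i = z i := by
      rw [hfr.narr _ (by decide)]; simp [Instr.apply, hz i hi]
    have er : σ'.rarr 1 0 (z i) = r (z i) := by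
      rw [hfr.rarr _ (by decide)]; simp [Instr.apply, hσ.rew _ (hzn i hi)]
    refine Runs.block ⟨by simp, ?_, ?_, ?_, fun s => ?_⟩
    · simp [Instr.apply, e4, hv, e6, er, h1, sum_range_succ]
    · simp [Instr.apply, h2, h3]
    · simp [Instr.apply, h3]
    · have h4s := h4 s
      rw [range_add_one, image_insert]
      simp only [mem_insert]
      by_cases hs : s = z i
      · simp [Instr.apply, update3, e4, hv, e6, e3, hs]
      · simp only [Instr.apply, List.foldl_cons, List.foldl_nil, update3]
        simp [e4, hv, e6, hs, h4s]
  · rintro t σ' - ⟨ht, h1, h2, -, h4⟩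
    exact ⟨by simp; omega, h1, h2, h4⟩

/-- One coefficient of the expansions along a cycle, up to an additive constant. -/
def levelWalkProg : Prog :=
  .seq (.block [.nadd 21 20 3, .rload 4 3 4 21, .rzero 5, .rzero 6])
    (.forLoop 23 19 (.block [.nload 18 6 4 23, .nadd 13 23 3, .nload 15 6 4 13, .rstore 2 21 18 5,
      .radd 6 6 5, .rload 0 1 4 18, .rmul 0 0 4, .rsub 5 5 0, .rload 0 2 20 15, .radd 5 5 0]))

/-- The numbers `u j` satisfy the equations for the coefficient of order `i + 1` along the cycle, and
`u 0 = 0`. -/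
theorem runs_levelWalkProg {n k c i : ℕ} {f : ℕ → ℕ} {r : ℕ → ℝ} {σ : Mem} {z : ℕ → ℕ}
    (hσ : EvalCtx n k f r σ) (hc : σ.nvar 19 = c) (hi : σ.nvar 20 = i) (hin : i < n + 4)
    (hz : ∀ j ≤ c, σ.narr 6 0 j = z j) (hzn : ∀ j < c, z j < n)
    (hinj : ∀ j < c, ∀ l < c, z j = z l → j = l) :
    Runs levelWalkProg σ fun t σ' => t ≤ 13 * c + 7 ∧ ∃ u : ℕ → ℝ, u 0 = 0 ∧
      (∀ j, u (j + 1) = u j - r (z j) * deltaTwo (i + 1) + σ.rarr 2 i (z (j + 1))) ∧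
      (∀ l s, (l = i + 1 → ∀ j < c, s ≠ z j) → σ'.rarr 2 l s = σ.rarr 2 l s) ∧
      (∀ j < c, σ'.rarr 2 (i + 1) (z j) = u j) ∧ σ'.rvar 6 = ∑ j ∈ range c, u j ∧
      σ'.nvar 21 = i + 1 := by
  refine Runs.seq (Runs.block ?_)
  set u : ℕ → ℝ := fun j => ∑ l ∈ range j,
    (σ.rarr 2 i (z (l + 1)) - r (z l) * deltaTwo (i + 1)) with hu
  have hus : ∀ j, u (j + 1) = u j - r (z j) * deltaTwo (i + 1) + σ.rarr 2 i (z (j + 1)) := by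
    intro j; simp only [hu, sum_range_succ]; ring
  have hd := hσ.delta (i + 1) (by omega)
  refine (Runs.forLoop_le (N := c) (B := 11)
    (fun m σ' => (∀ l s, (l = i + 1 → ∀ j < m, s ≠ z j) → σ'.rarr 2 l s = σ.rarr 2 l s) ∧
      (∀ j < m, σ'.rarr 2 (i + 1) (z j) = u j) ∧ σ'.rvar 5 = u m ∧
      σ'.rvar 6 = ∑ j ∈ range m, u j ∧ σ'.rvar 4 = deltaTwo (i + 1))
    ?_ ?_ (by decide) ?_ ?_).conseq ?_
  · simp [Instr.apply, hσ.one]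
  · simp [Instr.apply, hc]
  · simp [Instr.apply, hu, hσ.one, hi, hσ.zero, hd]
  · rintro m σ' hm hfr hv ⟨h1, h2, h3, h4, h5⟩
    have e3 : σ'.nvar 3 = 1 := by
      rw [hfr.nvar _ (by decide)]; simp [Instr.apply, hσ.one]
    have e4 : σ'.nvar 4 = 0 := by
      rw [hfr.nvar _ (by decide)]; simp [Instr.apply, hσ.zero]
    have e20 : σ'.nvar 20 = i := by
      rw [hfr.nvar _ (by decide)]; simp [Instr.apply, hi]
    have e21 : σ'.nvar 21 = i + 1 := by
      rw [hfr.nvar _ (by decide)]; simp [Instr.apply, hi, hσ.one]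
    have e6 : ∀ j ≤ c, σ'.narr 6 0 j = z j := by
      intro j hj; rw [hfr.narr _ (by decide)]; simp [Instr.apply, hz j hj]
    have er : σ'.rarr 1 0 (z m) = r (z m) := by
      rw [hfr.rarr _ (by decide)]; simp [Instr.apply, hσ.rew _ (hzn m hm)]
    have ew : σ'.rarr 2 i (z (m + 1)) = σ.rarr 2 i (z (m + 1)) := h1 _ _ (by omega)
    refine Runs.block ⟨by simp, fun l s hls => ?_, fun j hj => ?_, ?_, ?_, ?_⟩
    · have h1' := h1 l s fun hl j hj => hls hl j (by omega)
      have : ¬ (l = i + 1 ∧ s = z m) := fun h => hls h.1 m (by omega) h.2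
      simp [Instr.apply, update3, e4, hv, e6 m hm.le, e21, this, h1']
    · rcases Nat.lt_succ_iff_lt_or_eq.1 hj with hlt | rfl
      · have : z j ≠ z m := fun h => hlt.ne (hinj j (by omega) m hm h)
        simp [Instr.apply, update3, e4, hv, e6 m hm.le, e21, this, h2 j hlt]
      · simp [Instr.apply, update3, e4, hv, e6 j hm.le, e21, h3]
    · simp [Instr.apply, update3, e3, e4, hv, e6 m hm.le, e6 (m + 1) hm, e20, e21, h3, er, h5, ew,
        hus]
    · simp [Instr.apply, h3, h4, sum_range_succ]
    · simp [Instr.apply, h5]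
  · rintro t σ' hfr ⟨ht, h1, h2, -, h4, -⟩
    refine ⟨by simp; omega, u, by simp [hu], hus, h1, h2, h4, ?_⟩
    rw [hfr.nvar _ (by decide)]
    simp [Instr.apply, hi, hσ.one]

/-- The normalization of a coefficient along a cycle, which makes the next coefficient exist. -/
def levelShiftProg : Prog :=
  .seq (.block [.nadd 22 21 3, .rload 0 3 4 22, .rmul 0 0 2, .rsub 0 0 6, .rdiv 0 0 3])
    (.forLoop 23 19 (.block [.nload 18 6 4 23, .rload 1 2 21 18, .radd 1 1 0, .rstore 2 21 18 1]))

theorem runs_levelShiftProg {n k c i : ℕ} {σ : Mem} {z : ℕ → ℕ} (hσ : Ctx n k σ)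
    (hc : σ.nvar 19 = c) (hi : σ.nvar 21 = i + 1) (hin : i < n + 4)
    (hz : ∀ j < c, σ.narr 6 0 j = z j) (hinj : ∀ j < c, ∀ l < c, z j = z l → j = l) :
    Runs levelShiftProg σ fun t σ' => t ≤ 7 * c + 8 ∧
      (∀ l s, (l = i + 1 → ∀ j < c, s ≠ z j) → σ'.rarr 2 l s = σ.rarr 2 l s) ∧
      ∀ j < c, σ'.rarr 2 (i + 1) (z j) = σ.rarr 2 (i + 1) (z j) +
        (deltaTwo (i + 2) * σ.rvar 2 - σ.rvar 6) / σ.rvar 3 := by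
  refine Runs.seq (Runs.block ?_)
  have hd := hσ.delta (i + 2) (by omega)
  set κ := (deltaTwo (i + 2) * σ.rvar 2 - σ.rvar 6) / σ.rvar 3 with hκ
  refine (Runs.forLoop_le (N := c) (B := 5)
    (fun m σ' => (∀ l s, (l = i + 1 → ∀ j < m, s ≠ z j) → σ'.rarr 2 l s = σ.rarr 2 l s) ∧
      (∀ j < m, σ'.rarr 2 (i + 1) (z j) = σ.rarr 2 (i + 1) (z j) + κ) ∧ σ'.rvar 0 = κ)
    ?_ ?_ (by decide) ?_ ?_).conseq ?_
  · simp [Instr.apply, hσ.one]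
  · simp [Instr.apply, hc]
  · simp [Instr.apply, hσ.one, hi, hσ.zero, hd, hκ]
  · rintro m σ' hm hfr hv ⟨h1, h2, h3⟩
    have e4 : σ'.nvar 4 = 0 := by
      rw [hfr.nvar _ (by decide)]; simp [Instr.apply, hσ.zero]
    have e21 : σ'.nvar 21 = i + 1 := by
      rw [hfr.nvar _ (by decide)]; simp [Instr.apply, hi]
    have e6 : σ'.narr 6 0 m = z m := by
      rw [hfr.narr _ (by decide)]; simp [Instr.apply, hz m hm]
    refine Runs.block ⟨by simp, fun l s hls => ?_, fun j hj => ?_, ?_⟩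
    · have h1' := h1 l s fun hl j hj => hls hl j (by omega)
      have : ¬ (l = i + 1 ∧ s = z m) := fun h => hls h.1 m (by omega) h.2
      simp [Instr.apply, update3, e4, hv, e6, e21, this, h1']
    · rcases Nat.lt_succ_iff_lt_or_eq.1 hj with hlt | rfl
      · have : z j ≠ z m := fun h => hlt.ne (hinj j (by omega) m hm h)
        simp [Instr.apply, update3, e4, hv, e6, e21, this, h2 j hlt]
      · have h1' := h1 (i + 1) (z j) fun _ l hl h => hl.ne (hinj j hm l (by omega) h).symm
        simp [Instr.apply, update3, e4, hv, e6, e21, h3, h1']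
    · simp [Instr.apply, h3]
  · rintro t σ' - ⟨ht, h1, h2, -⟩
    exact ⟨by simp; omega, h1, h2⟩

end BlackwellDMDP

namespace BlackwellDMDP

open Function Finset

/-! ### Evaluating a policy: all states -/

/-- The expansions at the states in `D` have been computed. -/
structure EvalInv (n : ℕ) (f : ℕ → ℕ) (r : ℕ → ℝ) (D : Finset ℕ) (σ : Mem) : Prop where
  lt : ∀ s ∈ D, s < n
  closed : ∀ s ∈ D, f s ∈ D
  done : ∀ s < n, σ.narr 4 0 s = if s ∈ D then 1 else 0
  zero : ∀ s < n, σ.rarr 2 0 s = 0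
  step : ∀ s ∈ D, ∀ i < n + 4, σ.rarr 2 (i + 1) s =
    deltaTwo (i + 1) * r s + σ.rarr 2 (i + 1) (f s) - σ.rarr 2 i (f s)

theorem EvalInv.frame {n : ℕ} {f : ℕ → ℕ} {r : ℕ → ℝ} {D : Finset ℕ} {σ σ' : Mem} {P : Prog}
    (h : EvalInv n f r D σ) (hf : Frame P σ σ')
    (hP : 4 ∉ P.collect Instr.narrs ∧ 2 ∉ P.collect Instr.rarrs) : EvalInv n f r D σ' := by
  refine ⟨h.lt, h.closed, ?_, ?_, ?_⟩
  · rw [hf.narr _ hP.1]; exact h.done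
  · rw [hf.rarr _ hP.2]; exact h.zero
  · rw [hf.rarr _ hP.2]; exact h.step

theorem EvalInv.iterate_mem {n : ℕ} {f : ℕ → ℕ} {r : ℕ → ℝ} {D : Finset ℕ} {σ : Mem}
    (h : EvalInv n f r D σ) {s : ℕ} (hs : s ∈ D) (j : ℕ) : f^[j] s ∈ D := by
  induction j with
  | zero => exact hs
  | succ j ih => rw [iterate_succ_apply']; exact h.closed _ ih

theorem iterate_injOn_of_minimal {f : ℕ → ℕ} {x c : ℕ} (hc : f^[c] x = x)
    (hmin : ∀ j < c, 0 < j → f^[j] x ≠ x) :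
    ∀ j < c, ∀ l < c, f^[j] x = f^[l] x → j = l := by
  have key : ∀ j l, j < l → l < c → f^[j] x ≠ f^[l] x := by
    intro j l hjl hl he
    refine hmin (c - l + j) (by omega) (by omega) ?_
    rw [iterate_add_apply, he, ← iterate_add_apply, Nat.sub_add_cancel hl.le, hc]
  intro j hj l hl he
  by_contra hne
  rcases lt_or_gt_of_ne hne with h | h
  · exact key j l h hl he
  · exact key l j h hj he.symm

/-- Computes the expansions along the cycle through the state in variable `11`. -/
def cycleProg : Prog :=
  .seq (walkProg 6) (.seq periodProg (.seq cycleSumProg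
    (.forLoop 20 6 (.seq levelWalkProg levelShiftProg))))

/-- The state of the computation of the expansions along the cycle `z 0, …, z c = z 0` after `m`
coefficients, where `W` are the expansions computed before. -/
structure LevelInv (n c : ℕ) (r : ℕ → ℝ) (z : ℕ → ℕ) (W : ℕ → ℕ → ℝ) (m : ℕ) (σ : Mem) :
    Prop where
  old : ∀ l s, (l = 0 ∨ ∀ j < c, s ≠ z j) → σ.rarr 2 l s = W l s
  step : ∀ i < m, ∀ j < c, σ.rarr 2 (i + 1) (z j) = deltaTwo (i + 1) * r (z j) +
    σ.rarr 2 (i + 1) (z (j + 1)) - σ.rarr 2 i (z (j + 1))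
  sum : ∀ i ≤ m, ∑ j ∈ range c, σ.rarr 2 i (z j) = deltaTwo (i + 1) * ∑ j ∈ range c, r (z j)
  rsum : σ.rvar 2 = ∑ j ∈ range c, r (z j)
  len : σ.rvar 3 = c

theorem runs_level {n k c i : ℕ} {f : ℕ → ℕ} {r : ℕ → ℝ} {σ : Mem} {z : ℕ → ℕ} {W : ℕ → ℕ → ℝ}
    (hσ : EvalCtx n k f r σ) (hc : σ.nvar 19 = c) (hi : σ.nvar 20 = i) (hin : i < n + 4)
    (hz : ∀ j ≤ c, σ.narr 6 0 j = z j) (hzn : ∀ j < c, z j < n)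
    (hinj : ∀ j < c, ∀ l < c, z j = z l → j = l) (hc0 : 0 < c) (hcyc : z c = z 0)
    (hI : LevelInv n c r z W i σ) :
    Runs (.seq levelWalkProg levelShiftProg) σ fun t σ' => t ≤ 20 * c + 15 ∧
      LevelInv n c r z W (i + 1) σ' := by
  refine Runs.seq ((runs_levelWalkProg hσ hc hi hin hz hzn hinj).conseq ?_)
  rintro t σ1 hf1 ⟨ht, u, hu0, hus, hold1, hnew1, hsum1, h21⟩
  refine (runs_levelShiftProg (hσ.toCtx.frame hf1 (by decide))
    ((hf1.nvar _ (by decide)).trans hc) h21 hin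
    (fun j hj => (congrFun₂ (hf1.narr 6 (by decide)) 0 j).trans (hz j hj.le)) hinj).conseq ?_
  rintro t' σ2 hf2 ⟨ht', hold2, hnew2⟩
  have e2 : σ1.rvar 2 = σ.rvar 2 := hf1.rvar _ (by decide)
  have e3 : σ1.rvar 3 = σ.rvar 3 := hf1.rvar _ (by decide)
  set κ := (deltaTwo (i + 2) * σ1.rvar 2 - σ1.rvar 6) / σ1.rvar 3 with hκ
  have hold : ∀ l s, (l = i + 1 → ∀ j < c, s ≠ z j) → σ2.rarr 2 l s = σ.rarr 2 l s :=
    fun l s h => (hold2 l s h).trans (hold1 l s h)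
  -- the normalization of the previous coefficient closes the cycle
  have huc : u c = 0 := by
    have e : ∀ m, u m = ∑ j ∈ range m, σ.rarr 2 i (z (j + 1)) -
        deltaTwo (i + 1) * ∑ j ∈ range m, r (z j) := by
      intro m
      induction m with
      | zero => simp [hu0]
      | succ m ih => rw [hus, ih, sum_range_succ, sum_range_succ]; ring
    have e' := sum_range_succ' (fun j => σ.rarr 2 i (z j)) c
    rw [sum_range_succ, hcyc, add_left_inj] at e'
    rw [e, ← e', hI.sum i le_rfl, sub_self]
  have hnew : ∀ j ≤ c, σ2.rarr 2 (i + 1) (z j) = u j + κ := by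
    intro j hj
    rcases hj.lt_or_eq with hlt | rfl
    · rw [hnew2 j hlt, hnew1 j hlt]
    · rw [hcyc, hnew2 0 hc0, hnew1 0 hc0, hu0, huc]
  have hlow : ∀ l s, l ≤ i → σ2.rarr 2 l s = σ.rarr 2 l s := fun l s hl =>
    hold l s fun h => by omega
  refine ⟨by omega, ⟨fun l s hls => ?_, fun l hl j hj => ?_, fun l hl => ?_, ?_, ?_⟩⟩
  · rw [hold l s fun h => hls.resolve_left (by omega), hI.old l s hls]
  · rcases Nat.lt_succ_iff_lt_or_eq.1 hl with hlt | rfl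
    · rw [hlow _ _ hlt, hlow _ _ hlt, hlow _ _ (by omega), hI.step l hlt j hj]
    · rw [hnew j hj.le, hnew (j + 1) hj, hlow _ _ le_rfl, hus]
      ring
  · rcases Nat.le_succ_iff.1 hl with hle | rfl
    · rw [sum_congr rfl fun j _ => hlow l (z j) hle, hI.sum l hle]
    · rw [sum_congr rfl fun j hj => hnew j (mem_range.1 hj).le, sum_add_distrib, sum_const,
        card_range, nsmul_eq_mul, ← hsum1, hκ, e2, e3, hI.len, hI.rsum,
        mul_div_cancel₀ _ (by exact_mod_cast hc0.ne')]
      ring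
  · rw [hf2.rvar _ (by decide), e2, hI.rsum]
  · rw [hf2.rvar _ (by decide), e3, hI.len]

/-- The running time is charged to the states of the cycle, which are new in `D'`. -/
theorem runs_cycleProg {n k : ℕ} {f : ℕ → ℕ} {r : ℕ → ℝ} {σ : Mem} {x : ℕ} {D : Finset ℕ}
    (hσ : EvalCtx n k f r σ) (hf : ∀ s < n, f s < n) (hx : x < n) (hx' : σ.nvar 11 = x)
    (hD : EvalInv n f r D σ) (hxD : x ∉ D) (hper : ∃ m ≤ n, 0 < m ∧ f^[m] x = x) :
    Runs cycleProg σ fun t σ' => ∃ D', D ⊆ D' ∧ x ∈ D' ∧ EvalInv n f r D' σ' ∧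
      t + 225 * n * D.card ≤ 225 * n * D'.card := by
  refine Runs.seq ((runs_walkProg hσ hf (by decide) hx hx').conseq ?_)
  rintro t1 σ1 hf1 ⟨ht1, hz1, -⟩
  have hσ1 := hσ.frame hf1 (by decide)
  have hD1 := hD.frame hf1 (by decide)
  have hx1 := (hf1.nvar _ (by decide)).trans hx'
  refine Runs.seq ((runs_periodProg (z := fun j => f^[j] x) hσ1.toCtx hx1 hz1 hper).conseq ?_)
  rintro t2 σ2 hf2 ⟨ht2, hc0, hcn, hcyc, hmin⟩
  obtain ⟨c, hc⟩ : ∃ c, c = σ2.nvar 19 := ⟨_, rfl⟩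
  rw [← hc] at hc0 hcn hcyc hmin
  set z : ℕ → ℕ := fun j => f^[j] x with hz
  have hσ2 := hσ1.frame hf2 (by decide)
  have hD2 := hD1.frame hf2 (by decide)
  have hz2 : ∀ j ≤ c, σ2.narr 6 0 j = z j := fun j hj => by
    rw [hf2.narr _ (by decide)]; exact hz1 j (hj.trans hcn)
  have hzn : ∀ j < c, z j < n := fun j _ => iterate_lt hf hx j
  have hinj : ∀ j < c, ∀ l < c, z j = z l → j = l := iterate_injOn_of_minimal hcyc hmin
  refine Runs.seq ((runs_cycleSumProg hσ2 hc.symm (fun j hj => hz2 j hj.le) hzn).conseq ?_)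
  rintro t3 σ3 hf3 ⟨ht3, hrs, hlen, hdone⟩
  have hσ3 := hσ2.frame hf3 (by decide)
  have hW3 : σ3.rarr 2 = σ2.rarr 2 := hf3.rarr _ (by decide)
  refine (Runs.forLoop_le (N := n + 4) (B := 20 * c + 15) (fun m σ' => LevelInv n c r z
    (σ2.rarr 2) m σ') hσ3.one hσ3.hL (by decide) ?_ ?_).conseq ?_
  · refine ⟨fun l s _ => by rw [← hW3], fun i hi => absurd hi (Nat.not_lt_zero i),
      fun i hi => ?_, hrs, hlen⟩
    rw [Nat.le_zero.1 hi]
    refine (sum_eq_zero fun j hj => ?_).trans (by simp [deltaTwo])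
    change σ3.rarr 2 0 (z j) = 0
    rw [hW3]
    exact hD2.zero _ (hzn j (mem_range.1 hj))
  · intro m σ' hm hfr hv hI
    have hI' : LevelInv n c r z (σ2.rarr 2) m σ' := ⟨hI.old, hI.step, hI.sum, hI.rsum, hI.len⟩
    refine (runs_level (hσ3.frame hfr (by decide)) ?_ hv hm (fun j hj => ?_) hzn hinj hc0 hcyc
      hI').conseq fun t σ'' _ h => ⟨h.1, h.2.old, h.2.step, h.2.sum, h.2.rsum, h.2.len⟩
    · rw [hfr.nvar _ (by decide), hf3.nvar _ (by decide), ← hc]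
    · rw [hfr.narr _ (by decide), hf3.narr _ (by decide), hz2 j hj]
  · rintro t4 σ4 hf4 ⟨ht4, hI⟩
    have hCD : Disjoint D ((range c).image z) := by
      rw [disjoint_left]
      intro s hs hsC
      obtain ⟨j, hj, rfl⟩ := mem_image.1 hsC
      have := hD.iterate_mem hs (c - j)
      rw [hz, ← iterate_add_apply, Nat.sub_add_cancel (mem_range.1 hj).le] at this
      exact hxD (hcyc ▸ this)
    have hcard : ((range c).image z).card = c := by
      rw [card_image_of_injOn, card_range]
      intro j hj l hl h
      exact hinj j (mem_range.1 hj) l (mem_range.1 hl) h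
    have hnotC : ∀ s ∈ D, ∀ j < c, s ≠ z j := fun s hs j hj h =>
      disjoint_left.1 hCD hs (mem_image.2 ⟨j, mem_range.2 hj, h.symm⟩)
    have hzC : ∀ j < c, z (j + 1) ∈ (range c).image z := by
      intro j hj
      rcases Nat.lt_or_ge (j + 1) c with h | h
      · exact mem_image.2 ⟨j + 1, mem_range.2 h, rfl⟩
      · refine mem_image.2 ⟨0, mem_range.2 hc0, ?_⟩
        rw [show j + 1 = c by omega]
        exact hcyc.symm
    have hfz : ∀ j, f (z j) = z (j + 1) := fun j => (iterate_succ_apply' f j x).symm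
    refine ⟨D ∪ (range c).image z, subset_union_left,
      mem_union_right _ (mem_image.2 ⟨0, mem_range.2 hc0, rfl⟩), ⟨?_, ?_, ?_, ?_, ?_⟩, ?_⟩
    · intro s hs
      rcases mem_union.1 hs with h | h
      · exact hD.lt s h
      · obtain ⟨j, hj, rfl⟩ := mem_image.1 h
        exact hzn j (mem_range.1 hj)
    · intro s hs
      rcases mem_union.1 hs with h | h
      · exact mem_union_left _ (hD.closed s h)
      · obtain ⟨j, hj, rfl⟩ := mem_image.1 h
        rw [hfz]
        exact mem_union_right _ (hzC j (mem_range.1 hj))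
    · intro s hs
      rw [hf4.narr _ (by decide), hdone, hD2.done s hs]
      simp only [mem_union]
      by_cases h1 : s ∈ D <;> by_cases h2 : s ∈ (range c).image z <;> simp [h1, h2]
    · intro s hs
      rw [hI.old 0 s (Or.inl rfl), hD2.zero s hs]
    · intro s hs i hi
      rcases mem_union.1 hs with h | h
      · rw [hI.old _ s (Or.inr (hnotC s h)), hI.old _ (f s) (Or.inr (hnotC _ (hD.closed s h))),
          hI.old _ (f s) (Or.inr (hnotC _ (hD.closed s h))), hD2.step s h i hi]
      · obtain ⟨j, hj, rfl⟩ := mem_image.1 h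
        rw [hfz]
        exact hI.step i hi j (mem_range.1 hj)
    · rw [card_union_of_disjoint hCD, hcard]
      have hn1 : 1 ≤ n := by omega
      have h1 : n ≤ n * c := Nat.le_mul_of_pos_right n hc0
      have h2 : c ≤ n * c := Nat.le_mul_of_pos_left c hn1
      have h3 : (n + 4) * (20 * c + 15 + 2) = 20 * (n * c) + 17 * n + 80 * c + 68 := by ring
      have h4 : 225 * n * (D.card + c) = 225 * n * D.card + 225 * (n * c) := by ring
      omega

/-- Computes the expansion at the state in variable `10`: the walk from this state ends on a cycle,
which is treated first, and the states of the walk are then treated backwards. -/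
def stateProg : Prog :=
  .seq (.block [.nadd 11 10 4]) (.seq (walkProg 5) (.seq (.block [.nadd 11 18 4, .nload 14 4 4 11])
    (.seq (.ite (.nlt 14 3) cycleProg .skip)
      (.forLoop 12 0 (.seq (.block [.nsub 13 0 12, .nload 15 5 4 13, .nsub 13 13 3,
        .nload 11 5 4 13, .nload 14 4 4 11]) (.ite (.nlt 14 3) treeProg .skip))))))

/-- A walk of `n` steps among `n` states ends on a cycle. -/
theorem exists_iterate_eq_self {n : ℕ} {f : ℕ → ℕ} (hf : ∀ s < n, f s < n) {s : ℕ} (hs : s < n) :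
    ∃ m ≤ n, 0 < m ∧ f^[m] (f^[n] s) = f^[n] s := by
  obtain ⟨i, hi, j, hj, hne, he⟩ := exists_ne_map_eq_of_card_lt_of_maps_to
    (s := range (n + 1)) (t := range n) (f := fun t => f^[t] s)
    (by simp) (fun t _ => by simpa using iterate_lt hf hs t)
  have key : ∀ i j, i < j → j < n + 1 → f^[i] s = f^[j] s →
      ∃ m ≤ n, 0 < m ∧ f^[m] (f^[n] s) = f^[n] s := by
    intro i j hij hj he
    refine ⟨j - i, by omega, by omega, ?_⟩
    rw [← iterate_add_apply, show j - i + n = n - i + j by omega, iterate_add_apply, ← he,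
      ← iterate_add_apply, Nat.sub_add_cancel (by omega)]
  rw [mem_range] at hi hj
  rcases lt_or_gt_of_ne hne with h | h
  · exact key i j h hj he
  · exact key j i h hi he.symm

theorem EvalInv.insert_of_tree {n : ℕ} {f : ℕ → ℕ} {r : ℕ → ℝ} {D : Finset ℕ} {σ σ' : Mem} {x : ℕ}
    (hD : EvalInv n f r D σ) (hx : x < n) (hxD : x ∉ D) (hfx : f x ∈ D)
    (h4 : ∀ s, σ'.narr 4 0 s = if s = x then 1 else σ.narr 4 0 s)
    (hold : ∀ i, ∀ s ≠ x, σ'.rarr 2 i s = σ.rarr 2 i s) (h0 : σ'.rarr 2 0 x = σ.rarr 2 0 x)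
    (hnew : ∀ i < n + 4, σ'.rarr 2 (i + 1) x =
        deltaTwo (i + 1) * r x + σ.rarr 2 (i + 1) (f x) - σ.rarr 2 i (f x)) :
    EvalInv n f r (insert x D) σ' := by
  have hne : ∀ s ∈ D, s ≠ x := fun s hs h => hxD (h ▸ hs)
  refine ⟨fun s hs => ?_, fun s hs => ?_, fun s hs => ?_, fun s hs => ?_, fun s hs i hi => ?_⟩
  · rcases mem_insert.1 hs with rfl | h
    · exact hx
    · exact hD.lt s h
  · rcases mem_insert.1 hs with rfl | h
    · exact mem_insert_of_mem hfx
    · exact mem_insert_of_mem (hD.closed s h)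
  · rw [h4, hD.done s hs]
    simp only [mem_insert]
    by_cases h1 : s = x <;> by_cases h2 : s ∈ D <;> simp [h1, h2]
  · by_cases h1 : s = x
    · rw [h1, h0, hD.zero x hx]
    · rw [hold 0 s h1, hD.zero s hs]
  · rcases mem_insert.1 hs with rfl | h
    · rw [hnew i hi, hold _ _ (hne _ hfx), hold _ _ (hne _ hfx)]
    · rw [hold _ s (hne s h), hold _ _ (hne _ (hD.closed s h)),
        hold _ _ (hne _ (hD.closed s h)), hD.step s h i hi]

/-- Apart from `O(n)` steps, the running time is charged to the states that are new in `D'`. -/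
theorem runs_stateProg {n k : ℕ} {f : ℕ → ℕ} {r : ℕ → ℝ} {σ : Mem} {s : ℕ} {D : Finset ℕ}
    (hσ : EvalCtx n k f r σ) (hf : ∀ s < n, f s < n) (hs : s < n) (hs' : σ.nvar 10 = s)
    (hD : EvalInv n f r D σ) :
    Runs stateProg σ fun t σ' => ∃ D', s ∈ D' ∧ D ⊆ D' ∧ EvalInv n f r D' σ' ∧
      t + 225 * n * D.card ≤ 30 * n + 225 * n * D'.card := by
  refine Runs.seq (Runs.block ?_)
  obtain ⟨σ0, hσ0⟩ : ∃ σ0, σ0 = List.foldl Instr.apply σ [.nadd 11 10 4] := ⟨_, rfl⟩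
  have hf0 : Frame (.block [.nadd 11 10 4]) σ σ0 := by rw [hσ0]; exact Frame.block _ _
  rw [← hσ0]
  have hctx0 := hσ.frame hf0 (by decide)
  have hD0 := hD.frame hf0 (by decide)
  have h11 : σ0.nvar 11 = s := by rw [hσ0]; simp [Instr.apply, hs', hσ.zero]
  refine Runs.seq ((runs_walkProg hctx0 hf (by decide) hs h11).conseq ?_)
  rintro t1 σ1 hf1 ⟨ht1, hpath, h18⟩
  have hctx1 := hctx0.frame hf1 (by decide)
  have hD1 := hD0.frame hf1 (by decide)
  have hwn : f^[n] s < n := iterate_lt hf hs n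
  refine Runs.seq (Runs.block ?_)
  obtain ⟨σ2, hσ2⟩ : ∃ σ2, σ2 = List.foldl Instr.apply σ1 [.nadd 11 18 4, .nload 14 4 4 11] :=
    ⟨_, rfl⟩
  have hf2 : Frame (.block [.nadd 11 18 4, .nload 14 4 4 11]) σ1 σ2 := by
    rw [hσ2]
    exact Frame.block _ _
  rw [← hσ2]
  have hctx2 := hctx1.frame hf2 (by decide)
  have hD2 := hD1.frame hf2 (by decide)
  have h11' : σ2.nvar 11 = f^[n] s := by rw [hσ2]; simp [Instr.apply, h18, hctx1.zero]
  have h14 : σ2.nvar 14 = if f^[n] s ∈ D then 1 else 0 := by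
    rw [hσ2, ← hD1.done _ hwn]; simp [Instr.apply, h18, hctx1.zero]
  have hpath2 : ∀ j ≤ n, σ2.narr 5 0 j = f^[j] s := fun j hj => by
    rw [hf2.narr _ (by decide), hpath j hj]
  have hcyc : Runs (.ite (.nlt 14 3) cycleProg .skip) σ2 fun t σ' => ∃ D', D ⊆ D' ∧
      f^[n] s ∈ D' ∧ EvalInv n f r D' σ' ∧ t + 225 * n * D.card ≤ 2 + 225 * n * D'.card := by
    refine Runs.ite (fun hlt => ?_) fun hge => Runs.skip ?_
    · rw [Test.Holds, h14, hctx2.one] at hlt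
      have hnD : f^[n] s ∉ D := fun h => by rw [if_pos h] at hlt; exact lt_irrefl _ hlt
      refine (runs_cycleProg hctx2 hf hwn h11' hD2 hnD
        (exists_iterate_eq_self hf hs)).conseq ?_
      rintro t σ' - ⟨D', h1, h2, h3, h4⟩
      exact ⟨D', h1, h2, h3, by omega⟩
    · rw [Test.Holds, h14, hctx2.one] at hge
      have hD' : f^[n] s ∈ D := by
        by_contra h
        rw [if_neg h] at hge
        exact hge one_pos
      exact ⟨D, Subset.refl D, hD', hD2, by omega⟩
  refine Runs.seq (hcyc.conseq ?_)
  rintro t3 σ3 hf3 ⟨D3, hD3s, hwD3, hD3, ht3⟩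
  have hctx3 := hctx2.frame hf3 (by decide)
  have hpath3 : ∀ j ≤ n, σ3.narr 5 0 j = f^[j] s := fun j hj => by
    rw [hf3.narr _ (by decide), hpath2 j hj]
  refine (Runs.forLoop (N := n) (fun i T σ' => ∃ D', D3 ⊆ D' ∧
    (∀ j ≤ n, n - i ≤ j → f^[j] s ∈ D') ∧ EvalInv n f r D' σ' ∧
    T + 225 * n * D3.card ≤ 8 * i + 225 * n * D'.card) hctx3.one hctx3.hn (by decide) ?_ ?_).conseq
    ?_
  · refine ⟨D3, Subset.refl _, fun j h1 h2 => ?_, ⟨hD3.lt, hD3.closed, hD3.done, hD3.zero,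
      hD3.step⟩, by omega⟩
    rw [show j = n by omega]
    exact hwD3
  · rintro i T σ' hi hfr hv ⟨D', hsub, hmem, hinv, hT⟩
    have hctx := hctx3.frame hfr (by decide)
    have hp : ∀ j ≤ n, σ'.narr 5 0 j = f^[j] s := fun j hj => by
      rw [hfr.narr _ (by decide), hpath3 j hj]
    refine Runs.seq (Runs.block ?_)
    have hxn : f^[n - (i + 1)] s < n := iterate_lt hf hs _
    have hsucc : f (f^[n - (i + 1)] s) = f^[n - i] s := by
      rw [← iterate_succ_apply' f, show (n - (i + 1)).succ = n - i by omega]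
    obtain ⟨σ4, hσ4⟩ : ∃ σ4, σ4 = List.foldl Instr.apply σ' [.nsub 13 0 12, .nload 15 5 4 13,
      .nsub 13 13 3, .nload 11 5 4 13, .nload 14 4 4 11] := ⟨_, rfl⟩
    rw [← hσ4]
    have e13 : n - i - 1 = n - (i + 1) := by omega
    have g15 : σ4.nvar 15 = f^[n - i] s := by
      rw [hσ4]; simp [Instr.apply, hctx.hn, hctx.zero, hv, hp]
    have g11 : σ4.nvar 11 = f^[n - (i + 1)] s := by
      rw [hσ4]; simp [Instr.apply, hctx.hn, hctx.zero, hctx.one, hv, hp, e13]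
    have g14 : σ4.nvar 14 = if f^[n - (i + 1)] s ∈ D' then 1 else 0 := by
      rw [hσ4, ← hinv.done _ hxn]
      simp [Instr.apply, hctx.hn, hctx.zero, hctx.one, hv, hp, e13]
    have gctx : EvalCtx n k f r σ4 := by
      refine ⟨⟨?_, ?_, ?_, ?_, ?_, ?_, ?_⟩, ?_, ?_⟩ <;> rw [hσ4] <;> simp [Instr.apply]
      exacts [hctx.hn, hctx.hk, hctx.one, hctx.zero, hctx.hK, hctx.hL, hctx.delta, hctx.succ,
        hctx.rew]
    have ginv : EvalInv n f r D' σ4 := by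
      rw [hσ4]
      exact ⟨hinv.lt, hinv.closed, hinv.done, hinv.zero, hinv.step⟩
    have hall : ∀ D'', D' ⊆ D'' → f^[n - (i + 1)] s ∈ D'' →
        ∀ j ≤ n, n - (i + 1) ≤ j → f^[j] s ∈ D'' := by
      intro D'' h1 h2 j h3 h4
      rcases eq_or_lt_of_le h4 with h | h
      · exact h ▸ h2
      · exact h1 (hmem j h3 (by omega))
    refine Runs.ite (fun hlt => ?_) fun hge => Runs.skip ?_
    · rw [Test.Holds, g14, gctx.one] at hlt
      have hnD : f^[n - (i + 1)] s ∉ D' := fun h => by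
        rw [if_pos h] at hlt; exact lt_irrefl _ hlt
      have hyD : f^[n - i] s ∈ D' := hmem _ (by omega) le_rfl
      refine (runs_treeProg gctx hxn (fun h => hnD (h ▸ hyD)) g11 g15).conseq ?_
      rintro t σ5 - ⟨ht, h1, h2, h3, h4⟩
      have hins := ginv.insert_of_tree hxn hnD (hsucc ▸ hyD) h1 h2 h3 (hsucc ▸ h4)
      refine ⟨_, hsub.trans (subset_insert _ _), hall _ (subset_insert _ _) (mem_insert_self _ _),
        ⟨hins.lt, hins.closed, hins.done, hins.zero, hins.step⟩, ?_⟩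
      have e : 225 * n * (D'.card + 1) = 225 * n * D'.card + 225 * n := by ring
      rw [card_insert_of_notMem hnD, e]
      simp only [List.length_cons, List.length_nil]
      omega
    · rw [Test.Holds, g14, gctx.one] at hge
      have hD' : f^[n - (i + 1)] s ∈ D' := by
        by_contra h
        rw [if_neg h] at hge
        exact hge one_pos
      refine ⟨D', hsub, hall _ (Subset.refl _) hD',
        ⟨ginv.lt, ginv.closed, ginv.done, ginv.zero, ginv.step⟩, ?_⟩
      simp only [List.length_cons, List.length_nil]
      omega
  · rintro t4 σ' - ⟨T, rfl, D', h1, h2, h3, h4⟩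
    refine ⟨D', h2 0 (Nat.zero_le _) (by omega), hD3s.trans h1, h3, ?_⟩
    simp only [List.length_cons, List.length_nil]
    omega

/-- Computes the expansions of the values of all states. -/
def evalProg : Prog := .forLoop 10 0 stateProg

theorem runs_evalProg {n k : ℕ} {f : ℕ → ℕ} {r : ℕ → ℝ} {σ : Mem} (hn : 0 < n)
    (hσ : EvalCtx n k f r σ) (hf : ∀ s < n, f s < n) (hD : EvalInv n f r ∅ σ) :
    Runs evalProg σ fun t σ' => t ≤ 259 * n ^ 2 ∧ (∀ s < n, σ'.rarr 2 0 s = 0) ∧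
      ∀ i < n + 4, ∀ s < n, σ'.rarr 2 (i + 1) s =
        deltaTwo (i + 1) * r s + σ'.rarr 2 (i + 1) (f s) - σ'.rarr 2 i (f s) := by
  refine (Runs.forLoop (N := n) (fun i T σ' => ∃ D, (∀ s < i, s ∈ D) ∧ EvalInv n f r D σ' ∧
    T ≤ 30 * n * i + 225 * n * D.card) hσ.one hσ.hn (by decide) ?_ ?_).conseq ?_
  · exact ⟨∅, fun s hs => absurd hs (Nat.not_lt_zero s), ⟨hD.lt, hD.closed, hD.done, hD.zero,
      hD.step⟩, by omega⟩
  · rintro i T σ' hi hfr hv ⟨D, h1, h2, h3⟩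
    refine (runs_stateProg (hσ.frame hfr (by decide)) hf hi hv h2).conseq ?_
    rintro t σ'' - ⟨D', h4, h5, h6, h7⟩
    refine ⟨D', fun s hs => ?_, ⟨h6.lt, h6.closed, h6.done, h6.zero, h6.step⟩, ?_⟩
    · rcases Nat.lt_succ_iff_lt_or_eq.1 hs with h | rfl
      · exact h5 (h1 s h)
      · exact h4
    · rw [Nat.mul_add, Nat.mul_one]
      omega
  · rintro t σ' - ⟨T, rfl, D, h1, h2, h3⟩
    have hcard : D.card ≤ n := by
      have := card_le_card (s := D) (t := range n) fun s hs => mem_range.2 (h2.lt s hs)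
      rwa [card_range] at this
    refine ⟨?_, h2.zero, fun i hi s hs => h2.step s (h1 s hs) i hi⟩
    have h4 := Nat.mul_le_mul_left (225 * n) hcard
    have h5 : n ≤ n * n := Nat.le_mul_of_pos_left n hn
    have h6 : 30 * n * n = 30 * (n * n) := by ring
    have h7 : 225 * n * n = 225 * (n * n) := by ring
    rw [pow_two]
    omega

end BlackwellDMDP

namespace BlackwellDMDP

open Function

/-! ### Selecting a pair of maximal gain -/

/-- Loads successors and rewards under the current policy, which is row `N` of array `2`, with `N`
in variable `2`; marks all states as not done and sets the coefficients of order zero. -/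
def prepareProg : Prog :=
  .forLoop 10 0 (.block [.nload 13 2 2 10, .nload 15 0 10 13, .nstore 3 4 10 15, .rload 0 0 10 13,
    .rstore 1 4 10 0, .nstore 4 4 10 4, .rzero 0, .rstore 2 4 10 0])

theorem runs_prepareProg {n k N : ℕ} {σ : Mem} (hσ : Ctx n k σ) (hN : σ.nvar 2 = N) :
    Runs prepareProg σ fun t σ' => t ≤ 11 * n + 2 ∧
      EvalCtx n k (fun s => σ.narr 0 s (σ.narr 2 N s)) (fun s => σ.rarr 0 s (σ.narr 2 N s)) σ' ∧
      EvalInv n (fun s => σ.narr 0 s (σ.narr 2 N s)) (fun s => σ.rarr 0 s (σ.narr 2 N s)) ∅ σ' := by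
  refine (Runs.forLoop_le (N := n) (B := 9) (fun i σ' => (∀ s < i,
    σ'.narr 3 0 s = σ.narr 0 s (σ.narr 2 N s) ∧ σ'.rarr 1 0 s = σ.rarr 0 s (σ.narr 2 N s) ∧
    σ'.narr 4 0 s = 0 ∧ σ'.rarr 2 0 s = 0)) hσ.one hσ.hn (by decide) ?_ ?_).conseq ?_
  · exact fun s hs => absurd hs (Nat.not_lt_zero s)
  · rintro i σ' hi hfr hv hI
    have hc := hσ.frame hfr (by decide)
    have e2 : σ'.nvar 2 = N := (hfr.nvar _ (by decide)).trans hN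
    have a0 : σ'.narr 0 = σ.narr 0 := hfr.narr _ (by decide)
    have a2 : σ'.narr 2 = σ.narr 2 := hfr.narr _ (by decide)
    have r0 : σ'.rarr 0 = σ.rarr 0 := hfr.rarr _ (by decide)
    refine Runs.block ⟨by simp, fun s hs => ?_⟩
    rcases Nat.lt_succ_iff_lt_or_eq.1 hs with hlt | rfl
    · have : s ≠ i := hlt.ne
      simp [Instr.apply, update3, hv, hc.zero, this, hI s hlt]
    · simp [Instr.apply, update3, hv, hc.zero, e2, a0, a2, r0]
  · rintro t σ' hfr ⟨ht, hI⟩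
    refine ⟨by omega, ⟨hσ.frame hfr (by decide), fun s hs => (hI s hs).1,
      fun s hs => (hI s hs).2.1⟩, ⟨by simp, by simp, fun s hs => ?_, fun s hs => (hI s hs).2.2.2,
      by simp⟩⟩
    simp [(hI s hs).2.2.1]

/-- The coefficients of the gain of the pair `(s, a)` as computed from the memory. -/
noncomputable def memGain (σ : Mem) (s a i : ℕ) : ℝ :=
  deltaTwo (i + 1) * σ.rarr 0 s a + σ.rarr 2 (i + 1) (σ.narr 0 s a) - σ.rarr 2 i (σ.narr 0 s a) -
    σ.rarr 2 (i + 1) s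

theorem memGain_frame {σ σ' : Mem} {P : Prog} (hf : Frame P σ σ')
    (hP : 0 ∉ P.collect Instr.narrs ∧ 0 ∉ P.collect Instr.rarrs ∧ 2 ∉ P.collect Instr.rarrs) :
    memGain σ' = memGain σ := by
  funext s a i
  rw [memGain, memGain, hf.narr _ hP.1, hf.rarr _ hP.2.1, hf.rarr _ hP.2.2]

/-- Computes the coefficients of the gain of the pair in the variables `33` and `34`. -/
def gainProg : Prog :=
  .seq (.block [.nload 35 0 33 34]) (.forLoop 37 5 (.block [.nadd 13 37 3, .rload 0 3 4 13,
    .rload 1 0 33 34, .rmul 0 0 1, .rload 1 2 13 35, .radd 0 0 1, .rload 1 2 37 35, .rsub 0 0 1,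
    .rload 1 2 13 33, .rsub 0 0 1, .rstore 5 4 37 0]))

theorem runs_gainProg {n k s a : ℕ} {σ : Mem} (hσ : Ctx n k σ) (hs : σ.nvar 33 = s)
    (ha : σ.nvar 34 = a) :
    Runs gainProg σ fun t σ' => t ≤ 14 * n + 46 ∧ ∀ i < n + 3, σ'.rarr 5 0 i = memGain σ s a i := by
  refine Runs.seq (Runs.block ?_)
  have hf0 := Frame.block [.nload 35 0 33 34] σ
  have e35 : (List.foldl Instr.apply σ [.nload 35 0 33 34]).nvar 35 = σ.narr 0 s a := by
    simp [Instr.apply, hs, ha]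
  revert hf0 e35
  generalize List.foldl Instr.apply σ [.nload 35 0 33 34] = σ0
  intro hf0 e35
  have hσ0 := hσ.frame hf0 (by decide)
  refine (Runs.forLoop_le (N := n + 3) (B := 12) (fun i σ' => ∀ j < i,
    σ'.rarr 5 0 j = memGain σ s a j) hσ0.one hσ0.hK (by decide) ?_ ?_).conseq ?_
  · exact fun s hs => absurd hs (Nat.not_lt_zero s)
  · rintro i σ' hi hfr hv hI
    have hc := hσ0.frame hfr (by decide)
    have e33 : σ'.nvar 33 = s := by rw [hfr.nvar _ (by decide), hf0.nvar _ (by decide), hs]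
    have e34 : σ'.nvar 34 = a := by rw [hfr.nvar _ (by decide), hf0.nvar _ (by decide), ha]
    have e35' : σ'.nvar 35 = σ.narr 0 s a := by rw [hfr.nvar _ (by decide), e35]
    have r0 : σ'.rarr 0 = σ.rarr 0 := by rw [hfr.rarr _ (by decide), hf0.rarr _ (by decide)]
    have r2 : σ'.rarr 2 = σ.rarr 2 := by rw [hfr.rarr _ (by decide), hf0.rarr _ (by decide)]
    have hd := hc.delta (i + 1) (by omega)
    refine Runs.block ⟨by simp, fun j hj => ?_⟩
    rcases Nat.lt_succ_iff_lt_or_eq.1 hj with hlt | rfl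
    · have : j ≠ i := hlt.ne
      simp [Instr.apply, update3, hv, hc.zero, this, hI j hlt]
    · simp [Instr.apply, update3, hv, hc.zero, hc.one, e33, e34, e35', r0, r2, hd, memGain]
  · rintro t σ' - ⟨ht, hI⟩
    exact ⟨by simp only [List.length_cons, List.length_nil]; omega, hI⟩

/-- Lexicographic comparison of the best coefficients so far (array `4`) with those of the current
pair (array `5`). Variable `36` tells whether the comparison is decided, variable `39` whether the
current pair is better. -/
def compareProg : Prog :=
  .seq (.block [.nconst 36 0, .nconst 39 0]) (.forLoop 37 5 (.ite (.nlt 4 36) .skip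
    (.seq (.block [.rload 0 4 4 37, .rload 1 5 4 37]) (.ite (.rlt 0 1)
      (.block [.nconst 36 1, .nconst 39 1]) (.ite (.rlt 1 0) (.block [.nconst 36 1]) .skip)))))

theorem runs_compareProg {n k : ℕ} {σ : Mem} (hσ : Ctx n k σ) :
    Runs compareProg σ fun t σ' => t ≤ 11 * n + 38 ∧
      (σ'.nvar 39 = 1 ∧ LexLT (n + 3) (σ.rarr 4 0) (σ.rarr 5 0) ∨
        σ'.nvar 39 = 0 ∧ ¬ LexLT (n + 3) (σ.rarr 4 0) (σ.rarr 5 0)) := by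
  refine Runs.seq (Runs.block ?_)
  have hf0 := Frame.block [.nconst 36 0, .nconst 39 0] σ
  have e36 : (List.foldl Instr.apply σ [.nconst 36 0, .nconst 39 0]).nvar 36 = 0 := by
    simp [Instr.apply]
  have e39 : (List.foldl Instr.apply σ [.nconst 36 0, .nconst 39 0]).nvar 39 = 0 := by
    simp [Instr.apply]
  revert hf0 e36 e39
  generalize List.foldl Instr.apply σ [.nconst 36 0, .nconst 39 0] = σ0
  intro hf0 e36 e39
  have hσ0 := hσ.frame hf0 (by decide)
  refine (Runs.forLoop_le (N := n + 3) (B := 9) (fun i σ' =>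
    (σ'.nvar 36 = 0 ∧ σ'.nvar 39 = 0 ∧ ∀ j < i, σ.rarr 4 0 j = σ.rarr 5 0 j) ∨
    (σ'.nvar 36 = 1 ∧ σ'.nvar 39 = 1 ∧ LexLT (n + 3) (σ.rarr 4 0) (σ.rarr 5 0)) ∨
    (σ'.nvar 36 = 1 ∧ σ'.nvar 39 = 0 ∧ LexLT (n + 3) (σ.rarr 5 0) (σ.rarr 4 0)))
    hσ0.one hσ0.hK (by decide) ?_ ?_).conseq ?_
  · exact Or.inl ⟨by simpa using e36, by simpa using e39, fun j hj => absurd hj (Nat.not_lt_zero j)⟩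
  · rintro i σ' hi hfr hv hI
    have hc := hσ0.frame hfr (by decide)
    have r4 : σ'.rarr 4 = σ.rarr 4 := by rw [hfr.rarr _ (by decide), hf0.rarr _ (by decide)]
    have r5 : σ'.rarr 5 = σ.rarr 5 := by rw [hfr.rarr _ (by decide), hf0.rarr _ (by decide)]
    refine Runs.ite (fun hlt => Runs.skip ⟨by omega, ?_⟩) fun hge => ?_
    · rw [Test.Holds, hc.zero] at hlt
      rcases hI with h | h | h
      · rw [h.1] at hlt; exact absurd hlt (lt_irrefl _)
      · exact Or.inr (Or.inl (by simpa using h))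
      · exact Or.inr (Or.inr (by simpa using h))
    · rw [Test.Holds, hc.zero] at hge
      obtain ⟨h36, h39, heq⟩ : σ'.nvar 36 = 0 ∧ σ'.nvar 39 = 0 ∧
          ∀ j < i, σ.rarr 4 0 j = σ.rarr 5 0 j := by
        rcases hI with h | h | h
        · exact h
        · rw [h.1] at hge; exact absurd one_pos hge
        · rw [h.1] at hge; exact absurd one_pos hge
      refine Runs.seq (Runs.block (Runs.ite (fun h1 => Runs.block ⟨by simp, ?_⟩)
        fun h1 => Runs.ite (fun h2 => Runs.block ⟨by simp, ?_⟩)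
        fun h2 => Runs.skip ⟨by simp, ?_⟩))
      · simp [Test.Holds, Instr.apply, hc.zero, hv, r4, r5] at h1
        refine Or.inr (Or.inl ⟨by simp [Instr.apply], by simp [Instr.apply], i, hi, heq, h1⟩)
      · simp [Test.Holds, Instr.apply, hc.zero, hv, r4, r5] at h2
        refine Or.inr (Or.inr ⟨by simp [Instr.apply], by simp [Instr.apply, h39], i, hi,
          fun j hj => (heq j hj).symm, h2⟩)
      · simp [Test.Holds, Instr.apply, hc.zero, hv, r4, r5] at h1 h2
        refine Or.inl ⟨by simp [Instr.apply, h36], by simp [Instr.apply, h39], fun j hj => ?_⟩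
        rcases Nat.lt_succ_iff_lt_or_eq.1 hj with hlt | rfl
        · exact heq j hlt
        · exact le_antisymm h2 h1
  · rintro t σ' - ⟨ht, hI⟩
    refine ⟨by simp only [List.length_cons, List.length_nil]; omega, ?_⟩
    rcases hI with h | h | h
    · exact Or.inr ⟨h.2.1, fun hl => not_lexLT_self _ _ (hl.congr h.2.2 fun _ _ => rfl)⟩
    · exact Or.inl h.2
    · exact Or.inr ⟨h.2.1, fun hl => not_lexLT_self _ _ (hl.trans h.2.2)⟩

/-- Records the current pair as the best one. -/
def takeProg : Prog :=
  .seq (.block [.nconst 30 1, .nadd 31 33 4, .nadd 32 34 4])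
    (.forLoop 37 5 (.block [.rload 0 5 4 37, .rstore 4 4 37 0]))

theorem runs_takeProg {n k s a : ℕ} {σ : Mem} (hσ : Ctx n k σ) (hs : σ.nvar 33 = s)
    (ha : σ.nvar 34 = a) :
    Runs takeProg σ fun t σ' => t ≤ 5 * n + 21 ∧ σ'.nvar 30 = 1 ∧ σ'.nvar 31 = s ∧
      σ'.nvar 32 = a ∧ ∀ i < n + 3, σ'.rarr 4 0 i = σ.rarr 5 0 i := by
  refine Runs.seq (Runs.block ?_)
  have hf0 := Frame.block [.nconst 30 1, .nadd 31 33 4, .nadd 32 34 4] σ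
  have e : (List.foldl Instr.apply σ [.nconst 30 1, .nadd 31 33 4, .nadd 32 34 4]).nvar 30 = 1 ∧
      (List.foldl Instr.apply σ [.nconst 30 1, .nadd 31 33 4, .nadd 32 34 4]).nvar 31 = s ∧
      (List.foldl Instr.apply σ [.nconst 30 1, .nadd 31 33 4, .nadd 32 34 4]).nvar 32 = a := by
    simp [Instr.apply, hs, ha, hσ.zero]
  revert hf0 e
  generalize List.foldl Instr.apply σ [.nconst 30 1, .nadd 31 33 4, .nadd 32 34 4] = σ0
  rintro hf0 ⟨e30, e31, e32⟩
  have hσ0 := hσ.frame hf0 (by decide)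
  refine (Runs.forLoop_le (N := n + 3) (B := 3) (fun i σ' => ∀ j < i,
    σ'.rarr 4 0 j = σ.rarr 5 0 j) hσ0.one hσ0.hK (by decide) ?_ ?_).conseq ?_
  · exact fun s hs => absurd hs (Nat.not_lt_zero s)
  · rintro i σ' hi hfr hv hI
    have hc := hσ0.frame hfr (by decide)
    have r5 : σ'.rarr 5 = σ.rarr 5 := by rw [hfr.rarr _ (by decide), hf0.rarr _ (by decide)]
    refine Runs.block ⟨by simp, fun j hj => ?_⟩
    rcases Nat.lt_succ_iff_lt_or_eq.1 hj with hlt | rfl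
    · have : j ≠ i := hlt.ne
      simp [Instr.apply, update3, hv, hc.zero, this, hI j hlt]
    · simp [Instr.apply, update3, hv, hc.zero, r5]
  · rintro t σ' hfr ⟨ht, hI⟩
    refine ⟨by simp only [List.length_cons, List.length_nil]; omega, ?_, ?_, ?_, hI⟩
    · rw [hfr.nvar _ (by decide), e30]
    · rw [hfr.nvar _ (by decide), e31]
    · rw [hfr.nvar _ (by decide), e32]

/-- Array `4` holds the largest of zero and of the gains of the pairs in `V`; variable `30` tells
whether it is positive, and if so, the variables `31` and `32` hold a pair attaining it. -/
def SearchInv (n k : ℕ) (G : ℕ → ℕ → ℕ → ℝ) (V : ℕ → ℕ → Prop) (σ : Mem) : Prop :=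
  ∃ b : ℕ → ℝ, (∀ i < n + 3, σ.rarr 4 0 i = b i) ∧ (∀ s a, V s a → ¬ LexLT (n + 3) b (G s a)) ∧
    (σ.nvar 30 = 0 ∧ b = (fun _ => 0) ∨ σ.nvar 30 = 1 ∧ σ.nvar 31 < n ∧ σ.nvar 32 < k ∧
      b = G (σ.nvar 31) (σ.nvar 32) ∧ LexLT (n + 3) (fun _ => 0) b)

theorem SearchInv.congr {n k : ℕ} {G : ℕ → ℕ → ℕ → ℝ} {V V' : ℕ → ℕ → Prop} {σ σ' : Mem}
    (h : SearchInv n k G V σ) (hV : ∀ s a, V' s a → V s a) (h4 : σ'.rarr 4 = σ.rarr 4)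
    (h30 : σ'.nvar 30 = σ.nvar 30) (h31 : σ'.nvar 31 = σ.nvar 31)
    (h32 : σ'.nvar 32 = σ.nvar 32) : SearchInv n k G V' σ' := by
  obtain ⟨b, h1, h2, h3⟩ := h
  refine ⟨b, ?_, fun s a hsa => h2 s a (hV s a hsa), ?_⟩
  · rw [h4]; exact h1
  · rw [h30, h31, h32]; exact h3

/-- Treats the pair in the variables `33` and `34`. -/
def candidateProg : Prog :=
  .seq gainProg (.seq compareProg (.ite (.nlt 4 39) takeProg .skip))

theorem runs_candidateProg {n k s a : ℕ} {σ : Mem} {G : ℕ → ℕ → ℕ → ℝ} {V : ℕ → ℕ → Prop}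
    (hσ : Ctx n k σ) (hG : memGain σ = G) (hs : σ.nvar 33 = s) (ha : σ.nvar 34 = a) (hsn : s < n)
    (hak : a < k) (hI : SearchInv n k G V σ) :
    Runs candidateProg σ fun t σ' => t ≤ 30 * n + 106 ∧
      SearchInv n k G (fun s' a' => V s' a' ∨ s' = s ∧ a' = a) σ' := by
  refine Runs.seq ((runs_gainProg hσ hs ha).conseq ?_)
  rintro t1 σ1 hf1 ⟨ht1, h5⟩
  have hσ1 := hσ.frame hf1 (by decide)
  have hI1 : SearchInv n k G V σ1 := hI.congr (fun _ _ h => h) (hf1.rarr _ (by decide))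
    (hf1.nvar _ (by decide)) (hf1.nvar _ (by decide)) (hf1.nvar _ (by decide))
  rw [hG] at h5
  refine Runs.seq ((runs_compareProg hσ1).conseq ?_)
  rintro t2 σ2 hf2 ⟨ht2, hcmp⟩
  have hσ2 := hσ1.frame hf2 (by decide)
  have hI2 : SearchInv n k G V σ2 := hI1.congr (fun _ _ h => h) (hf2.rarr _ (by decide))
    (hf2.nvar _ (by decide)) (hf2.nvar _ (by decide)) (hf2.nvar _ (by decide))
  have e33 : σ2.nvar 33 = s := by rw [hf2.nvar _ (by decide), hf1.nvar _ (by decide), hs]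
  have e34 : σ2.nvar 34 = a := by rw [hf2.nvar _ (by decide), hf1.nvar _ (by decide), ha]
  rw [← hf2.rarr 4 (by decide), ← hf2.rarr 5 (by decide)] at hcmp
  rw [← hf2.rarr 5 (by decide)] at h5
  obtain ⟨b, hb1, hb2, hb3⟩ := hI2
  refine Runs.ite (fun hlt => ?_) fun hge => Runs.skip ?_
  · rw [Test.Holds, hσ2.zero] at hlt
    have hlex : LexLT (n + 3) b (G s a) := by
      rcases hcmp with h | h
      · exact h.2.congr hb1 h5
      · rw [h.1] at hlt; exact absurd hlt (lt_irrefl _)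
    refine (runs_takeProg hσ2 e33 e34).conseq ?_
    rintro t3 σ3 - ⟨ht3, g30, g31, g32, g4⟩
    refine ⟨by omega, G s a, fun i hi => (g4 i hi).trans (h5 i hi), ?_, Or.inr ⟨g30, g31 ▸ hsn,
      g32 ▸ hak, by rw [g31, g32], ?_⟩⟩
    · rintro s' a' (h | ⟨rfl, rfl⟩) hl
      · exact hb2 s' a' h (hlex.trans hl)
      · exact not_lexLT_self _ _ hl
    · rcases hb3 with h | h
      · rw [← h.2]; exact hlex
      · exact h.2.2.2.2.trans hlex
  · rw [Test.Holds, hσ2.zero] at hge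
    have hlex : ¬ LexLT (n + 3) b (G s a) := by
      rcases hcmp with h | h
      · rw [h.1] at hge; exact absurd one_pos hge
      · exact fun hl => h.2 (hl.congr (fun i hi => (hb1 i hi).symm) fun i hi => (h5 i hi).symm)
    refine ⟨by omega, b, hb1, ?_, hb3⟩
    rintro s' a' (h | ⟨rfl, rfl⟩)
    · exact hb2 s' a' h
    · exact hlex

/-- Searches for a pair of maximal positive gain. -/
def searchProg : Prog :=
  .seq (.block [.nconst 30 0]) (.seq (.forLoop 37 5 (.block [.rzero 0, .rstore 4 4 37 0]))
    (.forLoop 33 0 (.forLoop 34 1 candidateProg)))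

theorem runs_searchProg {n k : ℕ} {σ : Mem} (hσ : Ctx n k σ) (hn : 0 < n) (hk : 0 < k) :
    Runs searchProg σ fun t σ' => t ≤ 180 * (n ^ 2 * k) ∧
      SearchInv n k (memGain σ) (fun s a => s < n ∧ a < k) σ' := by
  refine Runs.seq (Runs.block ?_)
  have hf0 := Frame.block [.nconst 30 0] σ
  have e30 : (List.foldl Instr.apply σ [.nconst 30 0]).nvar 30 = 0 := by simp [Instr.apply]
  revert hf0 e30
  generalize List.foldl Instr.apply σ [.nconst 30 0] = σ0
  intro hf0 e30
  have hσ0 := hσ.frame hf0 (by decide)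
  refine Runs.seq ((Runs.forLoop_le (N := n + 3) (B := 3) (fun i σ' => ∀ j < i,
    σ'.rarr 4 0 j = 0) hσ0.one hσ0.hK (by decide) ?_ ?_).conseq ?_)
  · exact fun s hs => absurd hs (Nat.not_lt_zero s)
  · rintro i σ' hi hfr hv hI
    have hc := hσ0.frame hfr (by decide)
    refine Runs.block ⟨by simp, fun j hj => ?_⟩
    rcases Nat.lt_succ_iff_lt_or_eq.1 hj with hlt | rfl
    · have : j ≠ i := hlt.ne
      simp [Instr.apply, update3, hv, hc.zero, this, hI j hlt]
    · simp [Instr.apply, update3, hv, hc.zero]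
  rintro t1 σ1 hf1 ⟨ht1, h4⟩
  have hσ1 := hσ0.frame hf1 (by decide)
  have hG1 : memGain σ1 = memGain σ :=
    (memGain_frame hf1 (by decide)).trans (memGain_frame hf0 (by decide))
  refine (Runs.forLoop_le (N := n) (B := k * (30 * n + 108) + 2) (fun i σ' =>
    SearchInv n k (memGain σ) (fun s a => s < i ∧ a < k) σ') hσ1.one hσ1.hn (by decide)
    ?_ ?_).conseq ?_
  · refine ⟨fun _ => 0, h4, fun s a h => absurd h.1 (Nat.not_lt_zero s), Or.inl ⟨?_, rfl⟩⟩
    simp [hf1.nvar 30 (by decide), e30]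
  · rintro i σ' hi hfr hv hI
    have hc := hσ1.frame hfr (by decide)
    have hG := (memGain_frame hfr (by decide)).trans hG1
    refine (Runs.forLoop_le (N := k) (B := 30 * n + 106) (fun j σ'' =>
      SearchInv n k (memGain σ) (fun s a => s < i ∧ a < k ∨ s = i ∧ a < j) σ'') hc.one hc.hk
      (by decide) ?_ ?_).conseq ?_
    · exact hI.congr (fun s a h => h.resolve_right fun h' => Nat.not_lt_zero a h'.2) rfl
        (by simp) (by simp) (by simp)
    · rintro j σ'' hj hfr' hv' hI'
      refine (runs_candidateProg (hc.frame hfr' (by decide))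
        ((memGain_frame hfr' (by decide)).trans hG) ((hfr'.nvar _ (by decide)).trans hv) hv' hi hj
        hI').conseq ?_
      rintro t σ3 - ⟨ht, h⟩
      refine ⟨ht, h.congr (fun s a h => ?_) rfl (by simp) (by simp) (by simp)⟩
      rcases h with h | ⟨h, h'⟩
      · exact Or.inl (Or.inl h)
      · rcases Nat.lt_succ_iff_lt_or_eq.1 h' with h'' | h''
        · exact Or.inl (Or.inr ⟨h, h''⟩)
        · exact Or.inr ⟨h, h''⟩
    · rintro t σ'' - ⟨ht, h⟩
      refine ⟨ht, h.congr (fun s a h => ?_) rfl (by simp) (by simp) (by simp)⟩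
      rcases Nat.lt_succ_iff_lt_or_eq.1 h.1 with h' | h'
      · exact Or.inl ⟨h', h.2⟩
      · exact Or.inr ⟨h', h.2⟩
  · rintro t2 σ2 - ⟨ht2, h⟩
    refine ⟨?_, h⟩
    simp only [List.length_cons, List.length_nil]
    have e : n * (k * (30 * n + 108) + 2 + 2) = 30 * (n ^ 2 * k) + 108 * (n * k) + 4 * n := by ring
    have h1 : n ≤ n ^ 2 := Nat.le_self_pow two_ne_zero n
    have h2 : n * k ≤ n ^ 2 * k := Nat.mul_le_mul_right k h1
    have h3 : n ≤ n * k := Nat.le_mul_of_pos_right n hk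
    omega

end BlackwellDMDP

namespace BlackwellDMDP

open Function

/-! ### The program and its running time -/

/-- Appends the policy in which the action of state `31` is switched to the action in variable
`32`. -/
def appendProg : Prog :=
  .seq (.block [.nadd 40 2 3]) (.seq
    (.forLoop 33 0 (.block [.nload 13 2 2 33, .nstore 2 40 33 13]))
    (.block [.nstore 2 40 31 32, .nadd 2 40 4]))

theorem runs_appendProg {n k N x a : ℕ} {σ : Mem} (hσ : Ctx n k σ) (hN : σ.nvar 2 = N)
    (hx : σ.nvar 31 = x) (ha : σ.nvar 32 = a) :
    Runs appendProg σ fun t σ' => t ≤ 5 * n + 7 ∧ σ'.nvar 2 = N + 1 ∧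
      (∀ t ≠ N + 1, σ'.narr 2 t = σ.narr 2 t) ∧
      ∀ s < n, σ'.narr 2 (N + 1) s = if s = x then a else σ.narr 2 N s := by
  refine Runs.seq (Runs.block ?_)
  have hf0 := Frame.block [.nadd 40 2 3] σ
  have e40 : (List.foldl Instr.apply σ [.nadd 40 2 3]).nvar 40 = N + 1 := by
    simp [Instr.apply, hN, hσ.one]
  revert hf0 e40
  generalize List.foldl Instr.apply σ [.nadd 40 2 3] = σ0
  intro hf0 e40
  have hσ0 := hσ.frame hf0 (by decide)
  refine Runs.seq ((Runs.forLoop_le (N := n) (B := 3) (fun i σ' =>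
    (∀ t ≠ N + 1, σ'.narr 2 t = σ.narr 2 t) ∧ ∀ s < i, σ'.narr 2 (N + 1) s = σ.narr 2 N s)
    hσ0.one hσ0.hn (by decide) ?_ ?_).conseq ?_)
  · exact ⟨fun t _ => congrFun (hf0.narr 2 (by decide)) t, fun s hs =>
      absurd hs (Nat.not_lt_zero s)⟩
  · rintro i σ' hi hfr hv ⟨h1, h2⟩
    have e2 : σ'.nvar 2 = N := by rw [hfr.nvar _ (by decide), hf0.nvar _ (by decide), hN]
    have e40' : σ'.nvar 40 = N + 1 := by rw [hfr.nvar _ (by decide), e40]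
    refine Runs.block ⟨by simp, fun t ht => ?_, fun s hs => ?_⟩
    · rw [← h1 t ht]
      funext s
      simp [Instr.apply, update3, e40', ht]
    · rcases Nat.lt_succ_iff_lt_or_eq.1 hs with hlt | rfl
      · have : s ≠ i := hlt.ne
        simp [Instr.apply, update3, hv, e40', this, h2 s hlt]
      · simp [Instr.apply, update3, hv, e40', e2, h1 N (by omega)]
  · rintro t σ' hfr ⟨ht, h1, h2⟩
    have e40' : σ'.nvar 40 = N + 1 := by rw [hfr.nvar _ (by decide), e40]
    have e31 : σ'.nvar 31 = x := by rw [hfr.nvar _ (by decide), hf0.nvar _ (by decide), hx]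
    have e32 : σ'.nvar 32 = a := by rw [hfr.nvar _ (by decide), hf0.nvar _ (by decide), ha]
    have e4 : σ'.nvar 4 = 0 := by rw [hfr.nvar _ (by decide), hσ0.zero]
    refine Runs.block ⟨by simp only [List.length_cons, List.length_nil]; omega, ?_, fun t ht => ?_,
      fun s hs => ?_⟩
    · simp [Instr.apply, e40', e4]
    · rw [← h1 t ht]
      funext s
      simp [Instr.apply, update3, e40', ht]
    · by_cases hsx : s = x
      · simp [Instr.apply, update3, e40', e31, e32, hsx]
      · simp [Instr.apply, update3, e40', e31, hsx, h2 s hs]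

/-- One iteration of the Max-Gain procedure; variable `8` is set to zero when it stops. -/
def iterationProg : Prog :=
  .seq prepareProg (.seq evalProg (.seq searchProg
    (.ite (.nlt 4 30) appendProg (.block [.nconst 8 0]))))

/-- The memory during the procedure: after `N` iterations the policies visited so far are
`p 0, …, p N`. -/
structure LoopInv {n k : ℕ} (M : DMDP (Fin n) (Fin k)) (p : ℕ → Fin n → Fin k) (N : ℕ) (σ : Mem) :
    Prop where
  ctx : Ctx n k σ
  next : ∀ (s : Fin n) (a : Fin k), σ.narr 0 s a = M.next s a
  reward : ∀ (s : Fin n) (a : Fin k), σ.rarr 0 s a = M.reward s a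
  out : HoldsOutput p N σ

theorem runs_iterationProg {n k N : ℕ} {M : DMDP (Fin n) (Fin k)} {p : ℕ → Fin n → Fin k}
    {σ : Mem} (hn : 0 < n) (hI : LoopInv M p N σ) (h8 : σ.nvar 8 = 1) :
    Runs iterationProg σ fun t σ' => t ≤ 480 * (n ^ 2 * k) ∧
      (M.IsTerminal (p N) ∧ LoopInv M p N σ' ∧ σ'.nvar 8 = 0 ∨
        ∃ π', M.Step (p N) π' ∧ LoopInv M (update p (N + 1) π') (N + 1) σ' ∧ σ'.nvar 8 = 1) := by
  have hk : 0 < k := (p N ⟨0, hn⟩).pos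
  have hσ := hI.ctx
  have hpol : ∀ s : Fin n, σ.narr 2 N s = p N s := hI.out.2 N le_rfl
  refine Runs.seq ((runs_prepareProg hσ hI.out.1).conseq ?_)
  rintro t1 σ1 hf1 ⟨ht1, hctx1, hinv1⟩
  have hfn : ∀ s < n, σ.narr 0 s (σ.narr 2 N s) < n := by
    intro s hs
    rw [hpol ⟨s, hs⟩, hI.next ⟨s, hs⟩]
    exact Fin.is_lt _
  refine Runs.seq ((runs_evalProg hn hctx1 hfn hinv1).conseq ?_)
  rintro t2 σ2 hf2 ⟨ht2, hW0, hW⟩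
  have hσ2 := hctx1.toCtx.frame hf2 (by decide)
  have a0 : σ2.narr 0 = σ.narr 0 := by rw [hf2.narr _ (by decide), hf1.narr _ (by decide)]
  have r0 : σ2.rarr 0 = σ.rarr 0 := by rw [hf2.rarr _ (by decide), hf1.rarr _ (by decide)]
  have hexp : M.IsExpansion (p N) (Fintype.card (Fin n) + 4) fun i s => σ2.rarr 2 i s := by
    rw [Fintype.card_fin]
    refine ⟨fun s => hW0 s s.2, fun i hi s => ?_⟩
    have := hW i hi s s.2
    rwa [hpol, hI.next, hI.reward] at this
  have hgain : ∀ (s : Fin n) (a : Fin k), memGain σ2 s a =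
      M.gainCoeff (fun i s => σ2.rarr 2 i s) s a := by
    intro s a
    funext i
    rw [memGain, DMDP.gainCoeff, a0, r0, hI.next, hI.reward]
  have hgt0 : ∀ (s : Fin n) (a : Fin k), MuGT (M.ratGain (p N) s a) 0 ↔
      LexLT (n + 3) (fun _ => 0) (memGain σ2 s a) := by
    intro s a
    rw [hexp.muGT_zero_iff, Fintype.card_fin, hgain]
  have hgt : ∀ (s : Fin n) (a : Fin k) (s' : Fin n) (a' : Fin k),
      MuGT (M.ratGain (p N) s a) (M.ratGain (p N) s' a') ↔
      LexLT (n + 3) (memGain σ2 s' a') (memGain σ2 s a) := by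
    intro s a s' a'
    rw [hexp.muGT_iff, Fintype.card_fin, hgain, hgain]
  refine Runs.seq ((runs_searchProg hσ2 hn hk).conseq ?_)
  rintro t3 σ3 hf3 ⟨ht3, b, -, hmax, hb⟩
  have hσ3 := hσ2.frame hf3 (by decide)
  have a0' : σ3.narr 0 = σ.narr 0 := by rw [hf3.narr _ (by decide), a0]
  have r0' : σ3.rarr 0 = σ.rarr 0 := by rw [hf3.rarr _ (by decide), r0]
  have a2' : σ3.narr 2 = σ.narr 2 := by
    rw [hf3.narr _ (by decide), hf2.narr _ (by decide), hf1.narr _ (by decide)]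
  have v2 : σ3.nvar 2 = N := by
    rw [hf3.nvar _ (by decide), hf2.nvar _ (by decide), hf1.nvar _ (by decide), hI.out.1]
  have v8 : σ3.nvar 8 = 1 := by
    rw [hf3.nvar _ (by decide), hf2.nvar _ (by decide), hf1.nvar _ (by decide), h8]
  have hn2 : n ≤ n ^ 2 := Nat.le_self_pow two_ne_zero n
  have hn2k : n ^ 2 ≤ n ^ 2 * k := Nat.le_mul_of_pos_right _ hk
  refine Runs.ite (fun hlt => ?_) fun hge => Runs.block ?_
  · rw [Test.Holds, hσ3.zero] at hlt
    obtain ⟨-, h31, h32, rfl, hpos⟩ := hb.resolve_left fun h => by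
      rw [h.1] at hlt; exact lt_irrefl _ hlt
    refine (runs_appendProg hσ3 v2 rfl rfl).conseq ?_
    rintro t4 σ4 hf4 ⟨ht4, g2, gold, gnew⟩
    refine ⟨by omega, Or.inr ⟨update (p N) ⟨σ3.nvar 31, h31⟩ ⟨σ3.nvar 32, h32⟩,
      ⟨⟨σ3.nvar 31, h31⟩, ⟨σ3.nvar 32, h32⟩, fun s a => ?_, ?_, rfl⟩, ⟨hσ3.frame hf4 (by decide),
      fun s a => ?_, fun s a => ?_, g2, fun t ht s => ?_⟩, ?_⟩⟩
    · rw [hgt]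
      exact hmax s a ⟨s.2, a.2⟩
    · rw [hgt0]
      exact hpos
    · rw [hf4.narr _ (by decide), a0', hI.next]
    · rw [hf4.rarr _ (by decide), r0', hI.reward]
    · rcases Nat.le_succ_iff.1 ht with h | rfl
      · rw [gold t (by omega), update_of_ne (by omega), a2', hI.out.2 t h]
      · rw [gnew s s.2, update_self]
        by_cases hs : s = ⟨σ3.nvar 31, h31⟩
        · simp [hs]
        · have : (s : ℕ) ≠ σ3.nvar 31 := fun h => hs (Fin.ext h)
          rw [if_neg this, update_of_ne hs, a2', hpol]
    · rw [hf4.nvar _ (by decide), v8]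
  · rw [Test.Holds, hσ3.zero] at hge
    obtain ⟨-, rfl⟩ := hb.resolve_right fun h => by
      rw [h.1] at hge; exact hge one_pos
    refine ⟨by simp only [List.length_cons, List.length_nil]; omega, Or.inl ⟨fun s a => ?_,
      ⟨hσ3.frame (Frame.block _ _) (by decide), fun s a => ?_, fun s a => ?_, ?_, fun t ht s => ?_⟩,
      ?_⟩⟩
    · rw [hgt0]
      exact hmax s a ⟨s.2, a.2⟩
    · simp [Instr.apply, a0', hI.next]
    · simp [Instr.apply, r0', hI.reward]
    · simp [Instr.apply, v2]
    · simp [Instr.apply, a2', hI.out.2 t ht]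
    · simp [Instr.apply]

theorem DMDP.IsRun.update_succ {n k N : ℕ} {M : DMDP (Fin n) (Fin k)} {π₀ π' : Fin n → Fin k}
    {p : ℕ → Fin n → Fin k} (h : M.IsRun π₀ p N) (hs : M.Step (p N) π') :
    M.IsRun π₀ (update p (N + 1) π') (N + 1) := by
  refine ⟨by rw [update_of_ne (by omega), h.1], fun t ht => ?_⟩
  rcases Nat.lt_succ_iff_lt_or_eq.1 ht with hlt | rfl
  · rw [update_of_ne (by omega), update_of_ne (by omega)]
    exact h.2 t hlt
  · rw [update_self, update_of_ne (by omega)]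
    exact hs

/-- The remaining number `m` of iterations is controlled by the bound on the length of runs. -/
theorem runs_while_iterationProg {n k : ℕ} {M : DMDP (Fin n) (Fin k)} {π₀ : Fin n → Fin k}
    (hn : 0 < n) (m N : ℕ) (p : ℕ → Fin n → Fin k) (σ : Mem)
    (hm : N + m = DMDP.runBound (Fin n) (Fin k)) (hrun : M.IsRun π₀ p N) (hI : LoopInv M p N σ)
    (h8 : σ.nvar 8 = 1) :
    Runs (.while (.nlt 4 8) iterationProg) σ fun t σ' => t ≤ m * (480 * (n ^ 2 * k) + 1) + 1 ∧
      ∃ p N, M.IsRun π₀ p N ∧ M.IsTerminal (p N) ∧ HoldsOutput p N σ' := by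
  have : Nonempty (Fin n) := ⟨⟨0, hn⟩⟩
  induction m generalizing N p σ with
  | zero => exact absurd (M.run_lt_runBound hrun) (by omega)
  | succ m ih =>
    have hb : Test.Holds σ (.nlt 4 8) := by rw [Test.Holds, hI.ctx.zero, h8]; exact one_pos
    obtain ⟨t, σ', hE, ht, hcase⟩ := runs_iterationProg hn hI h8
    have hmul : (m + 1) * (480 * (n ^ 2 * k) + 1) =
        m * (480 * (n ^ 2 * k) + 1) + (480 * (n ^ 2 * k) + 1) := by ring
    rcases hcase with ⟨hterm, hI', h8'⟩ | ⟨π', hstep, hI', h8'⟩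
    · refine ⟨_, _, Exec.while_true hb hE (Exec.while_false ?_), by omega, p, N, hrun, hterm,
        hI'.out⟩
      rw [Test.Holds, hI'.ctx.zero, h8']
      exact lt_irrefl _
    · obtain ⟨u, σ'', hE', hu, hres⟩ := ih (N + 1) _ σ' (by omega)
        (DMDP.IsRun.update_succ hrun hstep) hI' h8'
      exact ⟨_, _, Exec.while_true hb hE hE', by omega, hres⟩

/-- Sets up the constants and copies the initial policy. -/
def initProg : Prog :=
  .seq (.block [.nconst 3 1, .nconst 4 0, .nconst 2 0, .nconst 8 1, .nconst 13 3, .nadd 5 0 13,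
    .nadd 6 5 3, .nadd 7 6 3, .nadd 7 7 3])
  (.seq (.forLoop 10 7 (.block [.rzero 0, .rstore 3 4 10 0]))
  (.seq (.block [.rone 0, .nconst 13 2, .rstore 3 4 13 0])
    (.forLoop 10 0 (.block [.nload 13 1 10 4, .nstore 2 4 10 13]))))

theorem runs_initProg {n k : ℕ} {M : DMDP (Fin n) (Fin k)} {π₀ : Fin n → Fin k} {σ : Mem}
    (hσ : HoldsInput M π₀ σ) : Runs initProg σ fun t σ' => t ≤ 10 * n + 48 ∧
      LoopInv M (fun _ => π₀) 0 σ' ∧ σ'.nvar 8 = 1 := by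
  obtain ⟨hn, hk, hnext, hpol, hrew⟩ := hσ
  refine Runs.seq (Runs.block ?_)
  set l : List Instr := [.nconst 3 1, .nconst 4 0, .nconst 2 0, .nconst 8 1, .nconst 13 3,
    .nadd 5 0 13, .nadd 6 5 3, .nadd 7 6 3, .nadd 7 7 3] with hl
  have hf0 := Frame.block l σ
  obtain ⟨e0, e1, e2, e3, e4, e5, e6, e7, e8⟩ :
      (List.foldl Instr.apply σ l).nvar 0 = n ∧ (List.foldl Instr.apply σ l).nvar 1 = k ∧
      (List.foldl Instr.apply σ l).nvar 2 = 0 ∧ (List.foldl Instr.apply σ l).nvar 3 = 1 ∧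
      (List.foldl Instr.apply σ l).nvar 4 = 0 ∧ (List.foldl Instr.apply σ l).nvar 5 = n + 3 ∧
      (List.foldl Instr.apply σ l).nvar 6 = n + 4 ∧ (List.foldl Instr.apply σ l).nvar 7 = n + 6 ∧
      (List.foldl Instr.apply σ l).nvar 8 = 1 := by
    simp [hl, Instr.apply, hn, hk]
  have hlen : l.length = 9 := rfl
  revert hf0 e0 e1 e2 e3 e4 e5 e6 e7 e8
  generalize List.foldl Instr.apply σ l = σ0
  intro hf0 e0 e1 e2 e3 e4 e5 e6 e7 e8
  refine Runs.seq ((Runs.forLoop_le (N := n + 6) (B := 3) (fun i σ' => ∀ j < i,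
    σ'.rarr 3 0 j = 0) e3 e7 (by decide) ?_ ?_).conseq ?_)
  · exact fun s hs => absurd hs (Nat.not_lt_zero s)
  · rintro i σ' hi hfr hv hI
    have e4' : σ'.nvar 4 = 0 := by rw [hfr.nvar _ (by decide), e4]
    refine Runs.block ⟨by simp, fun j hj => ?_⟩
    rcases Nat.lt_succ_iff_lt_or_eq.1 hj with hlt | rfl
    · have : j ≠ i := hlt.ne
      simp [Instr.apply, update3, hv, e4', this, hI j hlt]
    · simp [Instr.apply, update3, hv, e4']
  rintro t1 σ1 hf1 ⟨ht1, hz⟩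
  refine Runs.seq (Runs.block ?_)
  have hf2 := Frame.block [.rone 0, .nconst 13 2, .rstore 3 4 13 0] σ1
  have e4' : σ1.nvar 4 = 0 := by rw [hf1.nvar _ (by decide), e4]
  have hd : ∀ i ≤ n + 5, (List.foldl Instr.apply σ1
      [.rone 0, .nconst 13 2, .rstore 3 4 13 0]).rarr 3 0 i = deltaTwo i := by
    intro i hi
    by_cases h2 : i = 2
    · simp [Instr.apply, update3, e4', h2, deltaTwo]
    · simp [Instr.apply, update3, e4', h2, deltaTwo, hz i (by omega)]
  revert hf2 hd
  generalize List.foldl Instr.apply σ1 [.rone 0, .nconst 13 2, .rstore 3 4 13 0] = σ2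
  intro hf2 hd
  have hctx : Ctx n k σ2 := by
    refine ⟨?_, ?_, ?_, ?_, ?_, ?_, hd⟩ <;> rw [hf2.nvar _ (by decide), hf1.nvar _ (by decide)]
    exacts [e0, e1, e3, e4, e5, e6]
  have a1 : σ2.narr 1 = σ.narr 1 := by
    rw [hf2.narr _ (by decide), hf1.narr _ (by decide), hf0.narr _ (by decide)]
  refine (Runs.forLoop_le (N := n) (B := 3) (fun i σ' => ∀ j < i,
    σ'.narr 2 0 j = σ.narr 1 j 0) hctx.one hctx.hn (by decide) ?_ ?_).conseq ?_
  · exact fun s hs => absurd hs (Nat.not_lt_zero s)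
  · rintro i σ' hi hfr hv hI
    have hc := hctx.frame hfr (by decide)
    have a1' : σ'.narr 1 = σ.narr 1 := by rw [hfr.narr _ (by decide), a1]
    refine Runs.block ⟨by simp, fun j hj => ?_⟩
    rcases Nat.lt_succ_iff_lt_or_eq.1 hj with hlt | rfl
    · have : j ≠ i := hlt.ne
      simp [Instr.apply, update3, hv, hc.zero, this, hI j hlt]
    · simp [Instr.apply, update3, hv, hc.zero, a1']
  · rintro t3 σ3 hf3 ⟨ht3, hI⟩
    refine ⟨?_, ⟨hctx.frame hf3 (by decide), fun s a => ?_, fun s a => ?_, ?_, fun t ht s => ?_⟩,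
      ?_⟩
    · simp only [List.length_cons, List.length_nil, hlen]
      omega
    · rw [hf3.narr _ (by decide), hf2.narr _ (by decide), hf1.narr _ (by decide),
        hf0.narr _ (by decide), hnext]
    · rw [hf3.rarr _ (by decide), hf2.rarr _ (by decide), hf1.rarr _ (by decide),
        hf0.rarr _ (by decide), hrew]
    · rw [hf3.nvar _ (by decide), hf2.nvar _ (by decide), hf1.nvar _ (by decide), e2]
    · rw [Nat.le_zero.1 ht, hI s s.2, hpol]
    · rw [hf3.nvar _ (by decide), hf2.nvar _ (by decide), hf1.nvar _ (by decide), e8]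

/-- The Max-Gain procedure. -/
def maxGainProg : Prog := .seq initProg (.while (.nlt 4 8) iterationProg)

theorem runs_maxGainProg {n k : ℕ} {M : DMDP (Fin n) (Fin k)} {π₀ : Fin n → Fin k} {σ : Mem}
    (hn : 0 < n) (hσ : HoldsInput M π₀ σ) :
    Runs maxGainProg σ fun t σ' =>
      t ≤ 600 * (n ^ 2 * k) * (DMDP.runBound (Fin n) (Fin k) + 1) ∧
      ∃ p N, M.IsRun π₀ p N ∧ M.IsTerminal (p N) ∧ HoldsOutput p N σ' := by
  refine Runs.seq ((runs_initProg hσ).conseq ?_)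
  rintro t1 σ1 - ⟨ht1, hI, h8⟩
  refine (runs_while_iterationProg (π₀ := π₀) hn _ 0 _ σ1 (Nat.zero_add _)
    ⟨rfl, fun t ht => absurd ht (Nat.not_lt_zero t)⟩ hI h8).conseq ?_
  rintro t2 σ2 - ⟨ht2, h⟩
  refine ⟨?_, h⟩
  have hk : 0 < k := (π₀ ⟨0, hn⟩).pos
  have hn2 : n ≤ n ^ 2 := Nat.le_self_pow two_ne_zero n
  have hn2k : n ^ 2 ≤ n ^ 2 * k := Nat.le_mul_of_pos_right _ hk
  generalize DMDP.runBound (Fin n) (Fin k) = R at *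
  have h1 : R * (480 * (n ^ 2 * k) + 1) ≤ R * (600 * (n ^ 2 * k)) :=
    Nat.mul_le_mul_left R (by omega)
  have h2 : 600 * (n ^ 2 * k) * (R + 1) = R * (600 * (n ^ 2 * k)) + 600 * (n ^ 2 * k) := by ring
  omega

/-! ### The bound in terms of `n` and `k` -/

theorem runBound_add_one_le {n k : ℕ} (hn : 0 < n) (hk : 0 < k) :
    DMDP.runBound (Fin n) (Fin k) + 1 ≤ 55 * ((Nat.log 2 n + 1) ^ 2 * (n ^ 5 * k ^ 2)) := by
  rw [DMDP.runBound, DMDP.phaseBound]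
  simp only [Fintype.card_sum, Fintype.card_prod, Fintype.card_fin, Fintype.card_bool]
  set l := Nat.log 2 n + 1 with hl
  have h1 : 1 ≤ n * k := Nat.mul_pos hn hk
  have h2 : n ≤ n * k := Nat.le_mul_of_pos_right n hk
  have h3 : 1 ≤ l ^ 2 * (n ^ 5 * k ^ 2) := by
    have : 0 < l := Nat.succ_pos _
    exact Nat.succ_le_of_lt (by positivity)
  calc 2 * l * n * (3 * l * n ^ 2 * (n * k + n + 1)) * (n * k * 2 + 1) + 1
      ≤ 2 * l * n * (3 * l * n ^ 2 * (3 * (n * k))) * (3 * (n * k)) + 1 := by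
        gcongr <;> omega
    _ = 54 * (l ^ 2 * (n ^ 5 * k ^ 2)) + 1 := by ring
    _ ≤ _ := by omega

theorem natLog_succ_le_mul_log {n : ℕ} (hn : 2 ≤ n) :
    ((Nat.log 2 n + 1 : ℕ) : ℝ) ≤ 3 * Real.log n := by
  have hn' : (2 : ℝ) ≤ n := by exact_mod_cast hn
  have h2 := Real.log_two_gt_d9
  have h3 : Real.log 2 ≤ Real.log n := Real.log_le_log two_pos hn'
  have h4 : (Nat.log 2 n : ℝ) * Real.log 2 ≤ Real.log n := by
    rw [← Real.log_pow]
    refine Real.log_le_log (by positivity) ?_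
    exact_mod_cast Nat.pow_log_le_self 2 (by omega)
  push_cast
  nlinarith

theorem runBound_mul_le_bound {n k : ℕ} (hn : 2 ≤ n) (hk : 0 < k) :
    ((600 * (n ^ 2 * k) * (DMDP.runBound (Fin n) (Fin k) + 1) : ℕ) : ℝ) ≤ 297000 * bound n k := by
  have h1 : 600 * (n ^ 2 * k) * (DMDP.runBound (Fin n) (Fin k) + 1) ≤
      33000 * (n ^ 7 * k ^ 3 * (Nat.log 2 n + 1) ^ 2) := by
    refine (Nat.mul_le_mul_left _ (runBound_add_one_le (by omega) hk)).trans_eq ?_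
    ring
  have h2 := natLog_succ_le_mul_log hn
  have h3 : ((Nat.log 2 n + 1 : ℕ) : ℝ) ^ 2 ≤ (3 * Real.log n) ^ 2 :=
    pow_le_pow_left₀ (Nat.cast_nonneg _) h2 2
  calc ((600 * (n ^ 2 * k) * (DMDP.runBound (Fin n) (Fin k) + 1) : ℕ) : ℝ)
      ≤ ((33000 * (n ^ 7 * k ^ 3 * (Nat.log 2 n + 1) ^ 2) : ℕ) : ℝ) := by exact_mod_cast h1
    _ = 33000 * ((n : ℝ) ^ 7 * (k : ℝ) ^ 3 * ((Nat.log 2 n + 1 : ℕ) : ℝ) ^ 2) := by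
        push_cast; ring
    _ ≤ 33000 * ((n : ℝ) ^ 7 * (k : ℝ) ^ 3 * (3 * Real.log n) ^ 2) := by gcongr
    _ = 297000 * bound n k := by rw [bound]; ring

end BlackwellDMDP

theorem mainTheorem3 :
    ∃ (C : ℝ) (P : BlackwellDMDP.Prog),
      ∀ (n k : ℕ), 0 < n → ∀ (M : BlackwellDMDP.DMDP (Fin n) (Fin k)) (π₀ : Fin n → Fin k),
        -- the rule can be applied to every policy that is not terminal
        (∀ π : Fin n → Fin k, ¬ M.IsTerminal π → ∃ π' : Fin n → Fin k, M.Step π π') ∧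
        -- every sequence of iterations is finite, of length `O(n^7 k^3 log^2 n)`
        (¬ ∃ p : ℕ → Fin n → Fin k, ∀ N : ℕ, M.IsRun π₀ p N) ∧
        (∀ (p : ℕ → Fin n → Fin k) (N : ℕ), M.IsRun π₀ p N →
          2 ≤ n → (N : ℝ) ≤ C * BlackwellDMDP.bound n k) ∧
        -- and it can only end in a Blackwell optimal policy
        (∀ (p : ℕ → Fin n → Fin k) (N : ℕ), M.IsRun π₀ p N → M.IsTerminal (p N) →
          M.IsBlackwellOptimal (p N)) ∧
        -- the program carries the procedure out in `O(n^7 k^3 log^2 n)` elementary steps in all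
        (∀ σ : BlackwellDMDP.Mem, BlackwellDMDP.HoldsInput M π₀ σ →
          ∃ (t : ℕ) (σ' : BlackwellDMDP.Mem) (p : ℕ → Fin n → Fin k) (N : ℕ),
            BlackwellDMDP.Exec P σ t σ' ∧
            M.IsRun π₀ p N ∧ M.IsTerminal (p N) ∧ M.IsBlackwellOptimal (p N) ∧
            BlackwellDMDP.HoldsOutput p N σ' ∧
            (2 ≤ n → (t : ℝ) ≤ C * BlackwellDMDP.bound n k)) := by
  refine ⟨297000, BlackwellDMDP.maxGainProg, fun n k hn M π₀ => ?_⟩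
  have : Nonempty (Fin n) := ⟨⟨0, hn⟩⟩
  have hk : 0 < k := (π₀ ⟨0, hn⟩).pos
  refine ⟨fun π => M.exists_step, ?_, fun p N h hn2 => ?_, fun p N _ ht => ht.isBlackwellOptimal,
    fun σ hσ => ?_⟩
  · rintro ⟨p, hp⟩
    exact lt_irrefl _ (M.run_lt_runBound (hp (BlackwellDMDP.DMDP.runBound (Fin n) (Fin k))))
  · refine le_trans ?_ (BlackwellDMDP.runBound_mul_le_bound hn2 hk)
    have h1 := M.run_lt_runBound h
    have h2 : BlackwellDMDP.DMDP.runBound (Fin n) (Fin k) + 1 ≤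
        600 * (n ^ 2 * k) * (BlackwellDMDP.DMDP.runBound (Fin n) (Fin k) + 1) :=
      Nat.le_mul_of_pos_left _ (by positivity)
    exact_mod_cast (by omega : N ≤ _)
  · obtain ⟨t, σ', hE, ht, p, N, h1, h2, h3⟩ := BlackwellDMDP.runs_maxGainProg hn hσ
    exact ⟨t, σ', p, N, hE, h1, h2, h2.isBlackwellOptimal, h3, fun hn2 =>
      (Nat.cast_le.2 ht).trans (BlackwellDMDP.runBound_mul_le_bound hn2 hk)⟩
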